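/- Let $k$ be a field and let $X$ be a non-empty proper $k$-scheme of pure dimension $n$, i.e. all irreducible components of $X$ have dimension $n$ ($X$ may be reducible, non-reduced or singular). Let $\Delta_X\subset X\times_k X$ be the diagonal and suppose that $$[\Delta_X]=[X\times z]+[Z_X]\in \operatorname{CH}_n(X\times_k X),$$ where $z\in Z_0(X)$ is a $0$-cycle on $X$ and $Z_X$ is an $n$-cycle on $X\times_k X$ which does not dominate any irreducible component of the first factor. Here $[\Delta_X]$ is the fundamental cycle of the diagonal, and $X\times z=\sum_i a_i\,[X\times_k\{x_i\}]$ for $z=\sum_i a_i\,x_i$ with $x_i\in X$ closed points, where $[X\times_k\{x_i\}]$ denotes the fundamental cycle of the closed subscheme $X\times_k\operatorname{Spec}\kappa(x_i)$; components are counted with multiplicity, namely the length of the local ring at their generic point. Then: 1. the $0$-cycle $z$ has degree one, i.e. $\deg z=\sum_i a_i\,[\kappa(x_i):k]=1$; 2. $X$ is geometrically connected, i.e. $X\times_k\operatorname{Spec}K$ is connected for every field extension $K/k$. -/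

import Mathlib

open AlgebraicGeometry CategoryTheory CategoryTheory.Limits TopologicalSpace Topology

universe u

namespace ChowTheory

/-! ### Local finiteness of the set of generic points of a closed subset -/

/-- The points of a subset `C` which are generic points of its irreducible components. -/
def maximalPoints {T : Type*} [TopologicalSpace T] (C : Set T) : Set T :=
  {x | x ∈ C ∧ ∀ y ∈ C, y ⤳ x → y = x}

lemma finite_maximalPoints_of_noetherianSpace {T : Type*} [TopologicalSpace T] [NoetherianSpace T]
    [QuasiSober T] [T0Space T] : (maximalPoints (Set.univ : Set T)).Finite := by
  refine (genericPoints.finite NoetherianSpace.finite_irreducibleComponents).subset ?_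
  intro x hx
  obtain ⟨Z, hZ, hxZ⟩ := exists_mem_irreducibleComponents_subset_of_isIrreducible
    (closure {x}) isIrreducible_singleton.closure
  obtain ⟨y, hy⟩ := QuasiSober.sober hZ.1 (isClosed_of_mem_irreducibleComponents Z hZ)
  have hyx : y ⤳ x := hy.specializes (hxZ (subset_closure rfl))
  have := hx.2 y trivial hyx
  subst this
  change closure {y} ∈ irreducibleComponents T
  rw [hy.def]
  exact hZ

lemma exists_nhds_finite_inter_maximalPoints {X : Scheme.{u}} [IsLocallyNoetherian X]
    {C : Set X} (hC : IsClosed C) (z : X) : ∃ t ∈ 𝓝 z, (t ∩ maximalPoints C).Finite := by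
  obtain ⟨_, ⟨V, hV, rfl⟩, hzV, -⟩ := X.isBasis_affineOpens.exists_subset_of_mem_open
    (Set.mem_univ z) isOpen_univ
  refine ⟨V, V.isOpen.mem_nhds hzV, ?_⟩
  have : IsNoetherianRing Γ(X, V) := IsLocallyNoetherian.component_noetherian ⟨V, hV⟩
  have : NoetherianSpace V := noetherianSpace_of_isAffineOpen V hV
  let D : Set V := Subtype.val ⁻¹' C
  have hD : IsClosed D := hC.preimage continuous_subtype_val
  have : QuasiSober V := V.isOpen.isOpenEmbedding_subtypeVal.quasiSober
  have : QuasiSober D := hD.isClosedEmbedding_subtypeVal.quasiSober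
  refine ((finite_maximalPoints_of_noetherianSpace (T := D)).image
    (fun x ↦ (x.1.1 : X))).subset ?_
  rintro x ⟨hxV, hxC, hx⟩
  refine ⟨⟨⟨x, hxV⟩, hxC⟩, ⟨trivial, fun y _ hy ↦ ?_⟩, rfl⟩
  have := hx y.1.1 y.2 ((hy.map continuous_subtype_val).map continuous_subtype_val)
  exact Subtype.ext (Subtype.ext this)

/-! ### Cycles -/

/-- The group `Z_d(X)` of `d`-dimensional cycles. A prime cycle, that is an integral closed
subscheme, is given by its generic point `x`. In the order of specialization (`x ≤ y` if `x` lies in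
the closure of `y`) its dimension is `Order.height x`, the supremum of the lengths of chains of
irreducible closed subsets of the closure of `x`. -/
def cycleGroup (X : Scheme.{u}) (d : ℕ) : AddSubgroup (AlgebraicCycle X ℤ) where
  carrier := {c | ∀ x, c x ≠ 0 → Order.height x = d}
  zero_mem' x hx := absurd rfl hx
  add_mem' {a b} ha hb x hx := by
    by_cases h : a x = 0
    · exact hb x fun h' ↦ hx (by simp [h, h'])
    · exact ha x h
  neg_mem' {a} ha x hx := ha x fun h ↦ hx (by simp [h])

/-- The pushforward of `d`-cycles: a prime cycle `x` is sent to `[κ(x) : κ(f x)] • f x` if the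
closures of `x` and `f x` have the same dimension, and to `0` otherwise. -/
noncomputable def pushforward {X Y : Scheme.{u}} (f : X ⟶ Y) [QuasiCompact f] {d : ℕ}
    (c : cycleGroup X d) : cycleGroup Y d :=
  ⟨AlgebraicCycle.map f Order.height Order.height c.1, fun y hy ↦ by
    obtain ⟨x, hxy, hx⟩ := exists_ne_zero_of_finsum_mem_ne_zero hy
    have hc : Order.height x = d := c.2 x (left_ne_zero_of_mul hx)
    have hw := right_ne_zero_of_mul hx
    have hxy : f x = y := hxy
    by_contra hne
    apply hw
    have : Order.height x ≠ Order.height (f.base x) := fun h ↦ hne <| by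
      rw [← hxy, ← hc]
      exact h.symm
    simp [AlgebraicCycle.mapCoeff, this]⟩

open scoped Classical in
/-- The fundamental cycle of dimension `d` of a locally Noetherian scheme `X`: the sum of the
`d`-dimensional irreducible components of `X`, where the component with generic point `x` has
multiplicity the length of the Artinian ring `𝒪_{X,x}`. If `X` has pure dimension `d`, this is the
fundamental cycle `[X]`. -/
noncomputable def fundamentalCycle (X : Scheme.{u}) [IsLocallyNoetherian X] (d : ℕ) :
    cycleGroup X d :=
  ⟨{ toFun := fun x ↦ if x ∈ genericPoints X ∧ Order.height x = d then
        ((Module.length (X.presheaf.stalk x) (X.presheaf.stalk x)).toNat : ℤ) else 0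
     supportWithinDomain' := by simp
     supportLocallyFiniteWithinDomain' := fun z _ ↦ by
      obtain ⟨t, ht, hfin⟩ :=
        exists_nhds_finite_inter_maximalPoints (isClosed_univ : IsClosed (Set.univ : Set X)) z
      refine ⟨t, ht, hfin.subset fun x hx ↦ ⟨hx.1, trivial, fun y _ hy ↦ ?_⟩⟩
      have hx' : x ∈ genericPoints X := by
        by_contra h
        exact hx.2 (if_neg fun h' ↦ h h'.1)
      exact Specializes.antisymm hy (specializes_iff_mem_closure.mpr (hx'.2 isIrreducible_singleton.closure
        hy.closure_subset (subset_closure rfl))) |>.eq },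
   fun x hx ↦ by
    by_contra h
    exact hx (if_neg fun h' ↦ h h'.2)⟩

/-- The divisor of a nonzero rational function `g` on a locally Noetherian integral scheme `W`: its
coefficient at a point `w` of codimension one is the order of vanishing of `g` along the closure of
`w`. (For `g = 0` it is `0` by convention.) -/
noncomputable def divisor {W : Scheme.{u}} [IsIntegral W] [IsLocallyNoetherian W]
    (g : W.functionField) : AlgebraicCycle W ℤ where
  toFun := Scheme.ord g
  supportWithinDomain' := by simp
  supportLocallyFiniteWithinDomain' z _ := by
    by_cases hg : g = 0
    · subst hg
      exact ⟨Set.univ, Filter.univ_mem, by simp⟩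
    obtain ⟨U, -, g', hU, rfl, hg'⟩ := exists_isUnit_germ_eq W g hg
    obtain ⟨t, ht, hfin⟩ := exists_nhds_finite_inter_maximalPoints U.isOpen.isClosed_compl z
    refine ⟨t, ht, hfin.subset fun x hx ↦ ⟨hx.1, fun hxU ↦ hx.2 (Scheme.ord_of_isUnit hg' hxU),
      fun y hyU hy ↦ ?_⟩⟩
    have hx1 : Order.coheight x = 1 := by
      by_contra h
      exact hx.2 (Scheme.ord_eq_zero_of_coheight_neq_one h _)
    by_contra hne
    have hxy : x < y := lt_of_le_not_ge hy fun h ↦ hne (Specializes.antisymm hy h).eq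
    have hy' : y < genericPoint W := by
      refine lt_of_le_not_ge (genericPoint_specializes y) fun h ↦ hyU ?_
      exact Specializes.mem_open (show y ⤳ genericPoint W from h) U.isOpen
        (((genericPoint_spec W).mem_open_set_iff U.isOpen).mpr
          (by obtain ⟨a⟩ := hU; exact ⟨a.1, trivial, a.2⟩))
    have h1 := Order.coheight_add_one_le hxy
    have h2 := Order.coheight_add_one_le hy'
    rw [hx1] at h1
    have h3 : (1 : ℕ∞) + 1 ≤ 1 := (add_le_add_left ((self_le_add_left _ _).trans h2) 1).trans h1
    exact absurd h3 (by decide)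

/-! ### Chow groups -/

/-- The subgroup of `Z_d(X)` of cycles rationally equivalent to zero: it is generated by the
cycles `i_* div(g)`, where `i : W ⟶ X` is an integral closed subscheme of dimension `d + 1` and `g`
is a nonzero rational function on `W`. -/
def rationalEquivalence (X : Scheme.{u}) (d : ℕ) : AddSubgroup (cycleGroup X d) :=
  AddSubgroup.closure {c | ∃ (W : Scheme.{u}) (_ : IsIntegral W) (_ : IsLocallyNoetherian W)
    (i : W ⟶ X) (_ : IsClosedImmersion i) (g : W.functionField), g ≠ 0 ∧
      Order.height (genericPoint W) = d + 1 ∧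
      c.1 = AlgebraicCycle.map i Order.height Order.height (divisor g)}

/-- The Chow group `CH_d(X)` of `d`-cycles modulo rational equivalence. -/
abbrev ChowGroup (X : Scheme.{u}) (d : ℕ) : Type u :=
  cycleGroup X d ⧸ rationalEquivalence X d

/-- The class of a `d`-cycle in the Chow group. -/
abbrev chowClass {X : Scheme.{u}} {d : ℕ} (c : cycleGroup X d) : ChowGroup X d :=
  QuotientAddGroup.mk c

/-! ### Decompositions of the diagonal -/

/-- All irreducible components of `X` have dimension `n`. -/
def IsPureDimensional (X : Scheme.{u}) (n : ℕ) : Prop :=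
  ∀ Z ∈ irreducibleComponents X, topologicalKrullDim Z = n

/-- The degree of a `0`-cycle `z` on a scheme `X` of finite type over a field `k`: the sum of
`z(x) * [κ(x) : k]` over the closed points `x`. -/
noncomputable def degree {k : Type u} [Field k] {X : Scheme.{u}} (f : X ⟶ Spec (.of k))
    (z : cycleGroup X 0) : ℤ :=
  ∑ᶠ x : X, z.1 x * (f.residueDegree x : ℤ)

section Diagonal

variable {k : Type u} [Field k] {X : Scheme.{u}} (f : X ⟶ Spec (.of k)) [IsProper f] (n : ℕ)

/-- The class `[Δ_X]` in `Z_n(X ×_k X)` of the diagonal, for `X` of pure dimension `n`. -/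
noncomputable def diagonalCycle : cycleGroup (pullback f f) n :=
  haveI : IsLocallyNoetherian X := LocallyOfFiniteType.isLocallyNoetherian f
  pushforward (pullback.diagonal f) (fundamentalCycle X n)

/-- The closed subscheme `X ×_k {x}` of `X ×_k X`, for a closed point `x` of `X`, is the
scheme-theoretic fibre over `x` of the second projection. This is its fundamental cycle in
`Z_n(X ×_k X)`, for `X` of pure dimension `n`. -/
noncomputable def prodPointCycle (x : X) : cycleGroup (pullback f f) n :=
  haveI : LocallyOfFiniteType ((pullback.snd f f).fiberToSpecResidueField x) :=
    inferInstanceAs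
      (LocallyOfFiniteType (pullback.snd (pullback.snd f f) (X.fromSpecResidueField x)))
  haveI : QuasiCompact ((pullback.snd f f).fiberι x) :=
    inferInstanceAs
      (QuasiCompact (pullback.fst (pullback.snd f f) (X.fromSpecResidueField x)))
  haveI : IsLocallyNoetherian ((pullback.snd f f).fiber x) :=
    LocallyOfFiniteType.isLocallyNoetherian ((pullback.snd f f).fiberToSpecResidueField x)
  pushforward ((pullback.snd f f).fiberι x)
    (fundamentalCycle ((pullback.snd f f).fiber x) n)

/-- The cycle `X × z` in `Z_n(X ×_k X)` attached to a `0`-cycle `z`: additive in `z`, and equal to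
the fundamental cycle of `X ×_k {x}` if `z` is a closed point `x`. -/
noncomputable def prodCycle (z : cycleGroup X 0) : cycleGroup (pullback f f) n :=
  ∑ᶠ x : X, z.1 x • prodPointCycle f n x

/-- The cycle `Z` on `X ×_k X` does not dominate any irreducible component of the first factor:
no prime cycle in its support maps to a dense subset of an irreducible component of `X`. -/
def NotDominatesFirstFactor {d : ℕ} (Z : cycleGroup (pullback f f) d) : Prop :=
  ∀ w : ↥(pullback f f), Z.1 w ≠ 0 → pullback.fst f f w ∉ genericPoints X

/-- `[Δ_X] = [X × z] + [Z]` in `CH_n(X ×_k X)`, where the cycle `Z` does not dominate any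
component of the first factor. -/
def IsDecompositionOfDiagonal (z : cycleGroup X 0) (Z : cycleGroup (pullback f f) n) : Prop :=
  NotDominatesFirstFactor f Z ∧
    chowClass (diagonalCycle f n) = chowClass (prodCycle f n z) + chowClass Z

end Diagonal

end ChowTheory

/-! Fix the generic point `η` of a component of `X` and a clopen `U ⊆ X`. To an `n`-cycle on `X ×_k
X` attach the sum of its coefficients times `[κ(w) : κ(η)]`, taken over the points `w` with `pr₁ w =
η` and `pr₂ w ∈ U` (`fiberDegree`). This number kills rational equivalence
(`fiberDegree_eq_zero_of_mem_rationalEquivalence`): an integral closed `W` of dimension `n + 1` lies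
entirely over `U` or entirely off it, its fibre over `η` is empty or an integral proper scheme of
dimension at most one, and principal divisors there have degree zero.

Let `ℓ` be the length of the local ring at `η`. The diagonal contributes `ℓ` if `η ∈ U` and `0`
otherwise, `X × z` contributes `ℓ · deg(z|_U)`, and `Z` contributes `0`. Cancelling `ℓ`, the degree
of `z` on `U` is `1` or `0` according to whether `η ∈ U`. Taking `U = X` gives `deg z = 1`. Since
`deg(z|_U)` does not depend on `η`, a clopen `U` contains all generic points or none, so `X` is
connected.

For geometric connectedness, `Γ(X, ⊤)` is integral over `k` with only trivial idempotents, so modulo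
its nilradical it is a field `L`. This field embeds in every `κ(x)`, hence `[L : k]` divides `deg z
= 1` and `L = k`. By flat base change, functions on `X_K` are again scalars plus nilpotents, so they
have no nontrivial idempotents and `X_K` is connected.

Principal divisors on a proper curve `Y` over `K` are handled without normalization. Locally the
order of `g` is the length of `A / (A ∩ gA[g])` minus the same length for `g⁻¹`
(`ordInt_eq_length_sub_length`). The closure `D ⊆ Y × 𝔸¹` of the graph of `g` is glued from the
spectra of the rings `Γ(Y, V)[g]`. If `g` is transcendental, `D` is proper and quasi-finite over
`𝔸¹`, hence finite, and the zero scheme of the coordinate has degree `[F : K(g)]`, where `F` is the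
function field. Its local pieces are the quotients `A / (A ∩ gA[g])`. As `K(g⁻¹) = K(g)`, zeros and
poles have equal degree. -/

namespace ChowTheory

/-! ### Lengths of Artinian algebras -/

open IsLocalRing in
/-- The length of an Artinian algebra over a local ring, in terms of its localizations. -/
theorem length_eq_sum_localization (A B : Type*) [CommRing A] [IsLocalRing A] [CommRing B]
    [IsArtinianRing B] [Algebra A B] [Fintype (PrimeSpectrum B)]
    [∀ P : PrimeSpectrum B, IsLocalHom (algebraMap A (Localization.AtPrime P.asIdeal))] :
    Module.length A B = ∑ P : PrimeSpectrum B,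
      Module.length (Localization.AtPrime P.asIdeal) (Localization.AtPrime P.asIdeal) *
        Module.length (ResidueField A) (ResidueField (Localization.AtPrime P.asIdeal)) := by
  let e : B ≃ₗ[A] (Π P : PrimeSpectrum B, Localization.AtPrime P.asIdeal) :=
    (PrimeSpectrum.toPiLocalizationEquiv B).toLinearEquiv.restrictScalars A
  rw [e.length_eq, Module.length_pi_of_fintype]
  exact Finset.sum_congr rfl fun P _ ↦ length_restrictScalars A _ _

/-! ### The order of vanishing of a fraction -/

section Order

variable (A : Type*) {F : Type*} [CommRing A] [Field F] [Algebra A F]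

/-- The ideal `A ∩ g A[g]`. -/
def numeratorIdeal (g : F) : Ideal A :=
  ((Algebra.adjoin A {g}).toSubmodule.map (LinearMap.mulLeft A g)).comap (Algebra.linearMap A F)

variable {A}

lemma mem_numeratorIdeal {g : F} {a : A} :
    a ∈ numeratorIdeal A g ↔ ∃ y ∈ Algebra.adjoin A {g}, g * y = algebraMap A F a := Iff.rfl

variable (A) in
/-- The submodule `A + g A + ⋯ + g ^ n A`. -/
def powersSpan (g : F) : ℕ → Submodule A F
  | 0 => 1
  | n + 1 => 1 ⊔ (powersSpan g n).map (LinearMap.mulLeft A g)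

lemma map_powersSpan_le (g : F) (n : ℕ) :
    (powersSpan A g n).map (LinearMap.mulLeft A g) ≤ powersSpan A g (n + 1) := le_sup_right

lemma powersSpan_le_succ (g : F) (n : ℕ) : powersSpan A g n ≤ powersSpan A g (n + 1) := by
  induction n with
  | zero => exact le_sup_left
  | succ n ih => exact sup_le_sup_left (Submodule.map_mono ih) _

lemma powersSpan_mono (g : F) : Monotone (powersSpan A g) :=
  monotone_nat_of_le_succ (powersSpan_le_succ g)

lemma one_le_powersSpan (g : F) (n : ℕ) : 1 ≤ powersSpan A g n :=
  powersSpan_mono g (Nat.zero_le n)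

/-- The definition splits off the lowest power; splitting off the highest one shows that consecutive
modules have a cyclic quotient. -/
lemma powersSpan_succ' (g : F) (n : ℕ) :
    powersSpan A g (n + 1) = powersSpan A g n ⊔ A ∙ g ^ (n + 1) := by
  induction n with
  | zero => simp [powersSpan, Submodule.one_eq_span, Submodule.map_span]
  | succ n ih =>
    rw [powersSpan, ih, Submodule.map_sup, ← sup_assoc]
    change powersSpan A g (n + 1) ⊔ _ = _
    rw [← ih, Submodule.map_span]
    simp [pow_succ']

lemma fg_powersSpan (g : F) (n : ℕ) : (powersSpan A g n).FG := by
  induction n with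
  | zero =>
    rw [powersSpan, Submodule.one_eq_span]
    exact Submodule.fg_span_singleton _
  | succ n ih =>
    rw [powersSpan_succ']
    exact ih.sup (Submodule.fg_span_singleton _)

lemma mem_adjoin_iff_exists_mem_powersSpan {g y : F} :
    y ∈ Algebra.adjoin A {g} ↔ ∃ n, y ∈ powersSpan A g n := by
  constructor
  · intro hy
    have hmul : ∀ n, ∀ x ∈ powersSpan A g n, ∀ m, ∀ y ∈ powersSpan A g m,
        x * y ∈ powersSpan A g (n + m) := by
      intro n
      induction n with
      | zero =>
        rintro x hx m y hy
        obtain ⟨a, rfl⟩ := Submodule.mem_one.mp hx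
        simpa [← Algebra.smul_def] using Submodule.smul_mem _ a hy
      | succ n ih =>
        rintro x hx m y hy
        obtain ⟨u, hu, v, ⟨w, hw, rfl⟩, rfl⟩ := Submodule.mem_sup.mp hx
        obtain ⟨a, rfl⟩ := Submodule.mem_one.mp hu
        rw [add_mul]
        refine add_mem ?_ ?_
        · rw [← Algebra.smul_def]
          exact Submodule.smul_mem _ a (powersSpan_mono g (by lia) hy)
        · rw [show n + 1 + m = n + m + 1 by lia, LinearMap.mulLeft_apply, mul_assoc]
          exact map_powersSpan_le g _ ⟨_, ih w hw m y hy, rfl⟩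
    induction hy using Algebra.adjoin_induction with
    | mem x hx =>
      obtain rfl : x = g := hx
      exact ⟨1, map_powersSpan_le _ 0 ⟨1, Submodule.one_le.mp le_rfl, by simp⟩⟩
    | algebraMap r => exact ⟨0, Submodule.mem_one.mpr ⟨r, rfl⟩⟩
    | add x y _ _ hx hy =>
      obtain ⟨n, hx⟩ := hx
      obtain ⟨m, hy⟩ := hy
      exact ⟨max n m, add_mem (powersSpan_mono g (le_max_left _ _) hx)
        (powersSpan_mono g (le_max_right _ _) hy)⟩
    | mul x y _ _ hx hy =>
      obtain ⟨n, hx⟩ := hx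
      obtain ⟨m, hy⟩ := hy
      exact ⟨n + m, hmul n x hx m y hy⟩
  · rintro ⟨n, hn⟩
    induction n generalizing y with
    | zero =>
      obtain ⟨a, rfl⟩ := Submodule.mem_one.mp hn
      exact algebraMap_mem _ a
    | succ n ih =>
      obtain ⟨u, hu, v, ⟨w, hw, rfl⟩, rfl⟩ := Submodule.mem_sup.mp hn
      obtain ⟨a, rfl⟩ := Submodule.mem_one.mp hu
      exact add_mem (algebraMap_mem _ a) (mul_mem (Algebra.self_mem_adjoin_singleton A g) (ih hw))

/-- Multiplying `1, g, …, g ^ n` by `g⁻¹ ^ n` lists the powers of `g⁻¹` in reverse order. This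
symmetry lets one chain of modules compute the ideals of both `g` and `g⁻¹`. -/
lemma powersSpan_inv {g : F} (hg : g ≠ 0) (n : ℕ) :
    powersSpan A g⁻¹ n = (powersSpan A g n).map (LinearMap.mulLeft A (g⁻¹ ^ n)) := by
  induction n with
  | zero => simp [powersSpan]
  | succ n ih =>
    rw [powersSpan_succ' g, Submodule.map_sup, powersSpan, ih, sup_comm, ← Submodule.map_comp]
    congr 1
    · congr 1
      ext
      simp [pow_succ']
    · simp [Submodule.map_span, hg, Submodule.one_eq_span]

/-- The ideals `A ∩ (g A + ⋯ + g ^ (n + 1) A)` eventually agree with `A ∩ g A[g]`. -/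
lemma exists_forall_comap_powersSpan_eq [IsNoetherianRing A] (g : F) :
    ∃ N, ∀ n ≥ N, ((powersSpan A g n).map (LinearMap.mulLeft A g)).comap (Algebra.linearMap A F) =
      numeratorIdeal A g := by
  let I : ℕ →o Ideal A := ⟨fun n ↦
    ((powersSpan A g n).map (LinearMap.mulLeft A g)).comap (Algebra.linearMap A F),
    fun n m h ↦ Submodule.comap_mono (Submodule.map_mono (powersSpan_mono g h))⟩
  obtain ⟨N, hN⟩ := monotone_stabilizes_iff_noetherian.mpr ‹IsNoetherianRing A› I
  refine ⟨N, fun n hn ↦ ?_⟩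
  change I n = _
  rw [← hN n hn]
  refine le_antisymm ?_ ?_
  · rintro a ⟨y, hy, hya⟩
    exact ⟨y, mem_adjoin_iff_exists_mem_powersSpan.mpr ⟨N, hy⟩, hya⟩
  · rintro a ⟨y, hy, hya⟩
    obtain ⟨m, hm⟩ := mem_adjoin_iff_exists_mem_powersSpan.mp hy
    have : a ∈ I (max N m) := ⟨y, powersSpan_mono g (le_max_right _ _) hm, hya⟩
    rwa [← hN _ (le_max_left _ _)] at this

end Order

/-! ### Lengths of quotients of nested submodules -/

section RelativeLength

variable {A M M' : Type*} [CommRing A] [AddCommGroup M] [Module A M] [AddCommGroup M'] [Module A M']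

/-- The length of `L / (N ∩ L)`. -/
noncomputable def relLength (N L : Submodule A M) : ℕ∞ := Module.length A (L ⧸ N.submoduleOf L)

lemma relLength_add {N K L : Submodule A M} (h₁ : N ≤ K) (h₂ : K ≤ L) :
    relLength N L = relLength N K + relLength K L := by
  have h : N.submoduleOf K ≤ (N.submoduleOf L).comap (Submodule.inclusion h₂) := fun x hx ↦ hx
  have h' : N.submoduleOf L ≤ K.submoduleOf L := fun x hx ↦ h₁ hx
  refine Module.length_eq_add_of_exact (Submodule.mapQ _ _ (Submodule.inclusion h₂) h)
    (Submodule.factor h') ?_ (Submodule.factor_surjective h') ?_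
  · rw [injective_iff_map_eq_zero]
    intro x hx
    obtain ⟨x, rfl⟩ := Submodule.mkQ_surjective _ x
    rw [Submodule.mkQ_apply, Submodule.mapQ_apply, Submodule.Quotient.mk_eq_zero] at hx
    exact (Submodule.Quotient.mk_eq_zero _).mpr hx
  · intro x
    obtain ⟨x, rfl⟩ := Submodule.mkQ_surjective _ x
    constructor
    · intro hx
      exact ⟨Submodule.Quotient.mk ⟨x.1, (Submodule.Quotient.mk_eq_zero (K.submoduleOf L)).mp hx⟩,
        rfl⟩
    · rintro ⟨y, hy⟩
      obtain ⟨y, rfl⟩ := Submodule.mkQ_surjective _ y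
      rw [← hy]
      exact (Submodule.Quotient.mk_eq_zero (K.submoduleOf L)).mpr y.2

lemma relLength_map (f : M →ₗ[A] M') (hf : Function.Injective f) (N L : Submodule A M) :
    relLength (N.map f) (L.map f) = relLength N L := by
  refine (LinearEquiv.length_eq (Submodule.Quotient.equiv _ _ (L.equivMapOfInjective f hf) ?_)).symm
  ext ⟨x, hx⟩
  simp only [Submodule.mem_map, Submodule.submoduleOf, Submodule.mem_comap]
  constructor
  · rintro ⟨y, hy, hyx⟩
    exact ⟨y, hy, congr_arg Subtype.val hyx⟩
  · rintro ⟨y, hy, hyx⟩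
    obtain ⟨w, hw, rfl⟩ := hx
    obtain rfl := hf hyx
    exact ⟨⟨y, hw⟩, hy, rfl⟩

/-- When `L` is generated by `N` and the image of `f`, the quotient is cyclic, so it is `A` modulo
an ideal. -/
lemma relLength_eq_length_quotient {N L : Submodule A M} (f : A →ₗ[A] M) (hf : ∀ a, f a ∈ L)
    (hL : L ≤ N ⊔ LinearMap.range f) : relLength N L = Module.length A (A ⧸ N.comap f) := by
  let φ : A →ₗ[A] (L ⧸ N.submoduleOf L) := (Submodule.mkQ _).comp (f.codRestrict L hf)
  have hφ : Function.Surjective φ := by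
    intro x
    obtain ⟨⟨x, hx⟩, rfl⟩ := Submodule.mkQ_surjective _ x
    obtain ⟨n, hn, _, ⟨a, rfl⟩, rfl⟩ := Submodule.mem_sup.mp (hL hx)
    refine ⟨a, ?_⟩
    simp only [φ, LinearMap.comp_apply, Submodule.mkQ_apply]
    rw [Submodule.Quotient.eq]
    simpa [Submodule.submoduleOf] using hn
  have hker : LinearMap.ker φ = N.comap f := by
    ext a
    exact Submodule.Quotient.mk_eq_zero (N.submoduleOf L)
  rw [relLength, ← hker]
  exact (LinearEquiv.length_eq (φ.quotKerEquivOfSurjective hφ)).symm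

end RelativeLength

lemma map_mulLeft_le {A F : Type*} [CommRing A] [Field F] [Algebra A F]
    (a : A) (M : Submodule A F) :
    M.map (LinearMap.mulLeft A (algebraMap A F a)) ≤ M := by
  rintro _ ⟨x, hx, rfl⟩
  rw [LinearMap.mulLeft_apply, ← Algebra.smul_def]
  exact M.smul_mem a hx

lemma relLength_map_mulLeft_one {A F : Type*} [CommRing A] [Field F] [Algebra A F]
    [IsFractionRing A F]
    (a : A) :
    relLength ((1 : Submodule A F).map (LinearMap.mulLeft A (algebraMap A F a))) 1 =
      Ring.ord A a := by
  rw [relLength_eq_length_quotient (Algebra.linearMap A F)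
    (fun a ↦ Submodule.mem_one.mpr ⟨a, rfl⟩)
      (Submodule.one_eq_range (R := A) (A := F) ▸ le_sup_right)]
  suffices h : Submodule.comap (Algebra.linearMap A F)
      ((1 : Submodule A F).map (LinearMap.mulLeft A (algebraMap A F a))) = Ideal.span {a} by
    rw [h, Ring.ord]
  ext x
  simp only [Submodule.mem_comap, Submodule.mem_map, Submodule.mem_one, Ideal.mem_span_singleton']
  constructor
  · rintro ⟨_, ⟨y, rfl⟩, hy⟩
    refine ⟨y, FaithfulSMul.algebraMap_injective A F ?_⟩
    simpa [mul_comm] using hy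
  · rintro ⟨y, rfl⟩
    exact ⟨_, ⟨y, rfl⟩, by simp [mul_comm]⟩

lemma mulLeft_algebraMap_injective {A F : Type*} [CommRing A] [Field F] [Algebra A F]
    [IsFractionRing A F]
    {a : A} (ha : a ≠ 0) :
    Function.Injective (LinearMap.mulLeft A (algebraMap A F a)) := by
  intro x y h
  exact mul_left_cancel₀ (by simpa using ha) h

lemma numeratorIdeal_ne_bot {A F : Type*} [CommRing A] [IsDomain A] [Field F] [Algebra A F]
    [IsFractionRing A F] {g : F} (hg : g ≠ 0) : numeratorIdeal A g ≠ ⊥ := by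
  obtain ⟨a, b, hb, rfl⟩ := IsFractionRing.div_surjective A g
  refine Submodule.ne_bot_iff _ |>.mpr ⟨a, ⟨algebraMap A F b,
    (Algebra.adjoin A _).algebraMap_mem b, ?_⟩, ?_⟩
  · have : algebraMap A F b ≠ 0 := by simpa using nonZeroDivisors.ne_zero hb
    simp [this]
  · rintro rfl
    simp at hg

section Order

variable {A F : Type*} [CommRing A] [IsDomain A] [IsNoetherianRing A] [Ring.KrullDimLE 1 A]
  [Field F] [Algebra A F] [IsFractionRing A F]

variable (A) in
/-- The order of vanishing of a fraction as an integer, with value `0` at `0`. -/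
noncomputable def ordInt (g : F) : ℤ := Multiplicative.toAdd ((Ring.ordFrac A g).unzeroD 1)

lemma ordInt_div {a b : A} (ha : a ≠ 0) (hb : b ≠ 0) :
    ordInt A (algebraMap A F a / algebraMap A F b) =
      ((Ring.ord A a).toNat : ℤ) - (Ring.ord A b).toNat := by
  have key {a : A} (ha : a ≠ 0) : Ring.ordFrac A (algebraMap A F a) =
      Multiplicative.ofAdd ((Ring.ord A a).toNat : ℤ) := by
    rw [Ring.ordFrac_eq_ord _ ha]
    exact Ring.ordMonoidWithZeroHom_eq_coe _ (mem_nonZeroDivisors_of_ne_zero ha)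
      (ENat.natCast_toNat (Ring.ord_ne_top (mem_nonZeroDivisors_of_ne_zero ha))).symm
  rw [ordInt, map_div₀, key ha, key hb, ← WithZero.coe_div, WithZero.unzeroD_coe, ← ofAdd_sub,
    toAdd_ofAdd]

/-- A common denominator `c` gives `cA ⊆ cM ⊆ A`, so `M / A ≅ cM / cA` embeds in `A / cA`, which has
finite length. -/
lemma relLength_one_ne_top {M : Submodule A F} (hM : M.FG) (h1 : 1 ≤ M) :
    relLength 1 M ≠ ⊤ := by
  obtain ⟨c, hc, hcM⟩ := FractionalIdeal.isFractional_of_fg (S := nonZeroDivisors A) hM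
  have hc0 : c ≠ 0 := nonZeroDivisors.ne_zero hc
  have hle : M.map (LinearMap.mulLeft A (algebraMap A F c)) ≤ 1 := by
    rintro _ ⟨x, hx, rfl⟩
    rw [LinearMap.mulLeft_apply, ← Algebra.smul_def]
    exact Submodule.mem_one.mpr (hcM x hx)
  rw [← relLength_map _ (mulLeft_algebraMap_injective hc0)]
  refine ne_top_of_le_ne_top (Ring.ord_ne_top hc) ?_
  rw [← relLength_map_mulLeft_one (F := F) c, relLength_add (Submodule.map_mono h1) hle]
  exact le_self_add

/-- Count the index of `aA` in `M` through `aM` and through `A`. The terms `aM / aA` and `M / A`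
have equal finite length and cancel. -/
lemma relLength_map_mulLeft {M : Submodule A F} (hM : M.FG) (h1 : 1 ≤ M) {a : A} (ha : a ≠ 0) :
    relLength (M.map (LinearMap.mulLeft A (algebraMap A F a))) M = Ring.ord A a := by
  have h := relLength_add (map_mulLeft_le a (1 : Submodule A F)) h1
  rw [relLength_add (Submodule.map_mono h1) (map_mulLeft_le a M),
    relLength_map _ (mulLeft_algebraMap_injective ha), relLength_map_mulLeft_one, add_comm] at h
  exact (ENat.add_left_injective_of_ne_top (relLength_one_ne_top hM h1)) h

lemma length_quotient_ne_top {I : Ideal A} (hI : I ≠ ⊥) : Module.length A (A ⧸ I) ≠ ⊤ := by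
  obtain ⟨a, ha, ha0⟩ := Submodule.exists_mem_ne_zero_of_ne_bot hI
  exact ne_top_of_le_ne_top (Ring.ord_ne_top (mem_nonZeroDivisors_of_ne_zero ha0))
    (Module.length_le_of_surjective
      (Submodule.factor ((Ideal.span_singleton_le_iff_mem I).mpr ha) :
        (A ⧸ Ideal.span {a}) →ₗ[A] A ⧸ I) (Submodule.factor_surjective _))

/-- The order of vanishing of `g` is the length of `A / (A ∩ g A[g])` minus the length of
`A / (A ∩ g⁻¹ A[g⁻¹])`. -/
theorem ordInt_eq_length_sub_length {g : F} (hg : g ≠ 0) :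
    ordInt A g = ((Module.length A (A ⧸ numeratorIdeal A g)).toNat : ℤ) -
      (Module.length A (A ⧸ numeratorIdeal A g⁻¹)).toNat := by
  -- For `n` large both numerator ideals are already computed by finitely generated modules, so
  -- `A[g]`, which need not be finite over `A`, can be avoided.
  obtain ⟨N₁, h₁⟩ := exists_forall_comap_powersSpan_eq (A := A) g
  obtain ⟨N₂, h₂⟩ := exists_forall_comap_powersSpan_eq (A := A) g⁻¹
  let n := max N₁ N₂
  replace h₁ := h₁ n (le_max_left _ _)
  replace h₂ := h₂ n (le_max_right _ _)
  have fin₁ := length_quotient_ne_top (numeratorIdeal_ne_bot (A := A) hg)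
  have fin₂ := length_quotient_ne_top (numeratorIdeal_ne_bot (A := A) (inv_ne_zero hg))
  obtain ⟨a, b, hb, rfl⟩ := IsFractionRing.div_surjective A g
  have hb0 : b ≠ 0 := nonZeroDivisors.ne_zero hb
  have ha0 : a ≠ 0 := by rintro rfl; simp at hg
  have hb0' : algebraMap A F b ≠ 0 := by simpa using hb0
  rw [ordInt_div ha0 hb0]
  set g := algebraMap A F a / algebraMap A F b with hgdef
  set M := powersSpan A g n
  set M' := powersSpan A g (n + 1)
  have hinj : Function.Injective (LinearMap.mulLeft A g) := fun x y h ↦ mul_left_cancel₀ hg h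
  have hcomp : (M.map (LinearMap.mulLeft A (algebraMap A F b))).map (LinearMap.mulLeft A g) =
      M.map (LinearMap.mulLeft A (algebraMap A F a)) := by
    rw [← Submodule.map_comp, ← LinearMap.mulLeft_mul, hgdef, div_mul_cancel₀ _ hb0']
  have e₁ : relLength (M.map (LinearMap.mulLeft A g)) M' =
      Module.length A (A ⧸ numeratorIdeal A g) := by
    rw [← h₁]
    refine relLength_eq_length_quotient (Algebra.linearMap A F)
      (fun a ↦ one_le_powersSpan _ _ (Submodule.mem_one.mpr ⟨a, rfl⟩)) ?_
    rw [← Submodule.one_eq_range, sup_comm]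
    exact le_rfl
  have hgn : g ^ (n + 1) ≠ 0 := pow_ne_zero _ hg
  have hM' : M' = M ⊔ A ∙ g ^ (n + 1) := powersSpan_succ' g n
  have e₂ : relLength M M' = Module.length A (A ⧸ numeratorIdeal A g⁻¹) := by
    rw [← h₂]
    rw [relLength_eq_length_quotient (LinearMap.toSpanSingleton A F (g ^ (n + 1))) ?_ ?_]
    · suffices h : M.comap (LinearMap.toSpanSingleton A F (g ^ (n + 1))) =
          ((powersSpan A g⁻¹ n).map (LinearMap.mulLeft A g⁻¹)).comap (Algebra.linearMap A F) by
        rw [h]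
      rw [powersSpan_inv hg, ← Submodule.map_comp, ← LinearMap.mulLeft_mul, ← pow_succ']
      ext x
      simp only [Submodule.mem_comap, Submodule.mem_map, LinearMap.toSpanSingleton_apply,
        LinearMap.mulLeft_apply, Algebra.linearMap_apply, Algebra.smul_def]
      constructor
      · intro hx
        exact ⟨_, hx, by rw [inv_pow, mul_comm, mul_assoc, mul_inv_cancel₀ hgn, mul_one]⟩
      · rintro ⟨y, hy, hyx⟩
        rw [← hyx, inv_pow, mul_comm, mul_inv_cancel_left₀ hgn]
        exact hy
    · intro x
      rw [LinearMap.toSpanSingleton_apply]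
      refine Submodule.smul_mem _ _ ?_
      rw [hM']
      exact Submodule.mem_sup_right (Submodule.mem_span_singleton_self _)
    · rw [hM', LinearMap.range_toSpanSingleton]
  -- With `g = a / b` one has `gbM = aM`. Its index in `M'` is counted through `gM` and through `M`,
  -- and multiplication by `g` identifies `M / bM` with `gM / aM`. This yields `ord a + length (M' /
  -- M) = ord b + length (M' / gM)`.
  have k₁ := relLength_add (Submodule.map_mono (map_mulLeft_le b M))
    (map_powersSpan_le (A := A) g n)
  have k₂ := relLength_add (map_mulLeft_le a M) (powersSpan_le_succ (A := A) g n)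
  rw [hcomp] at k₁
  rw [relLength_add (map_mulLeft_le a M) (powersSpan_le_succ (A := A) g n),
    ← hcomp, relLength_map _ hinj, hcomp] at k₁
  change _ + relLength M M' = _ + relLength (M.map _) M' at k₁
  rw [relLength_map_mulLeft (fg_powersSpan g n) (one_le_powersSpan g n) ha0,
    relLength_map_mulLeft (fg_powersSpan g n) (one_le_powersSpan g n) hb0, e₁, e₂] at k₁
  have fa := Ring.ord_ne_top (mem_nonZeroDivisors_of_ne_zero ha0)
  have fb := Ring.ord_ne_top (mem_nonZeroDivisors_of_ne_zero hb0)
  lift Ring.ord A a to ℕ using fa with x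
  lift Ring.ord A b to ℕ using fb with y
  lift Module.length A (A ⧸ numeratorIdeal A g) to ℕ using fin₁ with p
  lift Module.length A (A ⧸ numeratorIdeal A g⁻¹) to ℕ using fin₂ with q
  simp only [ENat.toNat_natCast]
  have : x + q = y + p := by exact_mod_cast k₁
  lia

end Order

/-! ### Algebras generated by one fraction -/

section AdjoinFraction

variable {A B F : Type*} [CommRing A] [CommRing B] [Field F] [Algebra A B] [Algebra A F]
  [Algebra B F] [IsScalarTower A B F] {t : B}

/-- A polynomial in `t` is congruent to its constant term modulo `t`. Geometrically, the zero scheme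
of the coordinate on the graph embeds into the curve. -/
lemma exists_sub_mem_span_of_adjoin_eq_top {A B : Type*} [CommRing A] [CommRing B] [Algebra A B]
    {t : B} (ht : Algebra.adjoin A {t} = ⊤) (b : B) :
    ∃ a : A, b - algebraMap A B a ∈ Ideal.span {t} := by
  have hb : b ∈ Algebra.adjoin A {t} := ht ▸ trivial
  obtain ⟨q, rfl⟩ : ∃ q : Polynomial A, Polynomial.aeval t q = b := by
    rwa [Algebra.adjoin_singleton_eq_range_aeval] at hb
  refine ⟨q.coeff 0, Ideal.mem_span_singleton.mpr ?_⟩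
  nth_rewrite 1 [← Polynomial.divX_mul_X_add q]
  simp

lemma surjective_quotient_of_adjoin_eq_top {A B : Type*} [CommRing A] [CommRing B] [Algebra A B]
    {t : B} (ht : Algebra.adjoin A {t} = ⊤) :
    Function.Surjective (algebraMap A (B ⧸ Ideal.span {t})) := by
  intro x
  obtain ⟨b, rfl⟩ := Ideal.Quotient.mk_surjective x
  obtain ⟨a, ha⟩ := exists_sub_mem_span_of_adjoin_eq_top ht b
  exact ⟨a, ((Ideal.Quotient.mk_eq_mk_iff_sub_mem _ _).mpr ha).symm⟩

lemma eq_of_comap_eq_of_adjoin_eq_top {A B : Type*} [CommRing A] [CommRing B] [Algebra A B]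
    {t : B} (ht : Algebra.adjoin A {t} = ⊤) {p q : Ideal B} (hp : t ∈ p) (hq : t ∈ q)
    (h : p.comap (algebraMap A B) = q.comap (algebraMap A B)) : p = q := by
  ext b
  obtain ⟨a, ha⟩ := exists_sub_mem_span_of_adjoin_eq_top ht b
  have hp' := (Ideal.span_singleton_le_iff_mem p).mpr hp ha
  have hq' := (Ideal.span_singleton_le_iff_mem q).mpr hq ha
  have hpa : b ∈ p ↔ algebraMap A B a ∈ p := by
    nth_rewrite 1 [← sub_add_cancel b (algebraMap A B a)]
    exact Ideal.add_mem_iff_right _ hp'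
  have hqa : b ∈ q ↔ algebraMap A B a ∈ q := by
    nth_rewrite 1 [← sub_add_cancel b (algebraMap A B a)]
    exact Ideal.add_mem_iff_right _ hq'
  rw [hpa, hqa]
  exact Ideal.ext_iff.mp h a

lemma comap_span_eq_numeratorIdeal [FaithfulSMul B F] (ht : Algebra.adjoin A {t} = ⊤) :
    (Ideal.span {t}).comap (algebraMap A B) = numeratorIdeal A (algebraMap B F t) := by
  have hadj : Algebra.adjoin A {algebraMap B F t} = (IsScalarTower.toAlgHom A B F).range := by
    rw [← Algebra.map_top, ← ht, AlgHom.map_adjoin, Set.image_singleton]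
    rfl
  ext a
  rw [mem_numeratorIdeal, Ideal.mem_comap, Ideal.mem_span_singleton', hadj]
  constructor
  · rintro ⟨b, hb⟩
    exact ⟨_, ⟨b, rfl⟩, by
      rw [IsScalarTower.algebraMap_apply A B F, ← hb, map_mul, mul_comm]; rfl⟩
  · rintro ⟨_, ⟨b, rfl⟩, hb⟩
    refine ⟨b, FaithfulSMul.algebraMap_injective B F ?_⟩
    rw [← IsScalarTower.algebraMap_apply A B F, ← hb, map_mul, mul_comm]
    rfl

section Localization

variable {R S : Type*} [CommRing R] [CommRing S] [Algebra A R] [Algebra B S] [Algebra R S]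
  [Algebra R F] [Algebra S F] [IsScalarTower R S F] [IsScalarTower B S F]
  [IsScalarTower A R F] [FaithfulSMul S F]
  {p : Ideal B} [p.IsPrime]

lemma comap_localization_eq_numeratorIdeal [IsLocalization.AtPrime R (p.under A)]
    [IsLocalization.AtPrime S p] [IsDomain S] (ht : Algebra.adjoin A {t} = ⊤) (htp : t ∈ p) :
    (Ideal.span {algebraMap B S t}).comap (algebraMap R S) =
      numeratorIdeal R (algebraMap B F t) := by
  ext r
  rw [mem_numeratorIdeal, Ideal.mem_comap, Ideal.mem_span_singleton']
  constructor
  · rintro ⟨s, hs⟩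
    obtain ⟨b, u, rfl⟩ := IsLocalization.exists_mk'_eq p.primeCompl s
    obtain ⟨a, a', rfl⟩ := IsLocalization.exists_mk'_eq (p.under A).primeCompl r
    obtain ⟨u₀, hu₀⟩ := exists_sub_mem_span_of_adjoin_eq_top ht (u : B)
    obtain ⟨c, hc⟩ := Ideal.mem_span_singleton'.mp hu₀
    have hu₀p : u₀ ∈ (p.under A).primeCompl := fun h ↦ u.2 <| by
      rw [← sub_add_cancel (u : B) (algebraMap A B u₀)]
      exact p.add_mem ((Ideal.span_singleton_le_iff_mem p).mpr htp hu₀) h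
    have hle : (Algebra.adjoin A {algebraMap B F t} : Set F) ⊆
        Algebra.adjoin R {algebraMap B F t} := by
      intro x hx
      induction hx using Algebra.adjoin_induction with
      | mem x hx => exact Algebra.subset_adjoin hx
      | algebraMap a =>
        rw [IsScalarTower.algebraMap_apply A R F]
        exact Subalgebra.algebraMap_mem _ _
      | add x y _ _ hx hy => exact add_mem hx hy
      | mul x y _ _ hx hy => exact mul_mem hx hy
    have hmem (d : B) : algebraMap B F d ∈ Algebra.adjoin R {algebraMap B F t} := by
      refine hle ?_
      have hd : d ∈ Algebra.adjoin A {t} := ht ▸ trivial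
      have := (AlgHom.map_adjoin (IsScalarTower.toAlgHom A B F) {t}) ▸
        Subalgebra.mem_map.mpr ⟨d, hd, rfl⟩
      simpa using this
    have hv : algebraMap R F (algebraMap A R (a' * u₀)) *
        algebraMap R F (IsLocalization.mk' R 1 (a' * ⟨u₀, hu₀p⟩ : (p.under A).primeCompl)) = 1 := by
      rw [← map_mul]
      have := IsLocalization.mk'_spec' R (1 : A) (a' * ⟨u₀, hu₀p⟩ : (p.under A).primeCompl)
      rw [map_one] at this
      exact (congr_arg (algebraMap R F) this).trans (map_one _)
    -- Here `w = 1 / (a' u₀)`. From `a u = a' b t` and `u = u₀ + c t` follows `a u₀ = t (a' b - a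
    -- c)`, hence `a / a' = t · w (a' b - a c)`: the denominator `u ∈ B` has been traded for one
    -- from `A`.
    set w := IsLocalization.mk' R (1 : A) (a' * ⟨u₀, hu₀p⟩ : (p.under A).primeCompl)
    refine ⟨algebraMap R F w * algebraMap B F (b * algebraMap A B a' - algebraMap A B a * c),
      mul_mem (Subalgebra.algebraMap_mem _ _) (hmem _), ?_⟩
    have h1 : algebraMap B F b = algebraMap S F (IsLocalization.mk' S b u) * algebraMap B F u := by
      rw [IsScalarTower.algebraMap_apply B S F, IsScalarTower.algebraMap_apply B S F, ← map_mul,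
        IsLocalization.mk'_spec]
    have h2 : algebraMap A F a =
        algebraMap R F (IsLocalization.mk' R a a') * algebraMap A F a' := by
      rw [IsScalarTower.algebraMap_apply A R F, IsScalarTower.algebraMap_apply A R F, ← map_mul,
        IsLocalization.mk'_spec]
    have h3 := congr_arg (algebraMap S F) hs
    rw [← IsScalarTower.algebraMap_apply R S F, map_mul,
      ← IsScalarTower.algebraMap_apply B S F] at h3
    have h4 := congr_arg (algebraMap B F) hc
    rw [map_mul, map_sub, ← IsScalarTower.algebraMap_apply A B F] at h4
    rw [← IsScalarTower.algebraMap_apply A R F, map_mul] at hv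
    rw [map_sub, map_mul, map_mul, ← IsScalarTower.algebraMap_apply A B F,
      ← IsScalarTower.algebraMap_apply A B F, h2]
    rw [h1] 
    generalize algebraMap S F (IsLocalization.mk' S b u) = s at *
    generalize algebraMap R F (IsLocalization.mk' R a a') = r at *
    generalize algebraMap B F t = g at *
    generalize algebraMap A F a' = α at *
    generalize algebraMap A F u₀ = β at *
    generalize algebraMap B F u = v at *
    generalize algebraMap B F c = γ at *
    generalize algebraMap R F w = ω at *
    subst h3
    linear_combination (s * g) * hv - (s * g * ω * α) * h4
  · rintro ⟨y, hy, hyr⟩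
    have hle : y ∈ (IsScalarTower.toAlgHom R S F).range := by
      refine Algebra.adjoin_le ?_ hy
      rw [Set.singleton_subset_iff]
      exact ⟨algebraMap B S t, (IsScalarTower.algebraMap_apply B S F t).symm⟩
    obtain ⟨s, rfl⟩ := hle
    refine ⟨s, FaithfulSMul.algebraMap_injective S F ?_⟩
    rw [← IsScalarTower.algebraMap_apply R S F, ← hyr, map_mul,
      ← IsScalarTower.algebraMap_apply B S F, mul_comm]
    rfl

/-- Modulo `t` numerators and denominators both come from `A`. As `t ∈ p`, a denominator outside `p`
is represented outside `p ∩ A`. -/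
lemma surjective_localization_quotient {R S : Type*} [CommRing R] [CommRing S] [Algebra A R]
    [Algebra B S] [Algebra R S] [Algebra A S] [IsScalarTower A R S] [IsScalarTower A B S]
    {p : Ideal B} [p.IsPrime] [IsLocalization.AtPrime R (p.under A)]
    [IsLocalization.AtPrime S p] (ht : Algebra.adjoin A {t} = ⊤) (htp : t ∈ p) :
    Function.Surjective (algebraMap R (S ⧸ Ideal.span {algebraMap B S t})) := by
  have key (b : B) : ∃ a : A, Ideal.Quotient.mk (Ideal.span {algebraMap B S t}) (algebraMap B S b) =
      algebraMap R _ (algebraMap A R a) ∧ (b ∉ p → a ∈ (p.under A).primeCompl) := by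
    obtain ⟨a, ha⟩ := exists_sub_mem_span_of_adjoin_eq_top ht b
    refine ⟨a, ?_, fun hb hap ↦ hb ?_⟩
    · rw [IsScalarTower.algebraMap_apply R S, ← IsScalarTower.algebraMap_apply A R S]
      refine (Ideal.Quotient.mk_eq_mk_iff_sub_mem _ _).mpr ?_
      rw [IsScalarTower.algebraMap_apply A B S, ← map_sub]
      obtain ⟨c, hc⟩ := Ideal.mem_span_singleton'.mp ha
      rw [← hc, map_mul]
      exact Ideal.mul_mem_left _ _ (Ideal.mem_span_singleton_self _)
    · rw [← sub_add_cancel b (algebraMap A B a)]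
      exact p.add_mem ((Ideal.span_singleton_le_iff_mem p).mpr htp ha) hap
  intro x
  obtain ⟨s, rfl⟩ := Ideal.Quotient.mk_surjective x
  obtain ⟨b, u, rfl⟩ := IsLocalization.exists_mk'_eq p.primeCompl s
  obtain ⟨a, ha, -⟩ := key b
  obtain ⟨a', ha', hu⟩ := key u
  refine ⟨IsLocalization.mk' R a ⟨a', hu u.2⟩, ?_⟩
  have hunit : IsUnit (Ideal.Quotient.mk (Ideal.span {algebraMap B S t}) (algebraMap B S u)) :=
    (IsLocalization.map_units S u).map _
  rw [← hunit.mul_left_inj, ← map_mul, IsLocalization.mk'_spec, ha, ha', ← map_mul,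
    IsLocalization.mk'_spec' (S := R) a ⟨a', hu u.2⟩ |> fun h ↦ (mul_comm _ _).trans h]

end Localization

open Polynomial in
/-- If a Noetherian domain has dimension at most one, so does its extension by a fraction. -/
lemma krullDimLE_of_adjoin_eq_top [IsDomain A] [IsNoetherianRing A] [Ring.KrullDimLE 1 A]
    [IsFractionRing A F] [FaithfulSMul B F] (ht : Algebra.adjoin A {t} = ⊤) :
    Ring.KrullDimLE 1 B := by
  rw [Ring.krullDimLE_iff]
  have hA : ringKrullDim A ≤ 1 := Ring.krullDimLE_iff.mp ‹_›
  obtain ⟨a, b, hb, hab⟩ := IsFractionRing.div_surjective A (algebraMap B F t)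
  have hb0 : b ≠ 0 := nonZeroDivisors.ne_zero hb
  have hb0' : algebraMap A F b ≠ 0 := by simpa using hb0
  have hsurj : Function.Surjective (aeval (R := A) t) := by
    rw [← AlgHom.range_eq_top, ← Algebra.adjoin_singleton_eq_range_aeval, ht]
  -- `B` is a quotient of `A[X]` in which the non-zero-divisor `bX - a` dies, so `dim B + 1 ≤ dim
  -- A[X] = dim A + 1`.
  have h0 : aeval t (C b * X - C a) = 0 := by
    apply FaithfulSMul.algebraMap_injective B F
    rw [map_sub, map_mul, aeval_C, aeval_C, aeval_X, map_sub, map_mul, map_zero,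
      ← IsScalarTower.algebraMap_apply, ← IsScalarTower.algebraMap_apply, ← hab,
      mul_div_cancel₀ _ hb0', sub_self]
  have hne : C b * X - C a ∈ nonZeroDivisors A[X] := mem_nonZeroDivisors_of_ne_zero fun h ↦ by
    have := congr_arg (coeff · 1) h
    simp [coeff_C] at this
    exact hb0 this
  have := ringKrullDim_succ_le_of_surjective (aeval (R := A) t).toRingHom hsurj hne h0
  rw [ringKrullDim_of_isNoetherianRing] at this
  have h2 : ringKrullDim B + 1 ≤ 1 + 1 := this.trans (by gcongr)
  exact (ENat.WithBot.add_le_add_one_right_iff).mp h2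

end AdjoinFraction

/-! ### Affine curves over the affine line -/

section Curve

open Polynomial

variable {K B : Type*} [Field K] [CommRing B] [IsDomain B] [Ring.KrullDimLE 1 B]

lemma isMaximal_of_krullDimLE_one {p : Ideal B} [p.IsPrime] (hp : p ≠ ⊥) : p.IsMaximal :=
  Ring.krullDimLE_one_iff_of_noZeroDivisors.mp ‹_› p hp ‹_›

/-- A dominant morphism from an affine curve to the affine line is quasi-finite. -/
theorem quasiFinite_of_polynomial [Algebra K[X] B] [FaithfulSMul K[X] B]
    [Algebra.FiniteType K[X] B] :
    Algebra.QuasiFinite K[X] B := by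
  have : IsNoetherianRing B := Algebra.FiniteType.isNoetherianRing K[X] B
  rw [Algebra.QuasiFinite.iff_finite_comap_preimage_singleton]
  intro p
  by_cases hp : p.asIdeal = ⊥
  -- Over the generic point: a nonzero prime of `B` is maximal with residue field finite over `K`,
  -- so `K[X]` cannot embed into that field.
  · refine (Set.finite_singleton (⊥ : PrimeSpectrum B)).subset fun P hP ↦ ?_
    by_contra hne
    have hP0 : P.asIdeal ≠ ⊥ := fun h ↦ hne (PrimeSpectrum.ext h)
    have := isMaximal_of_krullDimLE_one hP0
    let _ : Field (B ⧸ P.asIdeal) := Ideal.Quotient.field _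
    let _ : Algebra K B := ((algebraMap K[X] B).comp C).toAlgebra
    have : IsScalarTower K K[X] B := .of_algebraMap_eq fun _ ↦ rfl
    have : Algebra.FiniteType K B := .trans (S := K[X]) inferInstance inferInstance
    have : Algebra.FiniteType K (B ⧸ P.asIdeal) := inferInstance
    have hfin : Module.Finite K (B ⧸ P.asIdeal) := finite_of_finite_type_of_isJacobsonRing K _
    have hinj :
        Function.Injective ((IsScalarTower.toAlgHom K K[X] (B ⧸ P.asIdeal)).toLinearMap) := by
      intro x y hxy
      rw [← sub_eq_zero] at hxy ⊢
      have h1 : algebraMap K[X] B (x - y) ∈ P.asIdeal := by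
        rw [← Ideal.Quotient.eq_zero_iff_mem, ← Ideal.Quotient.algebraMap_eq,
          ← IsScalarTower.algebraMap_apply, map_sub]
        exact hxy
      have h2 : x - y ∈ p.asIdeal := by
        rw [← (show PrimeSpectrum.comap (algebraMap K[X] B) P = p from hP)]
        exact h1
      rwa [hp] at h2
    have := Module.Finite.of_injective _ hinj
    exact Polynomial.not_finite this
  -- Over a closed point: the primes of `B` containing the nonzero image of `x` are minimal over it,
  -- as `dim B ≤ 1`, and there are finitely many of these.
  · obtain ⟨x, hx, hx0⟩ := Submodule.exists_mem_ne_zero_of_ne_bot hp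
    have hy0 : algebraMap K[X] B x ≠ 0 := by simpa using hx0
    refine Set.Finite.of_finite_image (f := PrimeSpectrum.asIdeal)
      ((Ideal.finite_minimalPrimes_of_isNoetherianRing B
        (Ideal.span {algebraMap K[X] B x})).subset ?_) fun _ _ _ _ ↦ PrimeSpectrum.ext
    rintro _ ⟨P, hP, rfl⟩
    have hxP : algebraMap K[X] B x ∈ P.asIdeal := by
      have : x ∈ (PrimeSpectrum.comap (algebraMap K[X] B) P).asIdeal := by rwa [show _ = p from hP]
      exact this
    refine ⟨⟨P.2, (Ideal.span_singleton_le_iff_mem _).mpr hxP⟩, fun Q ⟨hQ, hxQ⟩ hQP ↦ ?_⟩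
    have : Q.IsMaximal := isMaximal_of_krullDimLE_one fun h ↦ hy0 <| by
      simpa [h] using (Ideal.span_singleton_le_iff_mem _).mp hxQ
    exact (this.eq_of_le P.2.ne_top hQP).ge

end Curve

section Rank

open Polynomial IntermediateField

variable {K F B : Type*} [Field K] [Field F] [Algebra K F] [CommRing B] [IsDomain B]
  [Algebra K B] [Algebra K[X] B] [IsScalarTower K K[X] B] [Algebra B F] [IsFractionRing B F]
  [IsScalarTower K B F]

/-- The degree of the fibre over `0` of a finite morphism to the affine line. -/
theorem finrank_quotient_eq_finrank_adjoin [Module.Finite K[X] B] [FaithfulSMul K[X] B]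
    {g : F} (hX : algebraMap B F (algebraMap K[X] B X) = g) :
    Module.finrank K (B ⧸ Ideal.span {algebraMap K[X] B X}) = Module.finrank K⟮g⟯ F := by
  have : Module.Free K[X] B := inferInstance
  -- `B` is finite and torsion-free over a principal ideal domain, hence free. The dimension of the
  -- quotient is the degree of the norm of `X`, which is `X` to the power the rank.
  have e := finrank_quotient_span_eq_natDegree_norm (Module.Free.chooseBasis K[X] B)
    (f := algebraMap K[X] B X) (by simp)
  rw [e, Algebra.norm_algebraMap, natDegree_X_pow]
  let _ : Algebra K[X] F := ((algebraMap B F).comp (algebraMap K[X] B)).toAlgebra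
  have : IsScalarTower K[X] B F := .of_algebraMap_eq fun _ ↦ rfl
  have : IsScalarTower K K[X] F := .of_algebraMap_eq fun x ↦ by
    rw [IsScalarTower.algebraMap_apply K[X] B F, ← IsScalarTower.algebraMap_apply K K[X] B,
      ← IsScalarTower.algebraMap_apply K B F]
  have hF : (algebraMap K[X] F) = (aeval g : K[X] →ₐ[K] F).toRingHom := by
    suffices h : IsScalarTower.toAlgHom K K[X] F = aeval g from congr_arg AlgHom.toRingHom h
    exact Polynomial.algHom_ext (by rw [aeval_X]; exact hX)
  have hinj : Function.Injective (algebraMap K[X] F) :=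
    (FaithfulSMul.algebraMap_injective B F).comp (FaithfulSMul.algebraMap_injective K[X] B)
  have htr : Transcendental K g := by
    rw [transcendental_iff_injective]
    rw [hF] at hinj
    exact hinj
  -- The rank over `K[X]` is the degree of `F` over `K(X)`, and transcendence of `g` identifies
  -- `K(X)` with `K(g)`.
  let e := RatFunc.algEquivOfTranscendental g htr
  let _ : Algebra (RatFunc K) F := ((algebraMap K⟮g⟯ F).comp (e : RatFunc K →+* K⟮g⟯)).toAlgebra
  have : IsScalarTower K[X] (RatFunc K) F := .of_algebraMap_eq fun q ↦ by
    rw [hF]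
    refine Eq.trans ?_ (congr_arg (algebraMap K⟮g⟯ F)
      (RatFunc.algEquivOfTranscendental_algebraMap g htr q)).symm
    exact (aeval_algebraMap_apply F (AdjoinSimple.gen K g) q)
  rw [← IsFractionRing.finrank_eq K[X] (RatFunc K) B F]
  exact Algebra.finrank_eq_of_equiv_equiv e.toRingEquiv (RingEquiv.refl F) rfl

end Rank

/-! ### Degrees of residue field extensions -/

section LocalDegree

open IsLocalRing

/-- The degree of the residue field extension of a local homomorphism (zero if infinite). -/
noncomputable def localDegree {R S : Type*} [CommRing R] [CommRing S]
    [IsLocalRing R] [IsLocalRing S]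
    (φ : R →+* S) [IsLocalHom φ] : ℕ :=
  letI := (ResidueField.map φ).toAlgebra
  Module.finrank (ResidueField R) (ResidueField S)

variable {R S T : Type*} [CommRing R] [CommRing S] [CommRing T] [IsLocalRing R] [IsLocalRing S]
  [IsLocalRing T]

lemma localDegree_comp (ψ : S →+* T) (φ : R →+* S) [IsLocalHom φ] [IsLocalHom ψ] :
    localDegree (ψ.comp φ) = localDegree φ * localDegree ψ := by
  let _ := (ResidueField.map φ).toAlgebra
  let _ := (ResidueField.map ψ).toAlgebra
  let _ := (ResidueField.map (ψ.comp φ)).toAlgebra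
  have : IsScalarTower (ResidueField R) (ResidueField S) (ResidueField T) :=
    .of_algebraMap_eq' (ResidueField.map_comp φ ψ)
  exact (Module.finrank_mul_finrank (ResidueField R) (ResidueField S) (ResidueField T)).symm

lemma localDegree_eq_one_of_surjective (φ : R →+* S) [IsLocalHom φ] (h : Function.Surjective φ) :
    localDegree φ = 1 := by
  let _ := (ResidueField.map φ).toAlgebra
  have hs : Function.Surjective (ResidueField.map φ) := by
    intro x
    obtain ⟨x, rfl⟩ := residue_surjective x
    obtain ⟨x, rfl⟩ := h x
    exact ⟨residue R x, ResidueField.map_residue φ x⟩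
  let e : ResidueField R ≃ₗ[ResidueField R] ResidueField S :=
    LinearEquiv.ofBijective (Algebra.linearMap _ _) ⟨RingHom.injective _, hs⟩
  exact e.symm.finrank_eq.trans (Module.finrank_self _)

lemma localDegree_algebraMap [Algebra R S] [IsLocalHom (algebraMap R S)] :
    localDegree (algebraMap R S) = Module.finrank (ResidueField R) (ResidueField S) := by
  rw [localDegree]
  congr 1
  refine Module.ext' _ _ fun r m ↦ ?_
  obtain ⟨r, rfl⟩ := residue_surjective r
  obtain ⟨m, rfl⟩ := residue_surjective m
  change residue S (algebraMap R S r) * residue S m = residue R r • residue S m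
  rw [← map_mul, ← Algebra.smul_def]
  rfl

end LocalDegree

/-! ### Invariance of lengths and orders under ring maps -/

section Length

lemma length_quotient_ker_of_surjective {R S : Type*} [CommRing R] [CommRing S] {φ : R →+* S}
    (h : Function.Surjective φ) : Module.length R (R ⧸ RingHom.ker φ) = Module.length S S := by
  let _ := φ.toAlgebra
  rw [← Module.length_eq_of_surjective (R := S) (M := S) h]
  exact LinearEquiv.length_eq
    ((Algebra.linearMap R S).quotKerEquivOfSurjective h)

lemma length_eq_of_bijective {R S : Type*} [CommRing R] [CommRing S] {φ : R →+* S}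
    (h : Function.Bijective φ) : Module.length R R = Module.length S S := by
  rw [← length_quotient_ker_of_surjective h.2, (RingHom.injective_iff_ker_eq_bot φ).mp h.1]
  exact (Submodule.quotEquivOfEqBot (⊥ : Submodule R R) rfl).symm.length_eq

lemma ringOrd_map_of_bijective {R S : Type*} [CommRing R] [CommRing S] {φ : R →+* S}
    (h : Function.Bijective φ) (a : R) : Ring.ord S (φ a) = Ring.ord R a := by
  have h1 := length_quotient_ker_of_surjective
    (φ := Ideal.Quotient.mk (Ideal.span {φ a})) Ideal.Quotient.mk_surjective
  have h2 := length_quotient_ker_of_surjective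
    (φ := (Ideal.Quotient.mk (Ideal.span {φ a})).comp φ) (Ideal.Quotient.mk_surjective.comp h.2)
  have h3 : RingHom.ker ((Ideal.Quotient.mk (Ideal.span {φ a})).comp φ) = Ideal.span {a} := by
    ext x
    rw [RingHom.mem_ker, RingHom.comp_apply, Ideal.Quotient.eq_zero_iff_mem,
      Ideal.mem_span_singleton', Ideal.mem_span_singleton']
    constructor
    · rintro ⟨y, hy⟩
      obtain ⟨y, rfl⟩ := h.2 y
      exact ⟨y, h.1 (by rw [map_mul, hy])⟩
    · rintro ⟨y, rfl⟩
      exact ⟨φ y, (map_mul _ _ _).symm⟩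
  rw [Ideal.mk_ker] at h1
  rw [h3] at h2
  exact h1.trans h2.symm

lemma ordInt_map_of_bijective {A A' F F' : Type*} [CommRing A] [IsDomain A] [IsNoetherianRing A]
    [Ring.KrullDimLE 1 A] [Field F] [Algebra A F] [IsFractionRing A F] [CommRing A'] [IsDomain A']
    [IsNoetherianRing A'] [Ring.KrullDimLE 1 A'] [Field F'] [Algebra A' F'] [IsFractionRing A' F']
    {φ : A →+* A'} (hφ : Function.Bijective φ) {ψ : F →+* F'}
    (h : ψ.comp (algebraMap A F) = (algebraMap A' F').comp φ) {g : F} (hg : g ≠ 0) :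
    ordInt A' (ψ g) = ordInt A g := by
  obtain ⟨a, b, hb, rfl⟩ := IsFractionRing.div_surjective A g
  have hb0 : b ≠ 0 := nonZeroDivisors.ne_zero hb
  have ha0 : a ≠ 0 := by rintro rfl; simp at hg
  have hφ0 {x : A} (hx : x ≠ 0) : φ x ≠ 0 := (map_ne_zero_iff φ hφ.1).mpr hx
  have h' (x : A) : ψ (algebraMap A F x) = algebraMap A' F' (φ x) := congr($h x)
  rw [map_div₀, h', h', ordInt_div (hφ0 ha0) (hφ0 hb0), ordInt_div ha0 hb0,
    ringOrd_map_of_bijective hφ, ringOrd_map_of_bijective hφ]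

end Length

lemma residueDegree_eq_localDegree {X Y : Scheme.{u}} (f : X ⟶ Y) (x : X) :
    f.residueDegree x = localDegree (f.stalkMap x).hom := rfl

lemma residueDegree_comp {X Y Z : Scheme.{u}} (f : X ⟶ Y) (g : Y ⟶ Z) (x : X) :
    (f ≫ g).residueDegree x = f.residueDegree x * g.residueDegree (f x) := by
  have key : ∀ φ : Z.residueField (g (f x)) →+* X.residueField x,
      φ = (f.residueFieldMap x).hom.comp (g.residueFieldMap (f x)).hom →
      @Module.finrank _ _ _ _ φ.toAlgebra.toModule = f.residueDegree x * g.residueDegree (f x) := by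
    rintro _ rfl
    let _ := (f.residueFieldMap x).hom.toAlgebra
    let _ := (g.residueFieldMap (f x)).hom.toAlgebra
    let _ := ((f.residueFieldMap x).hom.comp (g.residueFieldMap (f x)).hom).toAlgebra
    have : IsScalarTower (Z.residueField (g (f x))) (Y.residueField (f x)) (X.residueField x) :=
      .of_algebraMap_eq' rfl
    exact (Module.finrank_mul_finrank (Z.residueField (g (f x))) (Y.residueField (f x))
      (X.residueField x)).symm.trans (mul_comm _ _)
  exact key _ (congr_arg CommRingCat.Hom.hom (Scheme.residueFieldMap_comp f g x))

lemma residueDegree_eq_one {X Y : Scheme.{u}} (f : X ⟶ Y) [SurjectiveOnStalks f] (x : X) :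
    f.residueDegree x = 1 :=
  localDegree_eq_one_of_surjective _ (f.stalkMap_surjective x)

lemma residueDegree_congr {X Y : Scheme.{u}} {f g : X ⟶ Y} (h : f = g) (x : X) :
    f.residueDegree x = g.residueDegree x := by
  rw [h]

/-! ### Flat preimmersions -/

lemma flat_fromSpecStalk (X : Scheme.{u}) (x : X) : Flat (X.fromSpecStalk x) := by
  obtain ⟨_, ⟨U, hU, rfl⟩, hxU, -⟩ := X.isBasis_affineOpens.exists_subset_of_mem_open
    (Set.mem_univ x) isOpen_univ
  rw [← hU.fromSpecStalk_eq_fromSpecStalk hxU]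
  let _ : Algebra Γ(X, U) (X.presheaf.stalk x) := (X.presheaf.germ U x hxU).hom.toAlgebra
  have := hU.isLocalization_stalk ⟨x, hxU⟩
  have : Module.Flat Γ(X, U) (X.presheaf.stalk x) :=
    IsLocalization.flat _ (hU.primeIdealOf ⟨x, hxU⟩).asIdeal.primeCompl
  have : Flat (Spec.map (X.presheaf.germ U x hxU)) := Flat.SpecMap_iff.mpr this
  have := hU.isOpenImmersion_fromSpec
  exact Flat.comp _ _

/-- A flat local homomorphism is faithfully flat, hence injective. Lengths and orders of vanishing
can thus be computed after localizing over a generic point of the base. -/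
lemma bijective_stalkMap {X Y : Scheme.{u}} (f : X ⟶ Y) [Flat f] [SurjectiveOnStalks f] (x : X) :
    Function.Bijective (f.stalkMap x).hom := by
  refine ⟨?_, f.stalkMap_surjective x⟩
  let _ := (f.stalkMap x).hom.toAlgebra
  have : Module.Flat (Y.presheaf.stalk (f x)) (X.presheaf.stalk x) := Flat.stalkMap f x
  have : IsLocalHom (algebraMap (Y.presheaf.stalk (f x)) (X.presheaf.stalk x)) :=
    inferInstanceAs (IsLocalHom (f.stalkMap x).hom)
  have := Module.FaithfullyFlat.of_flat_of_isLocalHom (A := Y.presheaf.stalk (f x))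
    (B := X.presheaf.stalk x)
  exact FaithfulSMul.algebraMap_injective (Y.presheaf.stalk (f x)) (X.presheaf.stalk x)

section Order

variable {X Y : Scheme.{u}}

lemma ord_eq_ordInt [IsIntegral X] [IsLocallyNoetherian X] {x : X} (hx : Order.coheight x = 1)
    [Ring.KrullDimLE 1 (X.presheaf.stalk x)] (g : X.functionField) :
    Scheme.ord g x = ordInt (X.presheaf.stalk x) g :=
  Scheme.ord_eq_ordHom_of_coheight_eq_one hx g

/-- The map of function fields induced by a morphism preserving generic points. -/
noncomputable def functionFieldMap [IsIntegral X] [IsIntegral Y] (f : X ⟶ Y)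
    (h : f (genericPoint X) = genericPoint Y) : Y.functionField →+* X.functionField :=
  (Y.presheaf.stalkSpecializes (specializes_of_eq h) ≫ f.stalkMap (genericPoint X)).hom

lemma functionFieldMap_comp_algebraMap [IsIntegral X] [IsIntegral Y] (f : X ⟶ Y)
    (h : f (genericPoint X) = genericPoint Y) (x : X) :
    (functionFieldMap f h).comp (algebraMap (Y.presheaf.stalk (f x)) Y.functionField) =
      (algebraMap (X.presheaf.stalk x) X.functionField).comp (f.stalkMap x).hom := by
  have := f.stalkSpecializes_stalkMap (genericPoint X) x (genericPoint_specializes x)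
  have h2 := congr_arg CommRingCat.Hom.hom this
  rw [CommRingCat.hom_comp, CommRingCat.hom_comp] at h2
  refine Eq.trans ?_ h2
  change ((f.stalkMap (genericPoint X)).hom.comp _).comp _ = _
  rw [RingHom.comp_assoc]
  congr 1
  exact congr_arg CommRingCat.Hom.hom (Y.presheaf.stalkSpecializes_comp
    (specializes_of_eq h) (genericPoint_specializes (f x)))

lemma ordInt_functionFieldMap [IsIntegral X] [IsIntegral Y] (f : X ⟶ Y) [Flat f]
    [SurjectiveOnStalks f] (h : f (genericPoint X) = genericPoint Y) [IsLocallyNoetherian X]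
    [IsLocallyNoetherian Y] (x : X) [Ring.KrullDimLE 1 (X.presheaf.stalk x)]
    [Ring.KrullDimLE 1 (Y.presheaf.stalk (f x))] {g : Y.functionField} (hg : g ≠ 0) :
    ordInt (X.presheaf.stalk x) (functionFieldMap f h g) = ordInt (Y.presheaf.stalk (f x)) g :=
  ordInt_map_of_bijective (bijective_stalkMap f x) (functionFieldMap_comp_algebraMap f h x) hg

end Order

/-! ### The graph of a rational function on a curve -/

/-- By the universal property `P` maps to the subring generated by the two images, and the composite
`P → S → P` is the identity. -/
lemma closure_range_union_range_of_isPushout {R A B P : CommRingCat.{u}} {f : R ⟶ A} {g : R ⟶ B}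
    {inl : A ⟶ P} {inr : B ⟶ P} (h : IsPushout f g inl inr) :
    Subring.closure (Set.range inl ∪ Set.range inr) = ⊤ := by
  set S := Subring.closure (Set.range inl ∪ Set.range inr)
  let l : A ⟶ CommRingCat.of S := CommRingCat.ofHom <| inl.hom.codRestrict S fun x ↦
    Subring.subset_closure (.inl ⟨x, rfl⟩)
  let r : B ⟶ CommRingCat.of S := CommRingCat.ofHom <| inr.hom.codRestrict S fun x ↦
    Subring.subset_closure (.inr ⟨x, rfl⟩)
  have hw : f ≫ l = g ≫ r := by
    refine CommRingCat.hom_ext (RingHom.ext fun x ↦ Subtype.ext ?_)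
    exact congr($(h.w) x)
  have hd : h.desc l r hw ≫ CommRingCat.ofHom S.subtype = 𝟙 P := by
    refine h.hom_ext ?_ ?_
    · rw [← Category.assoc, h.inl_desc, Category.comp_id]
      rfl
    · rw [← Category.assoc, h.inr_desc, Category.comp_id]
      rfl
  rw [eq_top_iff]
  intro x _
  have : S.subtype (h.desc l r hw x) = x := congr($hd x)
  exact this ▸ (h.desc l r hw x).2

section FieldOver

variable {K : Type u} [Field K] {Y : Scheme.{u}} [IsIntegral Y] (π : Y ⟶ Spec (.of K))

/-- The structure of the function field of an integral scheme over a field as an extension. -/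
noncomputable def functionFieldHom : CommRingCat.of K ⟶ Y.functionField :=
  Spec.preimage (Y.fromSpecStalk (genericPoint Y) ≫ π)

lemma SpecMap_functionFieldHom :
    Spec.map (functionFieldHom π) = Y.fromSpecStalk (genericPoint Y) ≫ π :=
  Spec.map_preimage _

/-- The function field as an algebra over the base field. -/
noncomputable abbrev functionFieldAlgebra : Algebra K Y.functionField :=
  (functionFieldHom π).hom.toAlgebra

open Polynomial in
/-- Evaluation of polynomials at a rational function. -/
noncomputable def evalFunction (g : Y.functionField) : CommRingCat.of K[X] ⟶ Y.functionField :=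
  CommRingCat.ofHom (eval₂RingHom (functionFieldHom π).hom g)

lemma le_preimage_top {X Y : Scheme.{u}} (f : X ⟶ Y) (U : X.Opens) : U ≤ f ⁻¹ᵁ ⊤ := le_top

lemma appLE_congr_hom {X Y : Scheme.{u}} {f g : X ⟶ Y} (h : f = g) {U : Y.Opens} {V : X.Opens}
    (e : V ≤ f ⁻¹ᵁ U) : f.appLE U V e = g.appLE U V (h ▸ e) := by
  subst h
  rfl

/-- The ring homomorphism `Γ(D, U) ⟶ F` induced by a morphism `Spec F ⟶ D` with image in `U`. -/
noncomputable def sectionsTo {F : CommRingCat.{u}} {D : Scheme.{u}} (τ : Spec F ⟶ D) (U : D.Opens)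
    (h : ⊤ ≤ τ ⁻¹ᵁ U) : Γ(D, U) ⟶ F :=
  τ.appLE U ⊤ h ≫ (Scheme.ΓSpecIso F).hom

lemma appLE_comp_sectionsTo {F : CommRingCat.{u}} {D E : Scheme.{u}} (τ : Spec F ⟶ D) (a : D ⟶ E)
    (V : E.Opens) (U : D.Opens) (h : ⊤ ≤ τ ⁻¹ᵁ U) (h' : U ≤ a ⁻¹ᵁ V) :
    a.appLE V U h' ≫ sectionsTo τ U h =
      sectionsTo (τ ≫ a) V (h.trans fun _ hx ↦ h' hx) := by
  rw [sectionsTo, sectionsTo, ← Category.assoc, Scheme.Hom.appLE_comp_appLE]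

lemma map_comp_sectionsTo {F : CommRingCat.{u}} {D : Scheme.{u}} (τ : Spec F ⟶ D)
    {U V : D.Opens} (h : ⊤ ≤ τ ⁻¹ᵁ U) (i : U ⟶ V) :
    D.presheaf.map i.op ≫ sectionsTo τ U h =
      sectionsTo τ V (h.trans fun _ hx ↦ i.le hx) := by
  rw [sectionsTo, sectionsTo, ← Category.assoc, Scheme.Hom.map_appLE]

lemma sectionsTo_fromSpecStalk {Y : Scheme.{u}} (x : Y) (V : Y.Opens)
    (h : ⊤ ≤ (Y.fromSpecStalk x) ⁻¹ᵁ V)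
    (hx : x ∈ V) : sectionsTo (Y.fromSpecStalk x) V h = Y.presheaf.germ V x hx := by
  rw [sectionsTo, Scheme.Hom.appLE, Scheme.fromSpecStalk_app hx]
  simp only [Category.assoc]
  rw [← Functor.map_comp_assoc]
  have : ((homOfLE le_top).op ≫ (homOfLE h).op :
      Opposite.op (⊤ : (Spec (Y.presheaf.stalk x)).Opens) ⟶ _) = 𝟙 _ := rfl
  rw [this, CategoryTheory.Functor.map_id]
  simp

lemma sectionsTo_SpecMap {R S : CommRingCat.{u}} (φ : R ⟶ S) (h) :
    sectionsTo (Spec.map φ) ⊤ h = (Scheme.ΓSpecIso R).hom ≫ φ := by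
  rw [sectionsTo, ← Scheme.ΓSpecIso_naturality]
  congr 1

end FieldOver

open Polynomial in
/-- A model `D` of an integral scheme `C` over which a rational function `g` extends to a morphism
to the affine line: over an affine open `V` of `C` it is the spectrum of `Γ(Y, V)[g]`. -/
structure GraphModel {K : Type u} [Field K] {Y : Scheme.{u}} [IsIntegral Y] (π : Y ⟶ Spec (.of K))
    (g : Y.functionField) where
  /-- The underlying scheme. -/
  D : Scheme.{u}
  /-- The projection to the curve. -/
  a : D ⟶ Y
  /-- The projection to the affine line. -/
  b : D ⟶ Spec (.of K[X])
  /-- The generic point. -/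
  τ : Spec Y.functionField ⟶ D
  isAffineHom_a : IsAffineHom a
  isProper_b : IsProper b
  comm : a ≫ π = b ≫ Spec.map (CommRingCat.ofHom Polynomial.C)
  τ_a : τ ≫ a = Y.fromSpecStalk (genericPoint Y)
  τ_b : τ ≫ b = Spec.map (evalFunction π g)
  -- This and `exists_eval` say that the functions over `V` form the subring `Γ(Y, V)[g]` of the
  -- function field.
  sectionsTo_injective (V : Y.Opens) (hV : IsAffineOpen V) (h : ⊤ ≤ τ ⁻¹ᵁ a ⁻¹ᵁ V) :
    Function.Injective (sectionsTo τ (a ⁻¹ᵁ V) h)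
  exists_eval (V : Y.Opens) (hV : IsAffineOpen V) (s : Γ(D, a ⁻¹ᵁ V)) :
    ∃ q : (Γ(Y, V))[X], q.eval₂ (a.app V).hom
      (b.appLE ⊤ (a ⁻¹ᵁ V) (le_preimage_top _ _) ((Scheme.ΓSpecIso (.of K[X])).inv X)) = s

section Existence

open Polynomial

variable {K : Type u} [Field K] {Y : Scheme.{u}} {π : Y ⟶ Spec (.of K)}

/-- Over an affine `V` the functions on `Y × 𝔸¹` form the pushout of `Γ(Y, V)` and `K[X]` over `K`,
which is generated by `Γ(Y, V)` and the coordinate. -/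
lemma exists_eval_of_isPullback {P : Scheme.{u}} {p : P ⟶ Y} {q : P ⟶ Spec (.of K[X])}
    (H : IsPullback p q π (Spec.map (CommRingCat.ofHom C))) (V : Y.Opens) (hV : IsAffineOpen V)
    (s : Γ(P, p ⁻¹ᵁ V)) :
    ∃ r : (Γ(Y, V))[X], r.eval₂ (p.app V).hom
      (q.appLE ⊤ (p ⁻¹ᵁ V) (le_preimage_top _ _) ((Scheme.ΓSpecIso (.of K[X])).inv X)) = s := by
  have hUY : p ⁻¹ᵁ V = p ⁻¹ᵁ V ⊓ q ⁻¹ᵁ ⊤ := by simp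
  have hiso := isIso_pushoutSection_of_isAffineOpen H (UT := ⊤) (le_preimage_top _ _)
    (le_preimage_top π V) hUY (isAffineOpen_top _) (isAffineOpen_top _) hV
  have hpush := (isIso_pushoutSection_iff H (UT := ⊤) (le_preimage_top _ _)
    (le_preimage_top π V) hUY).mp hiso
  have hcl := closure_range_union_range_of_isPushout hpush
  set t := q.appLE ⊤ (p ⁻¹ᵁ V) (le_preimage_top _ _) ((Scheme.ΓSpecIso (.of K[X])).inv X) with ht
  let θ : (Γ(Y, V))[X] →+* Γ(P, p ⁻¹ᵁ V) := eval₂RingHom (p.app V).hom t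
  suffices h : θ.range = ⊤ by
    have : s ∈ θ.range := h ▸ trivial
    exact this
  rw [eq_top_iff, ← hcl, Subring.closure_le, Set.union_subset_iff]
  constructor
  · rintro _ ⟨x, rfl⟩
    refine ⟨C x, ?_⟩
    rw [← Scheme.Hom.app_eq_appLE]
    exact eval₂_C _ _
  · rintro _ ⟨x, rfl⟩
    obtain ⟨r, rfl⟩ : ∃ r, (Scheme.ΓSpecIso (.of K[X])).inv r = x :=
      ⟨(Scheme.ΓSpecIso (.of K[X])).hom x, by simp⟩
    let κ : CommRingCat.of K ⟶ Γ(Y, V) :=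
      (Scheme.ΓSpecIso (.of K)).inv ≫ π.appLE ⊤ V (le_preimage_top _ _)
    refine ⟨r.map κ.hom, ?_⟩
    suffices h : θ.comp (mapRingHom κ.hom) = ((Scheme.ΓSpecIso (.of K[X])).inv ≫
        q.appLE ⊤ (p ⁻¹ᵁ V) (le_preimage_top _ _)).hom from congr($h r)
    refine Polynomial.ringHom_ext' ?_ ?_
    · have h1 : κ ≫ p.app V = CommRingCat.ofHom C ≫
          (Scheme.ΓSpecIso (.of K[X])).inv ≫ q.appLE ⊤ (p ⁻¹ᵁ V) (le_preimage_top _ _) := by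
        rw [Scheme.Hom.app_eq_appLE, Category.assoc, Scheme.Hom.appLE_comp_appLE,
          Scheme.ΓSpecIso_inv_naturality_assoc]
        exact congr_arg (_ ≫ ·) ((appLE_congr_hom H.w _).trans (Scheme.Hom.comp_appLE _ _ _ _ _))
      refine Eq.trans ?_ (congr_arg CommRingCat.Hom.hom h1)
      ext x
      simp [θ]
    · simp [θ, ht]

lemma top_le_preimage_of_isAffineOpen [IsIntegral Y] {V : Y.Opens} [Nonempty V] :
    ⊤ ≤ Y.fromSpecStalk (genericPoint Y) ⁻¹ᵁ V :=
  (Scheme.preimage_eq_top_of_closedPoint_mem _ (by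
    rw [Scheme.fromSpecStalk_closedPoint]
    exact ((genericPoint_spec Y).mem_open_set_iff V.isOpen).mpr
      (by obtain ⟨a⟩ := ‹Nonempty V›; exact ⟨a.1, trivial, a.2⟩))).ge

variable [IsIntegral Y] (π)

/-- `D` is the scheme-theoretic image of `(η, g) : Spec F ⟶ Y × 𝔸¹`. Being closed in `Y × 𝔸¹`, it is
affine over `Y`, and it is proper over `𝔸¹` because `Y` is proper over `K`. -/
theorem nonempty_graphModel [IsProper π] (g : Y.functionField) : Nonempty (GraphModel π g) := by
  let c : Spec (.of K[X]) ⟶ Spec (.of K) := Spec.map (CommRingCat.ofHom C)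
  have hw : Y.fromSpecStalk (genericPoint Y) ≫ π = Spec.map (evalFunction π g) ≫ c := by
    rw [← SpecMap_functionFieldHom, ← Spec.map_comp]
    congr 1
    ext x
    exact (eval₂_C _ _).symm
  let γ : Spec Y.functionField ⟶ pullback π c :=
    pullback.lift (Y.fromSpecStalk (genericPoint Y)) (Spec.map (evalFunction π g)) hw
  have hγ : γ ≫ pullback.snd π c = Spec.map (evalFunction π g) := pullback.lift_snd _ _ _
  have hγ' : γ ≫ pullback.fst π c = Y.fromSpecStalk (genericPoint Y) := pullback.lift_fst _ _ _
  have : QuasiCompact (γ ≫ pullback.snd π c) := by rw [hγ]; infer_instance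
  have : QuasiCompact γ := .of_comp γ (pullback.snd π c)
  have : IsAffineHom c := inferInstance
  have : IsAffineHom (pullback.fst π c) := 
    isAffineHom_isStableUnderBaseChange.of_isPullback (IsPullback.of_hasPullback π c).flip ‹_›
  refine ⟨{
    D := γ.image
    a := γ.imageι ≫ pullback.fst π c
    b := γ.imageι ≫ pullback.snd π c
    τ := γ.toImage
    isAffineHom_a := inferInstance
    isProper_b := inferInstance
    comm := by rw [Category.assoc, Category.assoc, pullback.condition]
    τ_a := by rw [Scheme.Hom.toImage_imageι_assoc, hγ']
    τ_b := by rw [Scheme.Hom.toImage_imageι_assoc, hγ]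
    sectionsTo_injective := fun V hV h ↦ ?_
    exists_eval := fun V hV s ↦ ?_ }⟩
  · refine (Scheme.ΓSpecIso _).commRingCatIsoToRingEquiv.injective.comp
      (f := γ.toImage.appLE _ ⊤ h) ?_
    have e : γ.toImage ⁻¹ᵁ (γ.imageι ≫ pullback.fst π c) ⁻¹ᵁ V = ⊤ := top_le_iff.mp h
    refine Function.Injective.comp (f := γ.toImage.app _)
      (g := (Spec Y.functionField).presheaf.map (homOfLE h).op) ?_
      (γ.toImage_app_injective (U := ⟨pullback.fst π c ⁻¹ᵁ V, hV.preimage _⟩))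
    have : IsIso (homOfLE h) := ⟨eqToHom e, Subsingleton.elim _ _, Subsingleton.elim _ _⟩
    exact (ConcreteCategory.bijective_of_isIso
      ((Spec Y.functionField).presheaf.map (homOfLE h).op)).1
  · obtain ⟨s, rfl⟩ := γ.imageι.app_surjective (pullback.fst π c ⁻¹ᵁ V) (hV.preimage _) s
    obtain ⟨r, rfl⟩ := exists_eval_of_isPullback (.of_hasPullback π c) V hV s
    refine ⟨r, ?_⟩
    change _ = (γ.imageι.app (pullback.fst π c ⁻¹ᵁ V)).hom _
    rw [hom_eval₂]
    refine congr_arg₂ (fun φ t ↦ eval₂ φ t r) ?_ ?_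
    · exact congr_arg CommRingCat.Hom.hom (Scheme.Hom.comp_app _ _ _)
    · have h1 := Scheme.Hom.appLE_comp_appLE γ.imageι (pullback.snd π c) ⊤ (pullback.fst π c ⁻¹ᵁ V)
        (γ.imageι ⁻¹ᵁ pullback.fst π c ⁻¹ᵁ V) (le_preimage_top _ _) le_rfl
      rw [Scheme.Hom.appLE_eq_app] at h1
      exact congr($h1.symm _)

end Existence

lemma krullDimLE_of_isAffineOpen {Y : Scheme.{u}} {n : ℕ}
    (h : ∀ y : Y, Ring.KrullDimLE n (Y.presheaf.stalk y)) {V : Y.Opens} (hV : IsAffineOpen V) :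
    Ring.KrullDimLE n Γ(Y, V) := by
  rw [Ring.krullDimLE_iff, ringKrullDim_le_iff_isMaximal_height_le]
  intro m hm
  let y : V := ⟨hV.fromSpec ⟨m, hm.isPrime⟩, (hV.isoSpec.inv ⟨m, hm.isPrime⟩).2⟩
  let _ := Y.presheaf.algebra_section_stalk y
  have hloc : IsLocalization.AtPrime (Y.presheaf.stalk y.1) m :=
    hV.isLocalization_stalk' ⟨m, hm.isPrime⟩ y.2
  rw [← IsLocalization.AtPrime.ringKrullDim_eq_height m (Y.presheaf.stalk y.1)]
  exact Ring.krullDimLE_iff.mp (h y.1)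

namespace GraphModel

open Polynomial

variable {K : Type u} [Field K] {Y : Scheme.{u}} [IsIntegral Y] {π : Y ⟶ Spec (.of K)}
  {g : Y.functionField} (M : GraphModel π g)

lemma top_le (V : Y.Opens) [Nonempty V] : ⊤ ≤ M.τ ⁻¹ᵁ M.a ⁻¹ᵁ V := by
  have h : ⊤ ≤ (M.τ ≫ M.a) ⁻¹ᵁ V := by
    rw [M.τ_a]
    exact top_le_preimage_of_isAffineOpen
  exact h

/-- The coordinate of the affine line as a function on the model. -/
noncomputable def coord (U : M.D.Opens) : Γ(M.D, U) :=
  M.b.appLE ⊤ U (le_preimage_top _ _) ((Scheme.ΓSpecIso (.of K[X])).inv X)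

/-- The inclusion of functions on the model into the function field. -/
noncomputable def toF (V : Y.Opens) [Nonempty V] : Γ(M.D, M.a ⁻¹ᵁ V) ⟶ Y.functionField :=
  sectionsTo M.τ (M.a ⁻¹ᵁ V) (M.top_le V)

lemma sectionsTo_congr {F : CommRingCat.{u}} {D : Scheme.{u}} {τ τ' : Spec F ⟶ D} (h : τ = τ')
    {U : D.Opens} (hU : ⊤ ≤ τ ⁻¹ᵁ U) : sectionsTo τ U hU = sectionsTo τ' U (h ▸ hU) := by
  subst h
  rfl

lemma app_toF (V : Y.Opens) [Nonempty V] : M.a.app V ≫ M.toF V = Y.germToFunctionField V := by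
  have h := appLE_comp_sectionsTo M.τ M.a V (M.a ⁻¹ᵁ V) (M.top_le V) le_rfl
  rw [Scheme.Hom.appLE_eq_app, sectionsTo_congr M.τ_a] at h
  exact h.trans (sectionsTo_fromSpecStalk _ _ _ _)

lemma appLE_sectionsTo (U : M.D.Opens) (hU : ⊤ ≤ M.τ ⁻¹ᵁ U) :
    (Scheme.ΓSpecIso (.of K[X])).inv ≫ M.b.appLE ⊤ U (le_preimage_top _ _) ≫ sectionsTo M.τ U hU =
      evalFunction π g := by
  have h := appLE_comp_sectionsTo M.τ M.b ⊤ U hU (le_preimage_top _ _)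
  rw [sectionsTo_congr M.τ_b, sectionsTo_SpecMap] at h
  rw [h, Iso.inv_hom_id_assoc]

lemma sectionsTo_coord (U : M.D.Opens) (hU : ⊤ ≤ M.τ ⁻¹ᵁ U) :
    sectionsTo M.τ U hU (M.coord U) = g :=
  congr($(M.appLE_sectionsTo U hU) X).trans (eval₂_X _ _)

/-- Functions on the model as an algebra over the functions on the curve. -/
noncomputable abbrev algebraLeft (V : Y.Opens) : Algebra Γ(Y, V) Γ(M.D, M.a ⁻¹ᵁ V) :=
  (M.a.app V).hom.toAlgebra

/-- The function field as an algebra over the functions on the model. -/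
noncomputable abbrev algebraRight (V : Y.Opens) [Nonempty V] :
    Algebra Γ(M.D, M.a ⁻¹ᵁ V) Y.functionField :=
  (M.toF V).hom.toAlgebra

lemma adjoin_coord (V : Y.Opens) (hV : IsAffineOpen V) :
    letI := M.algebraLeft V
    Algebra.adjoin Γ(Y, V) {M.coord (M.a ⁻¹ᵁ V)} = ⊤ := by
  let _ := M.algebraLeft V
  rw [eq_top_iff]
  intro s _
  obtain ⟨q, rfl⟩ := M.exists_eval V hV s
  rw [Algebra.adjoin_singleton_eq_range_aeval]
  exact ⟨q, rfl⟩

lemma isScalarTower (V : Y.Opens) [Nonempty V] :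
    letI := M.algebraLeft V
    letI := M.algebraRight V
    IsScalarTower Γ(Y, V) Γ(M.D, M.a ⁻¹ᵁ V) Y.functionField :=
  letI := M.algebraLeft V
  letI := M.algebraRight V
  .of_algebraMap_eq' (congr_arg CommRingCat.Hom.hom (M.app_toF V)).symm

lemma faithfulSMul (V : Y.Opens) (hV : IsAffineOpen V) [Nonempty V] :
    letI := M.algebraRight V
    FaithfulSMul Γ(M.D, M.a ⁻¹ᵁ V) Y.functionField :=
  letI := M.algebraRight V
  (faithfulSMul_iff_algebraMap_injective _ _).mpr (M.sectionsTo_injective V hV _)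

lemma isDomain (V : Y.Opens) (hV : IsAffineOpen V) [Nonempty V] : IsDomain Γ(M.D, M.a ⁻¹ᵁ V) :=
  (M.sectionsTo_injective V hV (M.top_le V)).isDomain (M.toF V).hom

lemma evalFunction_injective (hg : letI := functionFieldAlgebra π; Transcendental K g) :
    Function.Injective (evalFunction π g) := by
  let _ := functionFieldAlgebra π
  exact transcendental_iff_injective.mp hg

/-- A proper quasi-finite morphism is finite. Quasi-finiteness is checked on the charts `Γ(Y,
V)[g]`, which have dimension at most one and contain `K[X]` since `g` is transcendental. -/
theorem isFinite_b [IsProper π] (hdim : ∀ y : Y, Ring.KrullDimLE 1 (Y.presheaf.stalk y))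
    (hg : letI := functionFieldAlgebra π; Transcendental K g) : IsFinite M.b := by
  have := M.isAffineHom_a
  have := M.isProper_b
  suffices LocallyQuasiFinite M.b from .of_isProper_of_locallyQuasiFinite _
  have : IsLocallyNoetherian Y := LocallyOfFiniteType.isLocallyNoetherian π
  let ι := {V : Y.affineOpens // Nonempty V.1}
  refine HasRingHomProperty.of_iSup_eq_top (ι := ι)
    (fun V ↦ ⟨M.a ⁻¹ᵁ V.1.1, V.1.2.preimage M.a⟩) ?_ fun V ↦ ?_
  · rw [eq_top_iff]
    intro x _
    obtain ⟨_, ⟨V, hV, rfl⟩, hxV, -⟩ := Y.isBasis_affineOpens.exists_subset_of_mem_open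
      (Set.mem_univ (M.a x)) isOpen_univ
    exact Opens.mem_iSup.mpr ⟨⟨⟨V, hV⟩, ⟨_, hxV⟩⟩, hxV⟩
  · obtain ⟨⟨V, hV⟩, hVne⟩ := V
    have : Nonempty V := hVne
    change (M.b.appLE ⊤ (M.a ⁻¹ᵁ V) (le_preimage_top _ _)).hom.QuasiFinite
    let _ := M.algebraLeft V
    let _ := M.algebraRight V
    have := M.isScalarTower V
    have := M.faithfulSMul V hV
    have := M.isDomain V hV
    have : IsNoetherianRing Γ(Y, V) := IsLocallyNoetherian.component_noetherian ⟨V, hV⟩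
    have := functionField_isFractionRing_of_isAffineOpen Y V hV
    have := krullDimLE_of_isAffineOpen hdim hV
    have : Ring.KrullDimLE 1 Γ(M.D, M.a ⁻¹ᵁ V) :=
      krullDimLE_of_adjoin_eq_top (A := Γ(Y, V)) (F := Y.functionField) (M.adjoin_coord V hV)
    let φ := (Scheme.ΓSpecIso (.of K[X])).inv ≫
      M.b.appLE ⊤ (M.a ⁻¹ᵁ V) (le_preimage_top _ _)
    let _ : Algebra K[X] Γ(M.D, M.a ⁻¹ᵁ V) := φ.hom.toAlgebra
    have hφ : φ ≫ M.toF V = evalFunction π g := by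
      rw [Category.assoc]
      exact M.appLE_sectionsTo _ _
    have : FaithfulSMul K[X] Γ(M.D, M.a ⁻¹ᵁ V) :=
      (faithfulSMul_iff_algebraMap_injective _ _).mpr <| .of_comp (f := M.toF V) <| by
        have h := evalFunction_injective hg
        rw [← hφ] at h
        exact h
    have : φ.hom.FiniteType := by
      refine RingHom.FiniteType.comp ?_ (.of_surjective _
        (Scheme.ΓSpecIso (.of K[X])).symm.commRingCatIsoToRingEquiv.surjective)
      exact M.b.finiteType_appLE (isAffineOpen_top _) (hV.preimage M.a) _
    have : Algebra.FiniteType K[X] Γ(M.D, M.a ⁻¹ᵁ V) := this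
    have : φ.hom.QuasiFinite := quasiFinite_of_polynomial (K := K)
    exact RingHom.QuasiFinite.of_comp (g := (Scheme.ΓSpecIso (.of K[X])).inv.hom) this

end GraphModel

/-! ### Counting the points of a finite scheme over a local ring -/

lemma localDegree_comp_of_surjective {R S T : Type*} [CommRing R] [CommRing S] [CommRing T]
    [IsLocalRing R] [IsLocalRing S] [IsLocalRing T] {φ : R →+* S} [IsLocalHom φ] {χ : S →+* T}
    {ψ : R →+* T} [IsLocalHom ψ] (hχ : Function.Surjective χ) (h : ψ = χ.comp φ) :
    localDegree ψ = localDegree φ := by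
  subst h
  have : IsLocalHom χ := Function.Surjective.isLocalHom χ hχ
  rw [localDegree_comp, localDegree_eq_one_of_surjective χ hχ, mul_one]

open IsLocalRing in
/-- The length of an Artinian algebra over a local ring, in terms of its localizations. -/
theorem toNat_length_eq_sum (A Q : Type*) [CommRing A] [IsLocalRing A] [CommRing Q]
    [IsArtinianRing Q] [Algebra A Q] [Fintype (PrimeSpectrum Q)] (hfin : Module.length A Q ≠ ⊤)
    (S : PrimeSpectrum Q → Type*) [∀ P, CommRing (S P)] [∀ P, IsLocalRing (S P)]
    [∀ P, Algebra Q (S P)] [∀ P : PrimeSpectrum Q, IsLocalization.AtPrime (S P) P.asIdeal]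
    [∀ P, IsLocalHom ((algebraMap Q (S P)).comp (algebraMap A Q))] :
    (Module.length A Q).toNat = ∑ P, (Module.length (S P) (S P)).toNat *
      localDegree ((algebraMap Q (S P)).comp (algebraMap A Q)) := by
  let e (P : PrimeSpectrum Q) : S P ≃ₐ[Q] Localization.AtPrime P.asIdeal :=
    IsLocalization.algEquiv P.asIdeal.primeCompl _ _
  have he (P : PrimeSpectrum Q) : algebraMap A (Localization.AtPrime P.asIdeal) =
      ((e P).toRingEquiv : S P →+* _).comp ((algebraMap Q (S P)).comp (algebraMap A Q)) := by
    ext x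
    rw [IsScalarTower.algebraMap_apply A Q]
    exact ((e P).commutes _).symm
  have (P : PrimeSpectrum Q) : IsLocalHom (algebraMap A (Localization.AtPrime P.asIdeal)) := by
    rw [he P]
    infer_instance
  have hdeg (P : PrimeSpectrum Q) :
      localDegree ((algebraMap Q (S P)).comp (algebraMap A Q)) =
      localDegree (algebraMap A (Localization.AtPrime P.asIdeal)) :=
    (localDegree_comp_of_surjective (e P).surjective (he P)).symm
  have hlen (P : PrimeSpectrum Q) : Module.length (S P) (S P) =
      Module.length (Localization.AtPrime P.asIdeal) (Localization.AtPrime P.asIdeal) :=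
    length_eq_of_bijective (φ := ((e P).toRingEquiv : S P →+* _)) (e P).bijective
  have hsum := length_eq_sum_localization A Q
  rw [hsum] at hfin
  rw [hsum]
  have hterm : ∀ P ∈ (Finset.univ : Finset (PrimeSpectrum Q)),
      Module.length (Localization.AtPrime P.asIdeal)
      (Localization.AtPrime P.asIdeal) *
      Module.length (ResidueField A) (ResidueField (Localization.AtPrime P.asIdeal)) ≠ ⊤ := by
    intro P hP htop
    exact hfin (top_le_iff.mp (htop ▸ Finset.single_le_sum (f := fun P : PrimeSpectrum Q ↦
      Module.length (Localization.AtPrime P.asIdeal) (Localization.AtPrime P.asIdeal) *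
      Module.length (ResidueField A) (ResidueField (Localization.AtPrime P.asIdeal)))
      (fun _ _ ↦ bot_le) hP))
  rw [ENat.toNat_sum hterm]
  refine Finset.sum_congr rfl fun P hP ↦ ?_
  rw [hdeg, hlen, ENat.toNat_mul, localDegree_algebraMap]
  congr 1
  -- Each summand is finite and its first factor is positive, so the residue extension is finite and
  -- the convention that infinite extensions have degree `0` plays no role.
  have htop : Module.length (ResidueField A) (ResidueField (Localization.AtPrime P.asIdeal)) ≠ ⊤ :=
    fun h ↦ hterm P hP (by rw [h, ENat.mul_top Module.length_pos.ne'])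
  have := (isFiniteLength_iff_isNoetherian_isArtinian.mp (Module.length_ne_top_iff.mp htop)).1
  have : Module.Finite (ResidueField A) (ResidueField (Localization.AtPrime P.asIdeal)) :=
    inferInstance
  rw [Module.length_eq_finrank, ENat.toNat_natCast]

lemma isLocalization_quotient {B S : Type*} [CommRing B] [CommRing S] [Algebra B S] (t : B)
    (P : Ideal (B ⧸ Ideal.span {t})) [P.IsPrime]
    [IsLocalization.AtPrime S (P.comap (Ideal.Quotient.mk (Ideal.span {t})))]
    [Algebra (B ⧸ Ideal.span {t}) (S ⧸ Ideal.span {algebraMap B S t})]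
    (h : (algebraMap (B ⧸ Ideal.span {t}) (S ⧸ Ideal.span {algebraMap B S t})).comp
      (Ideal.Quotient.mk _) = (Ideal.Quotient.mk _).comp (algebraMap B S)) :
    IsLocalization.AtPrime (S ⧸ Ideal.span {algebraMap B S t}) P := by
  have h1 := IsLocalization.of_surjective
    (P.comap (Ideal.Quotient.mk (Ideal.span {t}))).primeCompl S
    (Ideal.Quotient.mk (Ideal.span {t})) Ideal.Quotient.mk_surjective
    (Ideal.Quotient.mk (Ideal.span {algebraMap B S t})) Ideal.Quotient.mk_surjective h.symm
    (by rw [Ideal.mk_ker, Ideal.mk_ker, Ideal.map_span, Set.image_singleton])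
  have h2 : (P.comap (Ideal.Quotient.mk (Ideal.span {t}))).primeCompl.map
      (Ideal.Quotient.mk (Ideal.span {t})) = P.primeCompl := by
    ext x
    obtain ⟨x, rfl⟩ := Ideal.Quotient.mk_surjective x
    constructor
    · rintro ⟨y, hy, hyx⟩
      rw [← hyx]
      exact hy
    · intro hx
      exact ⟨x, hx, rfl⟩
  rw [h2] at h1
  exact h1

section Affine

variable {A : CommRingCat.{u}} {D : Scheme.{u}} (d : D ⟶ Spec A)

/-- The ring homomorphism from the base ring to a stalk. -/
noncomputable def toStalk (y : D) : A ⟶ D.presheaf.stalk y :=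
  (Scheme.ΓSpecIso A).inv ≫ d.appTop ≫ D.presheaf.germ ⊤ y trivial

lemma toStalk_eq (y : D) : toStalk d y = StructureSheaf.toStalk A (d y) ≫ d.stalkMap y := by
  have h : (Spec A).presheaf.germ ⊤ (d y) trivial ≫ d.stalkMap y =
      d.appTop ≫ D.presheaf.germ ⊤ y trivial := d.germ_stalkMap ⊤ y trivial
  rw [toStalk, ← h]
  rfl

lemma bijective_structureSheaf_toStalk [IsLocalRing A] {x : PrimeSpectrum A}
    (hx : x = IsLocalRing.closedPoint A) :
    Function.Bijective (StructureSheaf.toStalk A x).hom := by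
  have h : IsLocalization.AtPrime ((Spec.structureSheaf A).presheaf.stalk x) x.asIdeal :=
    inferInstance
  have h1 : x.asIdeal.primeCompl ≤ IsUnit.submonoid A := by
    intro a ha
    by_contra h
    exact ha (hx ▸ h)
  exact (IsLocalization.atUnits A x.asIdeal.primeCompl h1
    (S := (Spec.structureSheaf A).presheaf.stalk x)).bijective

/-- The stalk of `Spec A` at the closed point of a local ring is `A` itself, so residue degrees can
be computed over `A`. -/
lemma localDegree_toStalk [IsLocalRing A] {y : D} (hy : d y = IsLocalRing.closedPoint A) :
    ∃ _ : IsLocalHom (toStalk d y).hom, localDegree (toStalk d y).hom = d.residueDegree y := by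
  have key : ∀ ψ : A →+* (Spec A).presheaf.stalk (d y), Function.Bijective ψ →
      ∀ φ : A →+* D.presheaf.stalk y, φ = (d.stalkMap y).hom.comp ψ →
      ∃ _ : IsLocalHom φ, localDegree φ = d.residueDegree y := by
    rintro ψ hψ _ rfl
    have : IsLocalHom ψ := Function.Surjective.isLocalHom _ hψ.2
    refine ⟨RingHom.isLocalHom_comp _ _, ?_⟩
    rw [localDegree_comp, localDegree_eq_one_of_surjective _ hψ.2, one_mul]
    rfl
  exact key _ (bijective_structureSheaf_toStalk hy) _
    (congr_arg CommRingCat.Hom.hom (toStalk_eq d y))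

/-- The zero locus of a function. -/
def vanishingSet (t : Γ(D, ⊤)) : Set D :=
  {y | D.presheaf.germ ⊤ y trivial t ∈ IsLocalRing.maximalIdeal (D.presheaf.stalk y)}

/-- The zero locus of a function with Artinian zero scheme is finite. For an affine scheme over a
local ring, the length of the zero scheme is computed by its points. -/
theorem finsum_length_mul_residueDegree [IsLocalRing A] [IsAffine D] (t : Γ(D, ⊤))
    [IsArtinianRing (Γ(D, ⊤) ⧸ Ideal.span {t})]
    (hlen : letI := ((Scheme.ΓSpecIso A).inv ≫ d.appTop).hom.toAlgebra
      Module.length A (Γ(D, ⊤) ⧸ Ideal.span {t}) ≠ ⊤)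
    (hd : ∀ y ∈ vanishingSet t, d y = IsLocalRing.closedPoint A) :
    (vanishingSet t).Finite ∧
    letI := ((Scheme.ΓSpecIso A).inv ≫ d.appTop).hom.toAlgebra
    (Module.length A (Γ(D, ⊤) ⧸ Ideal.span {t})).toNat =
      ∑ᶠ y ∈ vanishingSet t,
        (Module.length (D.presheaf.stalk y ⧸ Ideal.span {D.presheaf.germ ⊤ y trivial t})
          (D.presheaf.stalk y ⧸ Ideal.span {D.presheaf.germ ⊤ y trivial t})).toNat *
        d.residueDegree y := by
  let _ := ((Scheme.ΓSpecIso A).inv ≫ d.appTop).hom.toAlgebra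
  have hD := isAffineOpen_top D
  have := hD.isOpenImmersion_fromSpec
  let q := Ideal.Quotient.mk (Ideal.span {t})
  -- Primes of `Γ(D, ⊤) / (t)` are the points where `t` vanishes, and localizing there gives the
  -- stalk of `D` modulo `t`.
  let pt (P : PrimeSpectrum (Γ(D, ⊤) ⧸ Ideal.span {t})) : D := hD.fromSpec (P.comap q)
  let _ (y : D) : Algebra Γ(D, ⊤) (D.presheaf.stalk y) :=
    (D.presheaf.germ ⊤ y trivial).hom.toAlgebra
  have hloc (P : PrimeSpectrum Γ(D, ⊤)) :
      IsLocalization.AtPrime (D.presheaf.stalk (hD.fromSpec P)) P.asIdeal :=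
    hD.isLocalization_stalk' P trivial
  have hmem (P : PrimeSpectrum Γ(D, ⊤)) : hD.fromSpec P ∈ vanishingSet t ↔ t ∈ P.asIdeal :=
    IsLocalization.AtPrime.to_map_mem_maximal_iff (D.presheaf.stalk (hD.fromSpec P)) P.asIdeal t
  have hpt : Function.Injective pt :=
    hD.fromSpec.isOpenEmbedding.injective.comp
      (PrimeSpectrum.comap_injective_of_surjective q Ideal.Quotient.mk_surjective)
  have hrange : Set.range pt = vanishingSet t := by
    ext y
    obtain ⟨P, rfl⟩ : y ∈ Set.range hD.fromSpec := hD.range_fromSpec ▸ trivial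
    rw [show hD.fromSpec P ∈ vanishingSet t ↔ t ∈ P.asIdeal from hmem P]
    have h : P ∈ Set.range (PrimeSpectrum.comap q) ↔ t ∈ P.asIdeal := by
      rw [range_comap_of_surjective _ q Ideal.Quotient.mk_surjective, Ideal.mk_ker,
        PrimeSpectrum.zeroLocus_span]
      exact Set.singleton_subset_iff
    rw [← h]
    constructor
    · rintro ⟨Q, hQ⟩
      exact ⟨Q, hD.fromSpec.isOpenEmbedding.injective hQ⟩
    · rintro ⟨Q, rfl⟩
      exact ⟨Q, rfl⟩
  let S (y : D) := D.presheaf.stalk y ⧸ Ideal.span {D.presheaf.germ ⊤ y trivial t}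
  have hpt_mem (P) : pt P ∈ vanishingSet t := hrange ▸ ⟨P, rfl⟩
  have hS (y : D) (hy : y ∈ vanishingSet t) : IsLocalRing (S y) := by
    have : Nontrivial (S y) := Ideal.Quotient.nontrivial_iff.mpr fun h ↦
      (IsLocalRing.maximalIdeal.isMaximal (D.presheaf.stalk y)).ne_top
        (top_le_iff.mp (h ▸ (Ideal.span_singleton_le_iff_mem _).mpr hy))
    exact .of_surjective' _ Ideal.Quotient.mk_surjective
  have (P : PrimeSpectrum (Γ(D, ⊤) ⧸ Ideal.span {t})) : IsLocalRing (S (pt P)) := hS _ (hpt_mem P)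
  let φ (y : D) : (Γ(D, ⊤) ⧸ Ideal.span {t}) →+* S y :=
    Ideal.quotientMap _ (algebraMap Γ(D, ⊤) (D.presheaf.stalk y)) (by
      rw [Ideal.span_singleton_le_iff_mem]
      exact Ideal.mem_span_singleton_self _)
  have hφ (y : D) : (φ y).comp (Ideal.Quotient.mk _) =
      (Ideal.Quotient.mk _).comp (algebraMap Γ(D, ⊤) (D.presheaf.stalk y)) :=
    Ideal.quotientMap_comp_mk _
  let _ (P : PrimeSpectrum (Γ(D, ⊤) ⧸ Ideal.span {t})) :
      Algebra (Γ(D, ⊤) ⧸ Ideal.span {t}) (S (pt P)) := (φ (pt P)).toAlgebra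
  have (P : PrimeSpectrum (Γ(D, ⊤) ⧸ Ideal.span {t})) :
      IsLocalization.AtPrime (S (pt P)) P.asIdeal := by
    have : IsLocalization.AtPrime (D.presheaf.stalk (pt P)) (P.asIdeal.comap q) :=
      hloc (P.comap q)
    exact isLocalization_quotient (S := D.presheaf.stalk (pt P)) t P.asIdeal (hφ _)
  have hcomp (P : PrimeSpectrum (Γ(D, ⊤) ⧸ Ideal.span {t})) :
      (algebraMap (Γ(D, ⊤) ⧸ Ideal.span {t}) (S (pt P))).comp
      (algebraMap A (Γ(D, ⊤) ⧸ Ideal.span {t})) =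
      (Ideal.Quotient.mk _).comp (toStalk d (pt P)).hom := by
    change (φ (pt P)).comp (q.comp (algebraMap A Γ(D, ⊤))) = _
    rw [← RingHom.comp_assoc, hφ, RingHom.comp_assoc]
    rfl
  have hdeg (P : PrimeSpectrum (Γ(D, ⊤) ⧸ Ideal.span {t})) :
      ∃ _ : IsLocalHom ((algebraMap (Γ(D, ⊤) ⧸ Ideal.span {t}) (S (pt P))).comp
      (algebraMap A (Γ(D, ⊤) ⧸ Ideal.span {t}))),
      localDegree ((algebraMap (Γ(D, ⊤) ⧸ Ideal.span {t}) (S (pt P))).comp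
      (algebraMap A (Γ(D, ⊤) ⧸ Ideal.span {t}))) = d.residueDegree (pt P) := by
    rw [hcomp]
    obtain ⟨h1, h2⟩ := localDegree_toStalk d (hd _ (hpt_mem P))
    have : IsLocalHom (Ideal.Quotient.mk
        (Ideal.span {D.presheaf.germ ⊤ (pt P) trivial t}) : _ →+* S (pt P)) :=
      Function.Surjective.isLocalHom _ Ideal.Quotient.mk_surjective
    refine ⟨RingHom.isLocalHom_comp _ _, ?_⟩
    rw [localDegree_comp, h2, localDegree_eq_one_of_surjective _ Ideal.Quotient.mk_surjective,
      mul_one]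
  choose h1 h2 using hdeg
  have := Fintype.ofFinite (PrimeSpectrum (Γ(D, ⊤) ⧸ Ideal.span {t}))
  have h := toNat_length_eq_sum A (Γ(D, ⊤) ⧸ Ideal.span {t}) hlen (fun P ↦ S (pt P))
  refine ⟨hrange ▸ Set.finite_range pt, ?_⟩
  rw [← hrange, finsum_mem_range hpt, finsum_eq_sum_of_fintype]
  simp only [h2] at h
  exact h

end Affine

section LocalAlgebra

variable {A B R S F : Type*} [CommRing A] [CommRing B] [CommRing R] [CommRing S] [Field F]
  [Algebra A B] [Algebra A R] [Algebra B S] [Algebra R S] [Algebra A S] [Algebra A F] [Algebra B F]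
  [Algebra R F] [IsScalarTower A B F] [IsScalarTower A R F] [IsScalarTower A R S]
  [IsScalarTower A B S] [FaithfulSMul B F] {p : Ideal B} [p.IsPrime] {t : B}

/-- Since `B` embeds in the field `F`, elements outside `p` become units there. This supplies the
embedding of `S` into `F` needed for the comparison. -/
lemma comap_span_of_adjoin_eq_top [IsLocalization.AtPrime R (p.under A)]
    [IsLocalization.AtPrime S p] (ht : Algebra.adjoin A {t} = ⊤) (htp : t ∈ p) :
    (Ideal.span {algebraMap B S t}).comap (algebraMap R S) =
      numeratorIdeal R (algebraMap B F t) := by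
  have hinj := FaithfulSMul.algebraMap_injective B F
  have hu (x : p.primeCompl) : IsUnit (algebraMap B F x) :=
    ((map_ne_zero_iff _ hinj).mpr fun h ↦ x.2 (by rw [h]; exact p.zero_mem)).isUnit
  let _ : Algebra S F := (IsLocalization.lift (S := S) hu).toAlgebra
  have : IsScalarTower B S F := .of_algebraMap_eq fun b ↦ (IsLocalization.lift_eq hu b).symm
  have : FaithfulSMul S F := (faithfulSMul_iff_algebraMap_injective _ _).mpr <|
    (IsLocalization.lift_injective_iff hu).mpr fun x y ↦ by
      refine ⟨fun h ↦ ?_, fun h ↦ by rw [hinj h]⟩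
      rw [IsScalarTower.algebraMap_apply B S F, h, ← IsScalarTower.algebraMap_apply]
  have : IsDomain S := (FaithfulSMul.algebraMap_injective S F).isDomain (algebraMap S F)
  have : IsScalarTower R S F := .of_algebraMap_eq' <|
    IsLocalization.ringHom_ext (p.under A).primeCompl <| by
      rw [← IsScalarTower.algebraMap_eq A R F, RingHom.comp_assoc,
        ← IsScalarTower.algebraMap_eq A R S, IsScalarTower.algebraMap_eq A B S,
        ← RingHom.comp_assoc, ← IsScalarTower.algebraMap_eq B S F,
        ← IsScalarTower.algebraMap_eq A B F]
  exact comap_localization_eq_numeratorIdeal ht htp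

end LocalAlgebra

open Polynomial in
lemma finite_quotient_of_polynomial {K B : Type*} [Field K] [CommRing B] [Algebra K B]
    [Algebra K[X] B] [IsScalarTower K K[X] B] [Module.Finite K[X] B] :
    Module.Finite K (B ⧸ Ideal.span {algebraMap K[X] B X}) := by
  obtain ⟨s, hs⟩ := Module.Finite.fg_top (R := K[X]) (M := B ⧸ Ideal.span {algebraMap K[X] B X})
  -- As `X` acts by zero, generators over `K[X]` also generate over `K`.
  have hX (x : B ⧸ Ideal.span {algebraMap K[X] B X}) : (X : K[X]) • x = 0 := by
    obtain ⟨b, rfl⟩ := Ideal.Quotient.mk_surjective x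
    have h : algebraMap K[X] (B ⧸ Ideal.span {algebraMap K[X] B X}) X = 0 :=
      Ideal.Quotient.eq_zero_iff_mem.mpr (Ideal.mem_span_singleton_self _)
    rw [Algebra.smul_def, h, zero_mul]
  refine ⟨s, eq_top_iff.mpr fun x _ ↦ ?_⟩
  have hx : x ∈ Submodule.span K[X] (s : Set (B ⧸ Ideal.span {algebraMap K[X] B X})) :=
    hs ▸ trivial
  induction hx using Submodule.span_induction with
  | mem x hx => exact Submodule.subset_span hx
  | zero => exact zero_mem _
  | add x y _ _ hx hy => exact add_mem (hx trivial) (hy trivial)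
  | smul p x _ hx =>
    rw [← divX_mul_X_add p, add_smul, mul_smul, hX, smul_zero, zero_add, ← algebraMap_eq,
      algebraMap_smul]
    exact Submodule.smul_mem _ _ (hx trivial)

namespace GraphModel

open Polynomial

variable {K : Type u} [Field K] {Y : Scheme.{u}} [IsIntegral Y] {π : Y ⟶ Spec (.of K)}
  {g : Y.functionField} (M : GraphModel π g)

lemma coord_map {U V : M.D.Opens} (i : U ⟶ V) :
    M.D.presheaf.map i.op (M.coord V) = M.coord U :=
  congr($(M.b.appLE_map (U := ⊤) (le_preimage_top _ V) i.op)
    ((Scheme.ΓSpecIso (.of K[X])).inv X))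

lemma germ_coord (U : M.D.Opens) {y : M.D} (hy : y ∈ U) :
    M.D.presheaf.germ U y hy (M.coord U) = M.D.presheaf.germ ⊤ y trivial (M.coord ⊤) := by
  rw [← M.coord_map (homOfLE le_top : U ⟶ ⊤)]
  exact TopCat.Presheaf.germ_res_apply _ _ _ _ _

lemma sectionsTo_top_injective :
    Function.Injective (sectionsTo M.τ ⊤ (le_preimage_top _ _)) := by
  intro s s' hs
  let ι := {V : Y.affineOpens // Nonempty V.1}
  refine M.D.sheaf.eq_of_locally_eq' (fun V : ι ↦ M.a ⁻¹ᵁ V.1.1) ⊤ (fun V ↦ homOfLE le_top) ?_ _ _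
    fun V ↦ ?_
  · intro x _
    obtain ⟨_, ⟨V, hV, rfl⟩, hxV, -⟩ := Y.isBasis_affineOpens.exists_subset_of_mem_open
      (Set.mem_univ (M.a x)) isOpen_univ
    exact Opens.mem_iSup.mpr ⟨⟨⟨V, hV⟩, ⟨_, hxV⟩⟩, hxV⟩
  · have : Nonempty V.1.1 := V.2
    apply M.sectionsTo_injective V.1.1 V.1.2 (M.top_le V.1.1)
    have h (s) := congr($(map_comp_sectionsTo M.τ (M.top_le V.1.1) (homOfLE le_top)) s)
    exact (h s).trans (hs.trans (h s').symm)

/-- A basic open set of `D` around the generic point lies in a chart over `V`, so a function on `V`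
becomes a global function divided by a power of `f`. -/
lemma exists_eq_div [IsAffine M.D] (z : Y.functionField) :
    ∃ x y, z = sectionsTo M.τ ⊤ (le_preimage_top _ _) x /
        sectionsTo M.τ ⊤ (le_preimage_top _ _) y := by
  obtain ⟨_, ⟨V, hV, rfl⟩, hxV, -⟩ := Y.isBasis_affineOpens.exists_subset_of_mem_open
    (Set.mem_univ (genericPoint Y)) isOpen_univ
  have : Nonempty V := ⟨_, hxV⟩
  have := functionField_isFractionRing_of_isAffineOpen Y V hV
  let δ := M.τ (IsLocalRing.closedPoint _)
  have hδ : δ ∈ M.a ⁻¹ᵁ V := M.top_le V trivial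
  obtain ⟨f, hf, hδf⟩ := (isAffineOpen_top M.D).exists_basicOpen_le ⟨δ, hδ⟩ trivial
  have hle : ⊤ ≤ M.τ ⁻¹ᵁ M.D.basicOpen f :=
    (Scheme.preimage_eq_top_of_closedPoint_mem _ hδf).ge
  have hloc := (isAffineOpen_top M.D).isLocalization_basicOpen f
  have key (v : Γ(Y, V)) : ∃ x y, Y.germToFunctionField V v =
      sectionsTo M.τ ⊤ (le_preimage_top _ _) x / sectionsTo M.τ ⊤ (le_preimage_top _ _) y := by
    let s := M.D.presheaf.map (homOfLE hf).op (M.a.app V v)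
    have hs : sectionsTo M.τ _ hle s = Y.germToFunctionField V v :=
      congr($(map_comp_sectionsTo M.τ hle (homOfLE hf)) (M.a.app V v)).trans
        congr($(M.app_toF V) v)
    obtain ⟨n, x, hx⟩ := IsLocalization.Away.surj f s
    have hres (x : Γ(M.D, ⊤)) : sectionsTo M.τ _ hle (algebraMap _ _ x) =
        sectionsTo M.τ ⊤ (le_preimage_top _ _) x :=
      congr($(map_comp_sectionsTo M.τ hle (homOfLE le_top)) x)
    have hx' := congr_arg (sectionsTo M.τ _ hle) hx
    rw [map_mul, ← map_pow, hs, hres, hres] at hx'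
    have hunit : IsUnit (sectionsTo M.τ ⊤ (le_preimage_top _ _) (f ^ n)) := by
      rw [← hres, map_pow]
      exact ((IsLocalization.Away.algebraMap_isUnit f).pow n).map (sectionsTo M.τ _ hle).hom
    exact ⟨x, f ^ n, eq_div_of_mul_eq hunit.ne_zero hx'⟩
  obtain ⟨v, w, -, rfl⟩ := IsFractionRing.div_surjective Γ(Y, V) z
  obtain ⟨x, y, h1⟩ := key v
  obtain ⟨x', y', h2⟩ := key w
  refine ⟨x * y', y * x', ?_⟩
  rw [map_mul, map_mul, ← div_div_div_eq]
  exact congr_arg₂ (· / ·) h1 h2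

/-- The total degree of the zeros of a transcendental function on the model. -/
theorem finsum_vanishingSet_coord [IsProper π]
    (hdim : ∀ y : Y, Ring.KrullDimLE 1 (Y.presheaf.stalk y))
    (hg : letI := functionFieldAlgebra π; Transcendental K g) :
    (vanishingSet (M.coord ⊤)).Finite ∧
    (letI := functionFieldAlgebra π; Module.finrank (IntermediateField.adjoin K {g})
      Y.functionField) =
      ∑ᶠ y ∈ vanishingSet (M.coord ⊤), (Module.length
          (M.D.presheaf.stalk y ⧸ Ideal.span {M.D.presheaf.germ ⊤ y trivial (M.coord ⊤)})
          (M.D.presheaf.stalk y ⧸ Ideal.span {M.D.presheaf.germ ⊤ y trivial (M.coord ⊤)})).toNat *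
        (M.a ≫ π).residueDegree y := by
  have := M.isFinite_b hdim hg
  have : IsAffine M.D := isAffine_of_isAffineHom M.b
  have hinj := M.sectionsTo_top_injective
  let _ := functionFieldAlgebra π
  let φ : CommRingCat.of K[X] ⟶ Γ(M.D, ⊤) := (Scheme.ΓSpecIso (.of K[X])).inv ≫ M.b.appTop
  let ψ : CommRingCat.of K ⟶ Γ(M.D, ⊤) := (Scheme.ΓSpecIso (.of K)).inv ≫ (M.a ≫ π).appTop
  have hψ : ψ = CommRingCat.ofHom C ≫ φ := by
    dsimp only [ψ, φ]
    rw [M.comm, Scheme.Hom.comp_appTop, ← Category.assoc, ← Category.assoc,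
      ← Scheme.ΓSpecIso_inv_naturality]
  have hφF : φ ≫ sectionsTo M.τ ⊤ (le_preimage_top _ _) = evalFunction π g := by
    have h := M.appLE_sectionsTo ⊤ (le_preimage_top _ _)
    rw [← h, Category.assoc]
    congr 2
    exact M.b.appLE_eq_app.symm
  let _ : Algebra K[X] Γ(M.D, ⊤) := φ.hom.toAlgebra
  let _ : Algebra K Γ(M.D, ⊤) := ψ.hom.toAlgebra
  let _ : Algebra Γ(M.D, ⊤) Y.functionField :=
    (sectionsTo M.τ ⊤ (le_preimage_top _ _)).hom.toAlgebra
  have : IsScalarTower K K[X] Γ(M.D, ⊤) :=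
    .of_algebraMap_eq' (congr_arg CommRingCat.Hom.hom hψ)
  have : IsScalarTower K Γ(M.D, ⊤) Y.functionField := .of_algebraMap_eq fun x ↦ by
    have h : algebraMap Γ(M.D, ⊤) Y.functionField (algebraMap K Γ(M.D, ⊤) x) =
        evalFunction π g (C x) := by
      rw [← hφF, IsScalarTower.algebraMap_apply K K[X] Γ(M.D, ⊤)]
      rfl
    rw [h]
    exact (eval₂_C _ _).symm
  have : FaithfulSMul Γ(M.D, ⊤) Y.functionField :=
    (faithfulSMul_iff_algebraMap_injective _ _).mpr hinj
  have : IsDomain Γ(M.D, ⊤) :=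
    hinj.isDomain (sectionsTo M.τ ⊤ (le_preimage_top _ _)).hom
  have : IsFractionRing Γ(M.D, ⊤) Y.functionField := .of_field _ _ M.exists_eq_div
  have : Module.Finite K[X] Γ(M.D, ⊤) := by
    have h : φ.hom.Finite := RingHom.Finite.comp M.b.finite_appTop (.of_surjective _
      (Scheme.ΓSpecIso (.of K[X])).symm.commRingCatIsoToRingEquiv.surjective)
    exact h
  have : FaithfulSMul K[X] Γ(M.D, ⊤) :=
    (faithfulSMul_iff_algebraMap_injective _ _).mpr <|
      .of_comp (f := sectionsTo M.τ ⊤ (le_preimage_top _ _)) <| by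
        have h := evalFunction_injective hg
        rw [← hφF] at h
        exact h
  have ht : algebraMap K[X] Γ(M.D, ⊤) X = M.coord ⊤ :=
    congr($(M.b.appLE_eq_app (U := ⊤)) ((Scheme.ΓSpecIso (.of K[X])).inv X)).symm
  have hX : algebraMap Γ(M.D, ⊤) Y.functionField (algebraMap K[X] Γ(M.D, ⊤) X) = g := by
    rw [ht]
    exact M.sectionsTo_coord ⊤ (le_preimage_top _ _)
  -- `D` is affine and finite over `𝔸¹`, so the whole zero scheme of the coordinate has degree `[F :
  -- K(g)]`. It remains to distribute this over its points.
  have hrank := finrank_quotient_eq_finrank_adjoin (K := K) (B := Γ(M.D, ⊤)) hX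
  have hfin : Module.Finite K (Γ(M.D, ⊤) ⧸ Ideal.span {M.coord ⊤}) :=
    ht ▸ finite_quotient_of_polynomial
  have : IsArtinianRing (Γ(M.D, ⊤) ⧸ Ideal.span {M.coord ⊤}) := .of_finite K _
  have h := finsum_length_mul_residueDegree (A := .of K) (M.a ≫ π) (M.coord ⊤)
    Module.length_ne_top fun y _ ↦ Subsingleton.elim (α := PrimeSpectrum K) _ _
  refine ⟨h.1, ?_⟩
  rw [← h.2, ← hrank, ht]
  change _ = (Module.length K (Γ(M.D, ⊤) ⧸ Ideal.span {M.coord ⊤})).toNat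
  rw [Module.length_eq_finrank, ENat.toNat_natCast]

end GraphModel

lemma isLocalRing_quotient_of_mem {S : Type*} [CommRing S] [IsLocalRing S] {t : S}
    (ht : t ∈ IsLocalRing.maximalIdeal S) : IsLocalRing (S ⧸ Ideal.span {t}) := by
  have : Nontrivial (S ⧸ Ideal.span {t}) := Ideal.Quotient.nontrivial_iff.mpr fun h ↦
    (IsLocalRing.maximalIdeal.isMaximal S).ne_top
      (top_le_iff.mp (h ▸ (Ideal.span_singleton_le_iff_mem _).mpr ht))
  exact .of_surjective' _ Ideal.Quotient.mk_surjective

lemma localDegree_eq_one_of_surjective_quotient {R S : Type*} [CommRing R] [CommRing S]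
    [IsLocalRing R] [IsLocalRing S] (φ : R →+* S) [IsLocalHom φ] {t : S}
    (ht : t ∈ IsLocalRing.maximalIdeal S)
    (h : Function.Surjective ((Ideal.Quotient.mk (Ideal.span {t})).comp φ)) :
    localDegree φ = 1 := by
  have := isLocalRing_quotient_of_mem ht
  have : IsLocalHom (Ideal.Quotient.mk (Ideal.span {t})) :=
    Function.Surjective.isLocalHom _ Ideal.Quotient.mk_surjective
  have h1 := localDegree_comp (Ideal.Quotient.mk (Ideal.span {t})) φ
  rwa [localDegree_eq_one_of_surjective _ h,
    localDegree_eq_one_of_surjective _ Ideal.Quotient.mk_surjective, mul_one, eq_comm] at h1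

lemma algebraMap_mem_numeratorIdeal {A R F : Type*} [CommRing A] [CommRing R] [Field F]
    [Algebra A R] [Algebra A F] [Algebra R F] [IsScalarTower A R F] {g : F} {a : A}
    (ha : a ∈ numeratorIdeal A g) : algebraMap A R a ∈ numeratorIdeal R g := by
  obtain ⟨y, hy, h⟩ := mem_numeratorIdeal.mp ha
  rw [mem_numeratorIdeal]
  refine ⟨y, ?_, by rw [h, IsScalarTower.algebraMap_apply A R F]⟩
  clear h ha
  induction hy using Algebra.adjoin_induction with
  | mem x hx => exact Algebra.subset_adjoin hx
  | algebraMap a =>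
    rw [IsScalarTower.algebraMap_apply A R F]
    exact Subalgebra.algebraMap_mem _ _
  | add x y _ _ hx hy => exact add_mem hx hy
  | mul x y _ _ hx hy => exact mul_mem hx hy

lemma numeratorIdeal_le_of_ne_top {A R F : Type*} [CommRing A] [CommRing R] [Field F] [Algebra A R]
    [Algebra A F] [Algebra R F] [IsScalarTower A R F] {g : F} (p : Ideal A) [p.IsPrime]
    [IsLocalization.AtPrime R p] (h : numeratorIdeal R g ≠ ⊤) : numeratorIdeal A g ≤ p := by
  intro x hx
  by_contra hxp
  have hx' : algebraMap A R x ∈ numeratorIdeal R g := algebraMap_mem_numeratorIdeal hx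
  exact h (Ideal.eq_top_of_isUnit_mem _ hx'
    (IsLocalization.map_units (M := p.primeCompl) R ⟨x, hxp⟩))

namespace GraphModel

open Polynomial

variable {K : Type u} [Field K] {Y : Scheme.{u}} [IsIntegral Y] {π : Y ⟶ Spec (.of K)}
  {g : Y.functionField} (M : GraphModel π g)

lemma comap_primeIdealOf {V : Y.Opens} (hV : IsAffineOpen V) (hU : IsAffineOpen (M.a ⁻¹ᵁ V))
    {y : M.D} (hy : M.a y ∈ V) :
    (hU.primeIdealOf ⟨y, hy⟩).asIdeal.comap (M.a.app V).hom =
      (hV.primeIdealOf ⟨M.a y, hy⟩).asIdeal := by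
  have h := IsAffineOpen.comap_primeIdealOf_appLE (f := M.a) V hV (M.a ⁻¹ᵁ V) hU le_rfl hy
  rw [← h, Scheme.Hom.appLE_eq_app]
  rfl

lemma coord_mem_primeIdealOf {V : Y.Opens} (hU : IsAffineOpen (M.a ⁻¹ᵁ V)) {y : M.D}
    (hy : M.a y ∈ V) (h : y ∈ vanishingSet (M.coord ⊤)) :
    M.coord (M.a ⁻¹ᵁ V) ∈ (hU.primeIdealOf ⟨y, hy⟩).asIdeal := by
  let y' : ↥(M.a ⁻¹ᵁ V) := ⟨y, hy⟩
  let _ := M.D.presheaf.algebra_section_stalk y'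
  have := hU.isLocalization_stalk y'
  rw [← IsLocalization.AtPrime.to_map_mem_maximal_iff (M.D.presheaf.stalk y'.1)
    (hU.primeIdealOf y').asIdeal]
  have h' : M.D.presheaf.germ ⊤ y trivial (M.coord ⊤) ∈ IsLocalRing.maximalIdeal _ := h
  rw [← M.germ_coord (M.a ⁻¹ᵁ V) hy] at h'
  exact h'

/-- Both facts localize the chart `Γ(Y, V)[g]`, where every function is constant modulo the
coordinate. Together they identify the local ring of the zero scheme at `y` with `A / (A ∩ gA[g])`,
where `A` is the stalk of `Y` at `a y`. -/
lemma comap_stalkMap_span {y : M.D} (h : y ∈ vanishingSet (M.coord ⊤)) :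
    (Ideal.span {M.D.presheaf.germ ⊤ y trivial (M.coord ⊤)}).comap (M.a.stalkMap y).hom =
        numeratorIdeal (Y.presheaf.stalk (M.a y)) g ∧
      Function.Surjective ((Ideal.Quotient.mk
        (Ideal.span {M.D.presheaf.germ ⊤ y trivial (M.coord ⊤)})).comp (M.a.stalkMap y).hom) := by
  have := M.isAffineHom_a
  obtain ⟨_, ⟨V, hV, rfl⟩, hyV, -⟩ := Y.isBasis_affineOpens.exists_subset_of_mem_open
    (Set.mem_univ (M.a y)) isOpen_univ
  have : Nonempty V := ⟨_, hyV⟩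
  have hU : IsAffineOpen (M.a ⁻¹ᵁ V) := hV.preimage M.a
  let y' : ↥(M.a ⁻¹ᵁ V) := ⟨y, hyV⟩
  let c' : V := ⟨M.a y, hyV⟩
  rw [← M.germ_coord (M.a ⁻¹ᵁ V) hyV]
  let _ := M.algebraLeft V
  let _ := M.algebraRight V
  have := M.isScalarTower V
  have := M.faithfulSMul V hV
  let _ : Algebra Γ(Y, V) (Y.presheaf.stalk (M.a y)) := Y.presheaf.algebra_section_stalk c'
  let _ : Algebra Γ(M.D, M.a ⁻¹ᵁ V) (M.D.presheaf.stalk y) := M.D.presheaf.algebra_section_stalk y'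
  let _ : Algebra (Y.presheaf.stalk (M.a y)) (M.D.presheaf.stalk y) :=
    (M.a.stalkMap y).hom.toAlgebra
  let _ : Algebra Γ(Y, V) (M.D.presheaf.stalk y) :=
    ((M.D.presheaf.germ (M.a ⁻¹ᵁ V) y hyV).hom.comp (M.a.app V).hom).toAlgebra
  have : IsScalarTower Γ(Y, V) (Y.presheaf.stalk (M.a y)) Y.functionField :=
    functionField_isScalarTower Y V c'
  have : IsScalarTower Γ(Y, V) (Y.presheaf.stalk (M.a y)) (M.D.presheaf.stalk y) :=
    .of_algebraMap_eq' (congr_arg CommRingCat.Hom.hom (M.a.germ_stalkMap V y hyV)).symm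
  have : IsScalarTower Γ(Y, V) Γ(M.D, M.a ⁻¹ᵁ V) (M.D.presheaf.stalk y) :=
    .of_algebraMap_eq' rfl
  have : IsLocalization.AtPrime (M.D.presheaf.stalk y) (hU.primeIdealOf y').asIdeal :=
    hU.isLocalization_stalk y'
  have : IsLocalization.AtPrime (Y.presheaf.stalk (M.a y))
      ((hU.primeIdealOf y').asIdeal.under Γ(Y, V)) := by
    have key : ∀ (Q : Ideal Γ(Y, V)) [Q.IsPrime], Q = (hV.primeIdealOf c').asIdeal →
        IsLocalization.AtPrime (Y.presheaf.stalk (M.a y)) Q := by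
      rintro _ _ rfl
      exact hV.isLocalization_stalk c'
    exact key _ (M.comap_primeIdealOf hV hU hyV)
  have hmem := M.coord_mem_primeIdealOf hU hyV h
  have hF : algebraMap Γ(M.D, M.a ⁻¹ᵁ V) Y.functionField (M.coord (M.a ⁻¹ᵁ V)) = g :=
    M.sectionsTo_coord _ _
  refine ⟨?_, surjective_localization_quotient (p := (hU.primeIdealOf y').asIdeal)
    (M.adjoin_coord V hV) hmem⟩
  exact (comap_span_of_adjoin_eq_top (R := Y.presheaf.stalk (M.a y)) (F := Y.functionField)
    (M.adjoin_coord V hV) hmem).trans (congr_arg _ hF)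

lemma injOn_vanishingSet_coord : Set.InjOn M.a (vanishingSet (M.coord ⊤)) := by
  have := M.isAffineHom_a
  intro y hy y' hy' hyy'
  obtain ⟨_, ⟨V, hV, rfl⟩, hyV, -⟩ := Y.isBasis_affineOpens.exists_subset_of_mem_open
    (Set.mem_univ (M.a y)) isOpen_univ
  have hU : IsAffineOpen (M.a ⁻¹ᵁ V) := hV.preimage M.a
  have hyV' : M.a y' ∈ V := hyy' ▸ hyV
  let _ := M.algebraLeft V
  have h := eq_of_comap_eq_of_adjoin_eq_top (M.adjoin_coord V hV)
    (M.coord_mem_primeIdealOf hU hyV hy) (M.coord_mem_primeIdealOf hU hyV' hy') (by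
      refine (M.comap_primeIdealOf hV hU hyV).trans
        (Eq.trans ?_ (M.comap_primeIdealOf hV hU hyV').symm)
      congr 2
      exact Subtype.ext hyy')
  have h' := congr_arg hU.fromSpec (PrimeSpectrum.ext h)
  rwa [hU.fromSpec_primeIdealOf, hU.fromSpec_primeIdealOf] at h'

/-- On a chart, `Γ(Y, V) → Γ(Y, V)[g] / (g)` is onto with kernel the numerator ideal. The prime of
`c` contains that kernel, so it lifts to a zero of the coordinate. -/
lemma exists_mem_vanishingSet {c : Y} (hc : numeratorIdeal (Y.presheaf.stalk c) g ≠ ⊤) :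
    ∃ y ∈ vanishingSet (M.coord ⊤), M.a y = c := by
  have := M.isAffineHom_a
  obtain ⟨_, ⟨V, hV, rfl⟩, hcV, -⟩ := Y.isBasis_affineOpens.exists_subset_of_mem_open
    (Set.mem_univ c) isOpen_univ
  have : Nonempty V := ⟨_, hcV⟩
  have hU : IsAffineOpen (M.a ⁻¹ᵁ V) := hV.preimage M.a
  let c' : V := ⟨c, hcV⟩
  let _ := M.algebraLeft V
  let _ := M.algebraRight V
  have := M.isScalarTower V
  have := M.faithfulSMul V hV
  let _ : Algebra Γ(Y, V) (Y.presheaf.stalk c) := Y.presheaf.algebra_section_stalk c'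
  have : IsScalarTower Γ(Y, V) (Y.presheaf.stalk c) Y.functionField :=
    functionField_isScalarTower Y V c'
  have : IsLocalization.AtPrime (Y.presheaf.stalk c) (hV.primeIdealOf c').asIdeal :=
    hV.isLocalization_stalk c'
  have hF : algebraMap Γ(M.D, M.a ⁻¹ᵁ V) Y.functionField (M.coord (M.a ⁻¹ᵁ V)) = g :=
    M.sectionsTo_coord _ _
  have hnum := comap_span_eq_numeratorIdeal (F := Y.functionField) (M.adjoin_coord V hV)
  rw [hF] at hnum
  have hle : numeratorIdeal Γ(Y, V) g ≤ (hV.primeIdealOf c').asIdeal :=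
    numeratorIdeal_le_of_ne_top (R := Y.presheaf.stalk c) _ hc
  let q := Ideal.Quotient.mk (Ideal.span {M.coord (M.a ⁻¹ᵁ V)})
  have hsurj : Function.Surjective (q.comp (M.a.app V).hom) :=
    surjective_quotient_of_adjoin_eq_top (M.adjoin_coord V hV)
  have hker : RingHom.ker (q.comp (M.a.app V).hom) = numeratorIdeal Γ(Y, V) g := by
    rw [← RingHom.comap_ker, Ideal.mk_ker]
    exact hnum
  obtain ⟨Q, hQ⟩ : hV.primeIdealOf c' ∈
        Set.range (PrimeSpectrum.comap (q.comp (M.a.app V).hom)) := by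
    rw [range_comap_of_surjective _ _ hsurj, hker]
    exact hle
  let P : PrimeSpectrum Γ(M.D, M.a ⁻¹ᵁ V) := PrimeSpectrum.comap q Q
  have hmem : hU.fromSpec P ∈ M.a ⁻¹ᵁ V := by
    have : hU.fromSpec P ∈ Set.range hU.fromSpec := ⟨P, rfl⟩
    rwa [hU.range_fromSpec] at this
  have hP : hU.primeIdealOf ⟨hU.fromSpec P, hmem⟩ = P := by
    have := hU.isOpenImmersion_fromSpec
    exact hU.fromSpec.isOpenEmbedding.injective (hU.fromSpec_primeIdealOf _)
  refine ⟨hU.fromSpec P, ?_, ?_⟩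
  · let _ := M.D.presheaf.algebra_section_stalk (⟨hU.fromSpec P, hmem⟩ : ↥(M.a ⁻¹ᵁ V))
    have : IsLocalization.AtPrime (M.D.presheaf.stalk (hU.fromSpec P)) P.asIdeal :=
      hU.isLocalization_stalk' P hmem
    change M.D.presheaf.germ ⊤ _ trivial (M.coord ⊤) ∈ IsLocalRing.maximalIdeal _
    rw [← M.germ_coord (M.a ⁻¹ᵁ V) hmem]
    refine (IsLocalization.AtPrime.to_map_mem_maximal_iff (M.D.presheaf.stalk (hU.fromSpec P))
      P.asIdeal _).mpr ?_
    change q _ ∈ Q.asIdeal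
    rw [Ideal.Quotient.eq_zero_iff_mem.mpr (Ideal.mem_span_singleton_self _)]
    exact zero_mem _
  · have h1 := M.comap_primeIdealOf hV hU hmem
    rw [hP] at h1
    have h2 : hV.primeIdealOf ⟨M.a (hU.fromSpec P), hmem⟩ = hV.primeIdealOf c' := by
      rw [← hQ]
      exact PrimeSpectrum.ext h1.symm
    have h3 := congr_arg hV.fromSpec h2
    rwa [hV.fromSpec_primeIdealOf, hV.fromSpec_primeIdealOf] at h3

end GraphModel

/-- The total degree of the zeros of a transcendental function on a proper curve. -/
theorem finsum_length_quotient_numeratorIdeal {K : Type u} [Field K] {Y : Scheme.{u}}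
    [IsIntegral Y] (π : Y ⟶ Spec (.of K)) [IsProper π] (g : Y.functionField)
    (hdim : ∀ y : Y, Ring.KrullDimLE 1 (Y.presheaf.stalk y))
    (hg : letI := functionFieldAlgebra π; Transcendental K g) :
    {c : Y | numeratorIdeal (Y.presheaf.stalk c) g ≠ ⊤}.Finite ∧
    ∑ᶠ c : Y, (Module.length (Y.presheaf.stalk c)
      (Y.presheaf.stalk c ⧸ numeratorIdeal (Y.presheaf.stalk c) g)).toNat * π.residueDegree c =
    letI := functionFieldAlgebra π
    Module.finrank (IntermediateField.adjoin K {g}) Y.functionField := by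
  obtain ⟨M⟩ := nonempty_graphModel (π := π) g
  obtain ⟨hfin, hsum⟩ := M.finsum_vanishingSet_coord hdim hg
  have hsub : {c : Y | numeratorIdeal (Y.presheaf.stalk c) g ≠ ⊤} ⊆
      M.a '' vanishingSet (M.coord ⊤) := fun c hc ↦ M.exists_mem_vanishingSet hc
  refine ⟨(hfin.image _).subset hsub, ?_⟩
  rw [hsum, ← finsum_mem_univ, finsum_mem_inter_support_eq' _ _ (M.a '' vanishingSet (M.coord ⊤)),
    finsum_mem_image M.injOn_vanishingSet_coord]
  · refine finsum_mem_congr rfl fun y hy ↦ ?_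
    obtain ⟨h1, h2⟩ := M.comap_stalkMap_span hy
    rw [residueDegree_comp, residueDegree_eq_localDegree M.a,
      localDegree_eq_one_of_surjective_quotient _ hy h2, one_mul,
      ← length_quotient_ker_of_surjective h2, ← RingHom.comap_ker, Ideal.mk_ker, h1]
  -- Off the image of the zero set the numerator ideal is the unit ideal and the summand vanishes.
  · intro c hc
    refine iff_of_true trivial (hsub fun h ↦ hc ?_)
    have : Subsingleton (Y.presheaf.stalk c ⧸ numeratorIdeal (Y.presheaf.stalk c) g) :=
      Ideal.Quotient.subsingleton_iff.mpr h
    beta_reduce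
    rw [Module.length_eq_zero, ENat.toNat_zero, zero_mul]

/-! ### The degree of a principal divisor on a proper curve -/

section Curve

variable {K : Type u} [Field K] {Y : Scheme.{u}} [IsIntegral Y] (π : Y ⟶ Spec (.of K))

lemma functionFieldHom_mem_range (c : Y) (x : K) : functionFieldHom π x ∈
    Set.range (algebraMap (Y.presheaf.stalk c) Y.functionField) := by
  let φ : CommRingCat.of K ⟶ Y.presheaf.stalk c := Spec.preimage (Y.fromSpecStalk c ≫ π)
  have h : functionFieldHom π =
      φ ≫ Y.presheaf.stalkSpecializes (genericPoint_specializes c) := by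
    apply Spec.map_injective
    rw [SpecMap_functionFieldHom, Spec.map_comp, Spec.map_preimage,
      Scheme.SpecMap_stalkSpecializes_fromSpecStalk_assoc]
  exact ⟨φ x, congr($h x).symm⟩

/-- For `g` algebraic over `K` the inverse lies in `K[g]`, so `1 = g · g⁻¹` lies in `gA[g]`: such a
function has neither zeros nor poles. -/
lemma numeratorIdeal_eq_top_of_isAlgebraic {g : Y.functionField} (hg0 : g ≠ 0)
    (hg : letI := functionFieldAlgebra π; IsAlgebraic K g) (c : Y) :
    numeratorIdeal (Y.presheaf.stalk c) g = ⊤ := by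
  let _ := functionFieldAlgebra π
  rw [Ideal.eq_top_iff_one, mem_numeratorIdeal]
  refine ⟨g⁻¹, ?_, by rw [mul_inv_cancel₀ hg0, map_one]⟩
  have hmem : g⁻¹ ∈ Algebra.adjoin K {g} := hg.isIntegral.inv_mem_adjoin
  generalize g⁻¹ = h at hmem
  induction hmem using Algebra.adjoin_induction with
  | mem x hx => exact Algebra.subset_adjoin hx
  | algebraMap a =>
    obtain ⟨b, hb⟩ := functionFieldHom_mem_range π c a
    have h : algebraMap K Y.functionField a = algebraMap (Y.presheaf.stalk c) _ b := hb.symm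
    rw [h]
    exact Subalgebra.algebraMap_mem _ _
  | add x y _ _ hx hy => exact add_mem hx hy
  | mul x y _ _ hx hy => exact mul_mem hx hy

/-- The degree of a principal divisor on a proper curve is zero. -/
theorem finsum_ordInt_mul_residueDegree [IsProper π] [IsLocallyNoetherian Y]
    [hdim : ∀ y : Y, Ring.KrullDimLE 1 (Y.presheaf.stalk y)] {g : Y.functionField} (hg0 : g ≠ 0) :
    ∑ᶠ c : Y, ordInt (Y.presheaf.stalk c) g * (π.residueDegree c : ℤ) = 0 := by
  let _ := functionFieldAlgebra π
  by_cases hg : IsAlgebraic K g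
  · refine (finsum_congr fun c ↦ ?_).trans finsum_zero
    have h (h : Y.functionField) (hh : numeratorIdeal (Y.presheaf.stalk c) h = ⊤) :
        Module.length (Y.presheaf.stalk c)
          (Y.presheaf.stalk c ⧸ numeratorIdeal (Y.presheaf.stalk c) h) = 0 :=
      have := Ideal.Quotient.subsingleton_iff.mpr hh
      Module.length_eq_zero
    rw [ordInt_eq_length_sub_length hg0, h g (numeratorIdeal_eq_top_of_isAlgebraic π hg0 hg c),
      h g⁻¹ (numeratorIdeal_eq_top_of_isAlgebraic π (inv_ne_zero hg0) hg.inv c), sub_self, zero_mul]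
  · obtain ⟨h1, h2⟩ := finsum_length_quotient_numeratorIdeal π g hdim hg
    obtain ⟨h3, h4⟩ := finsum_length_quotient_numeratorIdeal π g⁻¹ hdim
      fun h ↦ hg (inv_inv g ▸ h.inv)
    -- Zeros of `g` and zeros of `g⁻¹` both have total degree `[F : K(g)]`.
    have hadj : IntermediateField.adjoin K {g⁻¹} = IntermediateField.adjoin K {g} :=
      le_antisymm (IntermediateField.adjoin_simple_le_iff.mpr
          (inv_mem (IntermediateField.mem_adjoin_simple_self K g)))
        (IntermediateField.adjoin_simple_le_iff.mpr
          (inv_mem_iff.mp (IntermediateField.mem_adjoin_simple_self K g⁻¹)))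
    have hsupp {h : Y.functionField}
        (hh : {c : Y | numeratorIdeal (Y.presheaf.stalk c) h ≠ ⊤}.Finite) :
        (Function.support fun c : Y ↦ (Module.length (Y.presheaf.stalk c)
          (Y.presheaf.stalk c ⧸ numeratorIdeal (Y.presheaf.stalk c) h)).toNat *
            π.residueDegree c).Finite := by
      refine hh.subset fun c hc hc' ↦ hc ?_
      have := Ideal.Quotient.subsingleton_iff.mpr hc'
      beta_reduce
      rw [Module.length_eq_zero, ENat.toNat_zero, zero_mul]
    have hcast (h : Y → ℕ) (hh : (Function.support h).Finite) :
        ∑ᶠ c, (h c : ℤ) = ((∑ᶠ c, h c : ℕ) : ℤ) :=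
      (AddMonoidHom.map_finsum (Nat.castAddMonoidHom ℤ) hh).symm
    have hcs {h : Y → ℕ} (hh : (Function.support h).Finite) :
        (Function.support fun c ↦ (h c : ℤ)).Finite :=
      hh.subset fun c hc hc' ↦ hc (by beta_reduce; rw [hc']; rfl)
    rw [hadj] at h4
    have := finsum_sub_distrib (hcs (hsupp h1)) (hcs (hsupp h3))
    rw [hcast _ (hsupp h1), hcast _ (hsupp h3), h2, h4, sub_self] at this
    rw [← this]
    refine finsum_congr fun c ↦ ?_
    rw [ordInt_eq_length_sub_length hg0, sub_mul, Nat.cast_mul, Nat.cast_mul]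

end Curve

/-! ### Dimensions of points -/

section Height

variable {X Y : Scheme.{u}}

/-- Specializations lift along a closed map, so a chain below `f x` lifts to a chain below `x`. -/
lemma height_apply_le_of_isClosedMap {f : X ⟶ Y} (hf : IsClosedMap f) (x : X) :
    Order.height (f x) ≤ Order.height x := by
  have key : ∀ n : ℕ, ∀ x : X, Order.height x ≤ n → Order.height (f x) ≤ n := by
    intro n
    induction n with
    | zero =>
      intro x hx
      refine Order.height_le_coe_iff.mpr fun y hy ↦ ?_
      obtain ⟨x', hx', rfl⟩ := hf.specializingMap hy.le
      have hlt : x' < x := lt_of_le_not_ge hx' fun h ↦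
        hy.not_ge (Specializes.map (show x' ⤳ x from h) f.continuous)
      exact absurd (Order.height_le_coe_iff.mp hx x' hlt) (by simp)
    | succ n ih =>
      intro x hx
      refine Order.height_le_coe_iff.mpr fun y hy ↦ ?_
      obtain ⟨x', hx', rfl⟩ := hf.specializingMap hy.le
      have hlt : x' < x := lt_of_le_not_ge hx' fun h ↦
        hy.not_ge (Specializes.map (show x' ⤳ x from h) f.continuous)
      have h1 := Order.height_le_coe_iff.mp hx x' hlt
      rw [Nat.cast_add, Nat.cast_one] at h1 ⊢
      have h2 := ih x' (Order.lt_add_one_iff_of_not_isMax (by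
        rw [isMax_iff_eq_top]; exact ENat.natCast_ne_top n) |>.mp h1)
      exact lt_of_le_of_lt h2 (by exact_mod_cast Nat.lt_succ_self n)
  induction h : Order.height x using ENat.recTopCoe with
  | top => exact le_top
  | coe n => exact key n x h.le

lemma height_le_apply_of_isEmbedding {f : X ⟶ Y} (hf : IsEmbedding f) (x : X) :
    Order.height x ≤ Order.height (f x) :=
  Order.height_le_height_apply_of_strictMono f (fun a b hab ↦
    lt_of_le_not_ge (Specializes.map (show b ⤳ a from hab.le) f.continuous) fun h ↦
      hab.not_ge (hf.isInducing.specializes_iff.mp h)) x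

lemma height_apply_of_isClosedImmersion (f : X ⟶ Y) [IsClosedImmersion f] (x : X) :
    Order.height (f x) = Order.height x :=
  (height_apply_le_of_isClosedMap f.isClosedEmbedding.isClosedMap x).antisymm
    (height_le_apply_of_isEmbedding f.isClosedEmbedding.isEmbedding x)

/-- Two strict steps above a point of height at least `n` would give a point of height at least `n +
2`, exceeding that of the generic point. -/
lemma coheight_le_one_of_height_le [IrreducibleSpace X] {n : ℕ}
    (hX : Order.height (genericPoint X) = n + 1) {x : X} (hx : n ≤ Order.height x) :
    Order.coheight x ≤ 1 := by
  refine Order.coheight_le_coe_iff.mpr fun y hy ↦ ?_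
  rw [Nat.cast_one, Order.lt_one_iff, Order.coheight_eq_zero]
  intro z hz
  by_contra h
  have h1 := Order.height_add_one_le hy
  have h2 := Order.height_add_one_le (lt_of_le_not_ge hz h)
  have h3 : Order.height z ≤ n + 1 := hX ▸ Order.height_mono (genericPoint_specializes z)
  have h4 : (n : ℕ∞) + 1 + 1 ≤ n + 1 :=
    ((add_le_add_left ((add_le_add_left hx 1).trans h1) 1).trans h2).trans h3
  exact absurd h4 (by exact_mod_cast (Nat.lt_succ_self (n + 1)).not_ge)

lemma exists_mem_genericPoints_specializes (x : X) : ∃ η ∈ genericPoints X, η ⤳ x := by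
  obtain ⟨Z, hZ, hxZ⟩ := exists_mem_irreducibleComponents_subset_of_isIrreducible
    (closure {x}) isIrreducible_singleton.closure
  obtain ⟨y, hy⟩ := QuasiSober.sober hZ.1 (isClosed_of_mem_irreducibleComponents Z hZ)
  refine ⟨y, ?_, hy.specializes (hxZ (subset_closure rfl))⟩
  change closure {y} ∈ irreducibleComponents X
  rwa [hy.def]

lemma mem_genericPoints_iff {η : X} : η ∈ genericPoints X ↔ ∀ y : X, y ⤳ η → y = η := by
  constructor
  · intro hη y hy
    exact Specializes.antisymm hy (specializes_iff_mem_closure.mpr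
      (hη.2 isIrreducible_singleton.closure hy.closure_subset (subset_closure rfl))) |>.eq
  · intro h
    obtain ⟨y, hy, hyη⟩ := exists_mem_genericPoints_specializes η
    exact h y hyη ▸ hy

/-- Points of the spectrum of the stalk are generalizations of `η`, so there is only one prime and
it consists of nilpotents. -/
lemma isNilpotent_of_mem_maximalIdeal {η : X} (hη : η ∈ genericPoints X)
    {a : X.presheaf.stalk η} (ha : a ∈ IsLocalRing.maximalIdeal (X.presheaf.stalk η)) :
    IsNilpotent a := by
  rw [← mem_nilradical, nilradical_eq_sInf, Ideal.mem_sInf]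
  intro p hp
  let P : PrimeSpectrum (X.presheaf.stalk η) := ⟨p, hp⟩
  have hP : X.fromSpecStalk η P ⤳ η := by
    have : X.fromSpecStalk η P ∈ Set.range (X.fromSpecStalk η) := ⟨P, rfl⟩
    rwa [Scheme.range_fromSpecStalk] at this
  have h : P = IsLocalRing.closedPoint _ := (X.fromSpecStalk η).isEmbedding.injective
    ((mem_genericPoints_iff.mp hη _ hP).trans Scheme.fromSpecStalk_closedPoint.symm)
  have h' : p = IsLocalRing.maximalIdeal _ := congr_arg PrimeSpectrum.asIdeal h
  exact h' ▸ ha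

end Height

/-! ### Localizing a scheme over a generic point of the base -/

section Localize

/-- Nilpotents of `R` vanish in the domain `Γ(C, ⊤)`, so the map factors through the residue field.
Thus a non-reduced `X` still leads to a curve over a field. -/
lemma exists_comp_isClosedImmersion {C : Scheme.{u}} [IsIntegral C] {R : CommRingCat.{u}}
    [IsLocalRing R] (σ : C ⟶ Spec R) (hR : ∀ a ∈ IsLocalRing.maximalIdeal R, IsNilpotent a) :
    ∃ (K : Type u) (_ : Field K) (π : C ⟶ Spec (.of K)) (ι : Spec (.of K) ⟶ Spec R),
      IsClosedImmersion ι ∧ π ≫ ι = σ := by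
  let φ : R ⟶ Γ(C, ⊤) := (Scheme.ΓSpecIso R).inv ≫ σ.appTop
  have hφ : ∀ a ∈ IsLocalRing.maximalIdeal R, φ.hom a = 0 :=
    fun a ha ↦ ((hR a ha).map φ.hom).eq_zero
  let ψ : IsLocalRing.ResidueField R →+* Γ(C, ⊤) := Ideal.Quotient.lift _ φ.hom hφ
  let ρ : R ⟶ CommRingCat.of (IsLocalRing.ResidueField R) :=
    CommRingCat.ofHom (IsLocalRing.residue R)
  have h : ρ ≫ CommRingCat.ofHom ψ = φ := by
    ext a
    exact Ideal.Quotient.lift_mk (IsLocalRing.maximalIdeal R) φ.hom hφ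
  refine ⟨_, inferInstance, C.toSpecΓ ≫ Spec.map (CommRingCat.ofHom ψ), Spec.map ρ,
    IsClosedImmersion.spec_of_surjective _ IsLocalRing.residue_surjective, ?_⟩
  rw [Category.assoc, ← Spec.map_comp, h, Spec.map_comp, ← Scheme.toSpecΓ_naturality_assoc,
    toSpecΓ_SpecMap_ΓSpecIso_inv, Category.comp_id]

lemma ordInt_of_isField {A F : Type*} [CommRing A] [IsDomain A] [IsNoetherianRing A]
    [Ring.KrullDimLE 1 A] [Field F] [Algebra A F] [IsFractionRing A F] (hA : IsField A) {g : F}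
    (hg : g ≠ 0) : ordInt A g = 0 := by
  obtain ⟨a, b, hb, rfl⟩ := IsFractionRing.div_surjective A g
  have ha0 : a ≠ 0 := by rintro rfl; simp at hg
  have hb0 : b ≠ 0 := nonZeroDivisors.ne_zero hb
  have h {c : A} (hc : c ≠ 0) : Ring.ord A c = 0 := by
    obtain ⟨d, hd⟩ := hA.mul_inv_cancel hc
    exact Ring.ord_of_isUnit (.of_mul_eq_one d hd)
  rw [ordInt_div ha0 hb0, h ha0, h hb0, sub_self]

variable {W X : Scheme.{u}} [IsIntegral W] [IsLocallyNoetherian W] (p : W ⟶ X) [IsProper p] {η : X}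

/-- The divisor of a rational function has degree zero on one-dimensional generic fibres. -/
theorem finsum_ord_mul_residueDegree (hη : η ∈ genericPoints X)
    (hco : ∀ w, p w = η → Order.coheight w ≤ 1) {g : W.functionField} (hg : g ≠ 0) :
    ∑ᶠ w ∈ p ⁻¹' {η}, Scheme.ord g w * (p.residueDegree w : ℤ) = 0 := by
  by_cases hne : ∃ w, p w = η
  swap
  · rw [Set.eq_empty_of_forall_notMem (s := p ⁻¹' {η}) fun w hw ↦ hne ⟨w, hw⟩, finsum_mem_empty]
  obtain ⟨w₀, hw₀⟩ := hne
  have hgen : p (genericPoint W) = η := mem_genericPoints_iff.mp hη _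
    (hw₀ ▸ (genericPoint_specializes w₀).map p.continuous)
  -- As `η` has no proper generalization, `C` has the fibre over `η` as underlying set. The map to
  -- `W` is a flat preimmersion, so it preserves stalks, orders and residue fields.
  let C := pullback p (X.fromSpecStalk η)
  let j : C ⟶ W := pullback.fst p (X.fromSpecStalk η)
  let σ : C ⟶ Spec (X.presheaf.stalk η) := pullback.snd p (X.fromSpecStalk η)
  have := flat_fromSpecStalk X η
  have : Flat j := inferInstanceAs (Flat (pullback.fst p (X.fromSpecStalk η)))
  have : IsPreimmersion j := inferInstanceAs (IsPreimmersion (pullback.fst p (X.fromSpecStalk η)))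
  have hrange : Set.range j = p ⁻¹' {η} := by
    have h : Set.range j = p ⁻¹' Set.range (X.fromSpecStalk η) := Scheme.Pullback.range_fst _ _
    rw [h, Scheme.range_fromSpecStalk]
    ext w
    exact ⟨fun h ↦ mem_genericPoints_iff.mp hη _ h, fun h ↦ specializes_of_eq h⟩
  have hinj : Function.Injective j := j.isEmbedding.injective
  obtain ⟨c₀, hc₀⟩ : genericPoint W ∈ Set.range j := hrange ▸ hgen
  have hspec (c : C) : c₀ ⤳ c :=
    j.isEmbedding.isInducing.specializes_iff.mp (hc₀ ▸ genericPoint_specializes _)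
  have : IrreducibleSpace C := by
    have : closure {c₀} = Set.univ := Set.eq_univ_of_forall fun c ↦ (hspec c).mem_closure
    have hirr : IsIrreducible (Set.univ : Set C) := this ▸ isIrreducible_singleton.closure
    exact { isPreirreducible_univ := hirr.2, toNonempty := ⟨c₀⟩ }
  have hstalk (c : C) := bijective_stalkMap j c
  have : IsReduced C := by
    have (c : C) : _root_.IsReduced (C.presheaf.stalk c) :=
      isReduced_of_injective (RingEquiv.ofBijective _ (hstalk c)).symm
        (RingEquiv.injective _)
    exact isReduced_of_isReduced_stalk C
  have : IsIntegral C := isIntegral_of_irreducibleSpace_of_isReduced C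
  obtain ⟨κ, _, π, ι, _, hσ⟩ := exists_comp_isClosedImmersion σ fun a ha ↦
    isNilpotent_of_mem_maximalIdeal hη ha
  have : IsProper σ := inferInstanceAs (IsProper (pullback.snd p (X.fromSpecStalk η)))
  have : IsProper (π ≫ ι) := hσ ▸ this
  have : IsProper π := .of_comp π ι
  have : IsLocallyNoetherian C := LocallyOfFiniteType.isLocallyNoetherian π
  have hjη (c : C) : p (j c) = η :=
    (hrange ▸ Set.mem_range_self c : j c ∈ p ⁻¹' {η})
  have hW (c : C) : Ring.KrullDimLE 1 (W.presheaf.stalk (j c)) :=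
    krullDimLE_of_coheight_le (hco _ (hjη c))
  have hC (c : C) : Ring.KrullDimLE 1 (C.presheaf.stalk c) := by
    rw [Ring.krullDimLE_iff, ← ringKrullDim_eq_of_ringEquiv (RingEquiv.ofBijective _ (hstalk c))]
    exact Ring.krullDimLE_iff.mp (hW c)
  have hjgen : j (genericPoint C) = genericPoint W :=
    ((genericPoint_specializes c₀).map j.continuous |>.trans (specializes_of_eq hc₀)).antisymm
      (genericPoint_specializes _) |>.eq
  have hres (c : C) : p.residueDegree (j c) = π.residueDegree c := by
    have h := residueDegree_congr (show j ≫ p = (π ≫ ι) ≫ X.fromSpecStalk η by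
      rw [hσ]; exact pullback.condition) c
    rwa [residueDegree_comp, residueDegree_comp, residueDegree_comp, residueDegree_eq_one j,
      residueDegree_eq_one (X.fromSpecStalk η), residueDegree_eq_one ι, one_mul, mul_one,
      mul_one] at h
  have hord (c : C) : Scheme.ord g (j c) =
      ordInt (C.presheaf.stalk c) (functionFieldMap j hjgen g) := by
    rw [ordInt_functionFieldMap j hjgen c hg]
    by_cases h1 : Order.coheight (j c) = 1
    · exact ord_eq_ordInt h1 g
    -- The generic point of `W` also lies in the fibre. There `Scheme.ord` is `0` by definition,
    -- while `ordInt` vanishes because the stalk is a field.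
    · have h0 : Order.coheight (j c) = 0 :=
        Order.lt_one_iff.mp (lt_of_le_of_ne (hco _ (hjη c)) h1)
      rw [Scheme.ord_eq_zero_of_coheight_neq_one h1]
      have := krullDimLE_of_coheight_le (n := 0) h0.le
      exact (ordInt_of_isField Ring.KrullDimLE.isField_of_isDomain hg).symm
  have hcore := finsum_ordInt_mul_residueDegree π
    ((map_ne_zero_iff _ (functionFieldMap j hjgen).injective).mpr hg)
  rw [← hrange, finsum_mem_range hinj, ← hcore]
  exact finsum_congr fun c ↦ by rw [hord, hres]

end Localize

lemma topologicalKrullDim_eq_krullDim {T β : Type*} [TopologicalSpace T] [QuasiSober T]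
    [T0Space T] [Preorder β] (e : T ≃ β) (h : ∀ a b, e a ≤ e b ↔ b ⤳ a) :
    topologicalKrullDim T = Order.krullDim β := by
  let _ := specializationOrder T
  let e' : T ≃o β := ⟨e, @h⟩
  rw [topologicalKrullDim]
  exact Order.krullDim_eq_of_orderIso (irreducibleSetEquivPoints.trans e')

section Height

variable {X Y : Scheme.{u}}

lemma height_eq_of_isPureDimensional {n : ℕ} (hX : IsPureDimensional X n) {η : X}
    (hη : η ∈ genericPoints X) : Order.height η = n := by
  let Z : Set X := closure {η}
  have hZ : IsClosed Z := isClosed_closure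
  have h : topologicalKrullDim Z = n := hX Z hη
  have : QuasiSober Z := hZ.isClosedEmbedding_subtypeVal.quasiSober
  let e : Z ≃ Set.Iic η :=
    { toFun := fun x ↦ ⟨x.1, specializes_iff_mem_closure.mpr x.2⟩
      invFun := fun x ↦ ⟨x.1, specializes_iff_mem_closure.mp x.2⟩
      left_inv := fun _ ↦ rfl
      right_inv := fun _ ↦ rfl }
  rw [topologicalKrullDim_eq_krullDim e fun a b ↦ (subtype_specializes_iff b a).symm,
    ← Order.height_eq_krullDim_Iic] at h
  exact_mod_cast h

/-- A fibre of a finite morphism is the spectrum of an Artinian ring, hence discrete, and has no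
proper specializations. -/
lemma eq_of_specializes_of_isFinite (r : Y ⟶ X) [IsFinite r] {y y' : Y} (h : y' ⤳ y)
    (he : r y' = r y) : y' = y := by
  let F := r.fiber (r y)
  let κ := X.residueField (r y)
  let s : F ⟶ Spec κ := r.fiberToSpecResidueField (r y)
  have : IsFinite s := inferInstanceAs (IsFinite (pullback.snd r (X.fromSpecResidueField (r y))))
  have hfin : ((Scheme.ΓSpecIso κ).inv ≫ s.appTop).hom.Finite := RingHom.Finite.comp s.finite_appTop
    (.of_surjective _ (Scheme.ΓSpecIso κ).symm.commRingCatIsoToRingEquiv.surjective)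
  let _ := ((Scheme.ΓSpecIso κ).inv ≫ s.appTop).hom.toAlgebra
  have : Module.Finite κ Γ(F, ⊤) := hfin
  have : IsArtinianRing Γ(F, ⊤) := .of_finite κ _
  have : IsAffine F := isAffine_of_isAffineHom s
  have : DiscreteTopology (Spec Γ(F, ⊤)) :=
    inferInstanceAs (DiscreteTopology (PrimeSpectrum Γ(F, ⊤)))
  have : DiscreteTopology F := F.isoSpec.hom.homeomorph.symm.discreteTopology
  let a := (r.fiberHomeo (r y)).symm ⟨y, rfl⟩
  let a' := (r.fiberHomeo (r y)).symm ⟨y', he⟩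
  have ha : r.fiberι (r y) a = y := r.fiberι_fiberHomeo_symm _ _
  have ha' : r.fiberι (r y) a' = y' := r.fiberι_fiberHomeo_symm _ _
  have haa : a' ⤳ a := (r.fiberι (r y)).isEmbedding.isInducing.specializes_iff.mp
    (by rw [ha, ha']; exact h)
  rw [← ha, ← ha', haa.eq]

lemma height_le_apply_of_isFinite (r : Y ⟶ X) [IsFinite r] (y : Y) :
    Order.height y ≤ Order.height (r y) := by
  refine Order.height_le_height_apply_of_strictMono r (fun a b hab ↦ ?_) y
  have h : b ⤳ a := hab.le
  refine lt_of_le_not_ge (h.map r.continuous) fun h' ↦ hab.not_ge ?_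
  exact specializes_of_eq (eq_of_specializes_of_isFinite r h
    ((h.map r.continuous).antisymm h').eq).symm

end Height

/-! ### The degree of a cycle on a part of a fibre -/

section FiberDegree

variable {P W X : Scheme.{u}}

lemma finite_support_cycle [CompactSpace P] (c : AlgebraicCycle P ℤ) :
    (Function.support c).Finite := by
  have h := (Function.locallyFinsupp.locallyFiniteSupport c).finite_inter_support_of_isCompact
    isCompact_univ
  rwa [Set.univ_inter] at h

/-- The degree over `X` of the part in `S` of a cycle. -/
noncomputable def fiberDegree [CompactSpace P] (q : P ⟶ X) (S : Set P) :
    AlgebraicCycle P ℤ →+ ℤ where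
  toFun c := ∑ᶠ w ∈ S, c w * (q.residueDegree w : ℤ)
  map_zero' := by simp
  map_add' c d := by
    have h (c : AlgebraicCycle P ℤ) :
        (S ∩ Function.support fun w ↦ c w * (q.residueDegree w : ℤ)).Finite :=
      (finite_support_cycle c).subset fun w hw h ↦ hw.2 (by simp [h])
    rw [← finsum_mem_add_distrib' (h c) (h d)]
    exact finsum_mem_congr rfl fun w _ ↦ add_mul _ _ _

lemma fiberDegree_apply [CompactSpace P] (q : P ⟶ X) (S : Set P) (c : AlgebraicCycle P ℤ) :
    fiberDegree q S c = ∑ᶠ w ∈ S, c w * (q.residueDegree w : ℤ) := rfl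

lemma fiberDegree_congr [CompactSpace P] {q q' : P ⟶ X} (h : q = q') (S : Set P) :
    fiberDegree q S = fiberDegree q' S := by
  rw [h]

lemma map_apply_of_isClosedImmersion (i : W ⟶ P) [IsClosedImmersion i] (c : AlgebraicCycle W ℤ)
    (w : W) : AlgebraicCycle.map i Order.height Order.height c (i w) = c w := by
  have h : i ⁻¹' {i w} = {w} := by
    ext w'
    exact i.isClosedEmbedding.injective.eq_iff
  have h' : Order.height w = Order.height (i.base w) := (height_apply_of_isClosedImmersion i w).symm
  rw [AlgebraicCycle.map, Function.locallyFinsupp.map_apply, h, finsum_mem_singleton,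
    AlgebraicCycle.mapCoeff, if_pos h', residueDegree_eq_one, Nat.cast_one, mul_one]

lemma map_apply_of_notMem_range (i : W ⟶ P) [QuasiCompact i] (c : AlgebraicCycle W ℤ)
    {y : P} (hy : y ∉ Set.range i) : AlgebraicCycle.map i Order.height Order.height c y = 0 := by
  rw [AlgebraicCycle.map, Function.locallyFinsupp.map_apply,
    Set.preimage_singleton_eq_empty.mpr hy, finsum_mem_empty]

lemma fiberDegree_map [CompactSpace P] [CompactSpace W] (q : P ⟶ X) (i : W ⟶ P)
    [IsClosedImmersion i] (S : Set P) (c : AlgebraicCycle W ℤ) :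
    fiberDegree q S (AlgebraicCycle.map i Order.height Order.height c) =
      fiberDegree (i ≫ q) (i ⁻¹' S) c := by
  rw [fiberDegree_apply, fiberDegree_apply, finsum_mem_inter_support_eq' _ S (i '' (i ⁻¹' S)),
    finsum_mem_image i.isClosedEmbedding.injective.injOn]
  · refine finsum_mem_congr rfl fun w _ ↦ ?_
    rw [map_apply_of_isClosedImmersion, residueDegree_comp, residueDegree_eq_one i, one_mul]
  · intro y hy
    have hyr : y ∈ Set.range i := by
      by_contra h
      exact hy (by beta_reduce; rw [map_apply_of_notMem_range i c h, zero_mul])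
    obtain ⟨w, rfl⟩ := hyr
    exact (i.isClosedEmbedding.injective.mem_set_image (s := i ⁻¹' S)).symm

/-- The degree over a generic point of a cycle rationally equivalent to zero vanishes. -/
theorem fiberDegree_eq_zero_of_mem_rationalEquivalence [CompactSpace P] (q : P ⟶ X) [IsProper q]
    {n : ℕ} {η : X} (hη : η ∈ genericPoints X) (hn : n ≤ Order.height η) {V : Set P}
    (hV : IsClopen V) {c : cycleGroup P n} (hc : c ∈ rationalEquivalence P n) :
    fiberDegree q (q ⁻¹' {η} ∩ V) c.1 = 0 := by
  let ψ : cycleGroup P n →+ ℤ :=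
    (fiberDegree q (q ⁻¹' {η} ∩ V)).comp (cycleGroup P n).subtype
  suffices h : rationalEquivalence P n ≤ ψ.ker from h hc
  rw [rationalEquivalence, AddSubgroup.closure_le]
  rintro c ⟨W, _, _, i, _, g, hg, hW, hci⟩
  change fiberDegree q (q ⁻¹' {η} ∩ V) c.1 = 0
  have : CompactSpace W := i.isClosedEmbedding.compactSpace
  rw [hci, fiberDegree_map]
  -- `W` is irreducible, so restricting to a clopen set keeps either all of its divisor or nothing.
  have hpre : IsClopen (i ⁻¹' V) := hV.preimage i.continuous
  rw [Set.preimage_inter]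
  rcases isClopen_iff.mp hpre with h | h
  · rw [h, Set.inter_empty, fiberDegree_apply, finsum_mem_empty]
  · rw [h, Set.inter_univ]
    refine finsum_ord_mul_residueDegree (i ≫ q) hη (fun w hw ↦ ?_) hg
    -- Since `W → X` is closed, points over `η` have height at least that of `η`, hence at least
    -- `n`, while `W` has dimension `n + 1`.
    refine coheight_le_one_of_height_le hW (hn.trans ?_)
    rw [← hw]
    exact height_apply_le_of_isClosedMap (i ≫ q).isClosedMap w

end FiberDegree

/-! ### Fundamental cycles under finite extension of the base field -/

section Affine

open TensorProduct

/-- The fundamental cycle of a base change of an Artinian local scheme along a finite field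
extension. -/
theorem finsum_length_mul_residueDegree_of_isArtinianRing {A : CommRingCat.{u}} [IsLocalRing A]
    [IsArtinianRing A] {Q : CommRingCat.{u}} [Algebra A Q] [Module.Finite A Q] (φ : A ⟶ Q)
    (hφ : φ.hom = algebraMap A Q) :
    ∑ᶠ y : ↥(Spec Q),
      (Module.length ((Spec Q).presheaf.stalk y) ((Spec Q).presheaf.stalk y)).toNat *
      (Spec.map φ).residueDegree y = (Module.length A Q).toNat := by
  let D := Spec Q
  let _ : Algebra A Γ(D, ⊤) := ((Scheme.ΓSpecIso A).inv ≫ (Spec.map φ).appTop).hom.toAlgebra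
  have hnat : (Scheme.ΓSpecIso A).inv ≫ (Spec.map φ).appTop = φ ≫ (Scheme.ΓSpecIso Q).inv :=
    (Scheme.ΓSpecIso_inv_naturality φ).symm
  let ε : Q →+* Γ(D, ⊤) := (Scheme.ΓSpecIso Q).inv.hom
  have hε : Function.Bijective ε := (Scheme.ΓSpecIso Q).symm.commRingCatIsoToRingEquiv.bijective
  -- The count for zero loci is applied to the zero function, which vanishes at every point and
  -- whose zero scheme is all of `Spec Q`.
  let ε' : Q →+* Γ(D, ⊤) ⧸ Ideal.span {(0 : Γ(D, ⊤))} := (Ideal.Quotient.mk _).comp ε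
  have hbij {S : Type u} [CommRing S] :
      Function.Bijective (Ideal.Quotient.mk (Ideal.span {(0 : S)})) := by
    refine ⟨?_, Ideal.Quotient.mk_surjective⟩
    rw [RingHom.injective_iff_ker_eq_bot, Ideal.mk_ker]
    exact Ideal.span_zero
  have hε' : Function.Bijective ε' := hbij.comp hε
  let e : Q ≃ₗ[A] (Γ(D, ⊤) ⧸ Ideal.span {(0 : Γ(D, ⊤))}) :=
    LinearEquiv.ofBijective
      { toFun := ε'
        map_add' := map_add ε'
        map_smul' := fun a x ↦ by
          rw [Algebra.smul_def, Algebra.smul_def, map_mul, ← hφ]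
          congr 1
          exact congr_arg (Ideal.Quotient.mk _) congr($hnat a).symm } hε'
  have : IsArtinianRing Q := .of_finite A Q
  have : IsArtinianRing (Γ(D, ⊤) ⧸ Ideal.span {(0 : Γ(D, ⊤))}) := hε'.2.isArtinianRing
  have : Module.Finite A (Γ(D, ⊤) ⧸ Ideal.span {(0 : Γ(D, ⊤))}) := .equiv e
  have hA (p : PrimeSpectrum A) : p = IsLocalRing.closedPoint A :=
    PrimeSpectrum.ext (IsLocalRing.eq_maximalIdeal inferInstance)
  have h := (finsum_length_mul_residueDegree (Spec.map φ) (0 : Γ(D, ⊤)) Module.length_ne_top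
    fun y _ ↦ hA _).2
  rw [e.length_eq, h, ← finsum_mem_univ]
  have huniv : vanishingSet (0 : Γ(D, ⊤)) = Set.univ := Set.eq_univ_of_forall fun y ↦ by
    change D.presheaf.germ ⊤ y trivial 0 ∈ IsLocalRing.maximalIdeal (D.presheaf.stalk y)
    rw [map_zero]
    exact zero_mem _
  rw [huniv]
  refine finsum_mem_congr rfl fun y _ ↦ ?_
  rw [map_zero, length_eq_of_bijective hbij]

end Affine

section Fibre

variable {k κ : Type u} [Field k] [Field κ] [Algebra k κ] [Module.Finite k κ] {X Y : Scheme.{u}}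
  {f : X ⟶ Spec (.of k)} {r : Y ⟶ X} {s : Y ⟶ Spec (.of κ)}

lemma range_of_isPullback {P X Y Z : Scheme.{u}} {p : P ⟶ X} {q : P ⟶ Y} {f : X ⟶ Z} {g : Y ⟶ Z}
    (h : IsPullback p q f g) : Set.range p = f ⁻¹' Set.range g := by
  rw [← Scheme.Pullback.range_fst]
  ext x
  constructor
  · rintro ⟨y, rfl⟩
    exact ⟨h.isoPullback.hom y, by rw [← Scheme.Hom.comp_apply, h.isoPullback_hom_fst]⟩
  · rintro ⟨y, rfl⟩
    exact ⟨h.isoPullback.inv y, by rw [← Scheme.Hom.comp_apply, h.isoPullback_inv_fst]⟩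

-- Localized at `η`, the base change `Y` is the spectrum of `R ⊗[k] κ`, free over `R` of rank `[κ :
-- k]`. Its length over `R` is therefore `[κ : k]` times that of `R`, and the points over `η` share
-- out this length.
open TensorProduct in
theorem fiberDegree_fundamentalCycle_of_isArtinianRing
    (h : IsPullback r s f (Spec.map (CommRingCat.ofHom (algebraMap k κ))))
    [IsLocallyNoetherian Y] [CompactSpace Y] {n : ℕ} {η : X}
    (hη : η ∈ genericPoints X) (hn : Order.height η = n) {R : CommRingCat.{u}} [IsLocalRing R]
    [IsArtinianRing R] (e : Spec R ⟶ X) [Flat e] [IsPreimmersion e] (he : Set.range e = {η}) :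
    fiberDegree r (r ⁻¹' {η}) (fundamentalCycle Y n).1 =
      Module.finrank k κ * (Module.length R R).toNat := by
  let α : CommRingCat.of k ⟶ R := Spec.preimage (e ≫ f)
  have hα : Spec.map α = e ≫ f := Spec.map_preimage _
  let _ : Algebra k R := α.hom.toAlgebra
  let φ : R ⟶ .of (R ⊗[k] κ) :=
    CommRingCat.ofHom (S := R ⊗[k] κ) Algebra.TensorProduct.includeLeftRingHom
  let ρ : CommRingCat.of κ ⟶ .of (R ⊗[k] κ) := CommRingCat.ofHom (S := R ⊗[k] κ)
    (Algebra.TensorProduct.includeRight (R := k) (A := R) (B := κ)).toRingHom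
  have hsq : IsPullback (Spec.map φ) (Spec.map ρ) (e ≫ f)
      (Spec.map (CommRingCat.ofHom (algebraMap k κ))) := by
    rw [← hα]
    exact isPullback_SpecMap_of_isPushout _ _ _ _ (CommRingCat.isPushout_tensorProduct k R κ)
  let j : Spec (.of (R ⊗[k] κ)) ⟶ Y := h.lift (Spec.map φ ≫ e) (Spec.map ρ) (by
    rw [Category.assoc, hsq.w])
  have hj : IsPullback j (Spec.map φ) r e := by
    refine .of_right (h₁₂ := s) ?_ (h.lift_fst _ _ _) h.flip
    rw [h.lift_snd]
    exact hsq.flip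
  have : Flat j := MorphismProperty.of_isPullback hj.flip ‹_›
  have : IsPreimmersion j := MorphismProperty.of_isPullback hj.flip ‹_›
  have : IsFinite (Spec.map (CommRingCat.ofHom (algebraMap k κ))) :=
    (IsFinite.SpecMap_iff _).mpr (RingHom.finite_algebraMap.mpr ‹_›)
  have : IsFinite r := MorphismProperty.of_isPullback h.flip ‹_›
  have hrange : Set.range j = r ⁻¹' {η} := by rw [range_of_isPullback hj, he]
  have hjη (y) : r (j y) = η := (hrange ▸ Set.mem_range_self y : j y ∈ r ⁻¹' {η})
  -- A generalization of a point over `η` again lies over `η`, and a finite morphism has no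
  -- specializations inside a fibre. Hence every point over `η` counts in the fundamental cycle.
  have hgen (y) : j y ∈ genericPoints Y := mem_genericPoints_iff.mpr fun y' hy' ↦
    eq_of_specializes_of_isFinite r hy' (by
      rw [hjη]
      exact mem_genericPoints_iff.mp hη _ (hjη y ▸ hy'.map r.continuous))
  have hheight (y) : Order.height (j y) = n := by
    rw [← hn, ← hjη y]
    exact (height_le_apply_of_isFinite r _).antisymm
      (height_apply_le_of_isClosedMap r.isClosedMap _)
  have hsum := finsum_length_mul_residueDegree_of_isArtinianRing (Q := .of (R ⊗[k] κ)) φ rfl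
  have hlen := Module.length_of_free_of_finite R (R ⊗[k] κ)
  rw [Module.finrank_baseChange] at hlen
  rw [fiberDegree_apply, ← hrange, finsum_mem_range j.isEmbedding.injective]
  have hterm (y) : (fundamentalCycle Y n).1 (j y) * (r.residueDegree (j y) : ℤ) =
      ((Module.length ((Spec (.of (R ⊗[k] κ))).presheaf.stalk y)
        ((Spec (.of (R ⊗[k] κ))).presheaf.stalk y)).toNat * (Spec.map φ).residueDegree y : ℕ) := by
    have h1 : (fundamentalCycle Y n).1 (j y) =
        (Module.length (Y.presheaf.stalk (j y)) (Y.presheaf.stalk (j y))).toNat :=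
      if_pos ⟨hgen y, hheight y⟩
    have h2 := residueDegree_congr hj.w y
    rw [residueDegree_comp, residueDegree_comp, residueDegree_eq_one j,
      residueDegree_eq_one e, one_mul, mul_one] at h2
    rw [h1, h2, length_eq_of_bijective (bijective_stalkMap j y), Nat.cast_mul]
  rw [finsum_congr hterm]
  have : IsArtinianRing (R ⊗[k] κ) := .of_finite R _
  have : Finite (Spec (.of (R ⊗[k] κ))) := inferInstanceAs (Finite (PrimeSpectrum (R ⊗[k] κ)))
  refine (AddMonoidHom.map_finsum (Nat.castAddMonoidHom ℤ) (Set.toFinite _)).symm.trans ?_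
  rw [hsum]
  change ((Module.length R (R ⊗[k] κ)).toNat : ℤ) = _
  rw [hlen, ENat.toNat_mul, ENat.toNat_natCast, Nat.cast_mul]

lemma isArtinianRing_stalk {X : Scheme.{u}} [IsLocallyNoetherian X] {η : X}
    (hη : η ∈ genericPoints X) : IsArtinianRing (X.presheaf.stalk η) := by
  have : Ring.KrullDimLE 0 (X.presheaf.stalk η) := by
    refine krullDimLE_of_coheight_le (n := 0) ?_
    rw [Nat.cast_zero, nonpos_iff_eq_zero, Order.coheight_eq_zero]
    intro y hy
    exact specializes_of_eq (mem_genericPoints_iff.mp hη y hy).symm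
  exact isArtinianRing_iff_isNoetherianRing_krullDimLE_zero.mpr ⟨inferInstance, this⟩

/-- The degree over a generic point of the fundamental cycle of the base change along a finite
field extension. -/
theorem fiberDegree_fundamentalCycle_of_isPullback
    (h : IsPullback r s f (Spec.map (CommRingCat.ofHom (algebraMap k κ))))
    [IsLocallyNoetherian X] [IsLocallyNoetherian Y] [CompactSpace Y] {n : ℕ} {η : X}
    (hη : η ∈ genericPoints X) (hn : Order.height η = n) :
    fiberDegree r (r ⁻¹' {η}) (fundamentalCycle Y n).1 =
      Module.finrank k κ * (Module.length (X.presheaf.stalk η) (X.presheaf.stalk η)).toNat := by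
  have := flat_fromSpecStalk X η
  have := isArtinianRing_stalk hη
  refine fiberDegree_fundamentalCycle_of_isArtinianRing h hη hn (X.fromSpecStalk η) ?_
  rw [Scheme.range_fromSpecStalk]
  ext w
  exact ⟨fun h ↦ mem_genericPoints_iff.mp hη _ h, fun h ↦ specializes_of_eq h⟩

end Fibre

/-! ### Residue fields of points as extensions of the base field -/

section ResidueField

variable {k : Type u} [Field k] {X : Scheme.{u}} (f : X ⟶ Spec (.of k))

lemma fromSpecStalk_comp_eq_SpecMap {A : CommRingCat.{u}} (d : X ⟶ Spec A) (x : X) :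
    X.fromSpecStalk x ≫ d = Spec.map (toStalk d x) := by
  refine (Scheme.SpecMap_stalkMap_fromSpecStalk d).symm.trans ?_
  rw [Spec.fromSpecStalk_eq']
  exact (Spec.map_comp _ _).symm.trans (congr_arg Spec.map (toStalk_eq d x).symm)

/-- The extension of the base field given by a residue field. -/
noncomputable def residueFieldHom (x : X) : CommRingCat.of k ⟶ X.residueField x :=
  toStalk f x ≫ X.residue x

lemma SpecMap_residueFieldHom (x : X) :
    Spec.map (residueFieldHom f x) = X.fromSpecResidueField x ≫ f := by
  rw [residueFieldHom, Spec.map_comp, ← fromSpecStalk_comp_eq_SpecMap]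
  exact (Category.assoc _ _ _).symm

lemma finrank_residueFieldHom (x : X) :
    letI := (residueFieldHom f x).hom.toAlgebra
    Module.finrank k (X.residueField x) = f.residueDegree x := by
  let _ := (residueFieldHom f x).hom.toAlgebra
  obtain ⟨h1, h2⟩ := localDegree_toStalk (A := .of k) f
    (y := x) (Subsingleton.elim (α := PrimeSpectrum k) _ _)
  rw [← h2]
  let _ := (IsLocalRing.ResidueField.map (toStalk f x).hom).toAlgebra
  let i : k ≃+* IsLocalRing.ResidueField k :=
    .ofBijective (IsLocalRing.residue k) ⟨RingHom.injective _, IsLocalRing.residue_surjective⟩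
  exact Algebra.finrank_eq_of_equiv_equiv i (RingEquiv.refl (X.residueField x)) (by ext; rfl)

lemma finite_residueFieldHom [LocallyOfFiniteType f] {x : X} (hx : IsClosed {x}) :
    (residueFieldHom f x).hom.Finite := by
  rw [← IsFinite.SpecMap_iff, SpecMap_residueFieldHom]
  have := isClosed_singleton_iff_isClosedImmersion.mp hx
  have : Subsingleton (Spec (X.residueField x)) :=
    inferInstanceAs (Subsingleton (PrimeSpectrum (X.residueField x)))
  have : JacobsonSpace (Spec (.of k)) := inferInstanceAs (JacobsonSpace (PrimeSpectrum k))
  exact isFinite_iff_locallyOfFiniteType_of_jacobsonSpace.mpr inferInstance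

lemma isClosed_singleton_of_height_eq_zero {x : X} (hx : Order.height x = 0) : IsClosed {x} := by
  rw [← closure_subset_iff_isClosed]
  intro y hy
  have h : x ⤳ y := specializes_iff_mem_closure.mpr hy
  exact (h.antisymm (Order.height_eq_zero.mp hx h)).eq.symm

end ResidueField

/-! ### Degrees of the three cycles in the decomposition -/

section Diagonal

variable {k : Type u} [Field k] {X : Scheme.{u}} (f : X ⟶ Spec (.of k)) {n : ℕ}

lemma fiberDegree_eq_zero_of_notDominatesFirstFactor [CompactSpace ↥(pullback f f)] {η : X}
    (hη : η ∈ genericPoints X) (U : Set ↥(pullback f f)) {Z : cycleGroup (pullback f f) n}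
    (hZ : NotDominatesFirstFactor f Z) :
    fiberDegree (pullback.fst f f) (pullback.fst f f ⁻¹' {η} ∩ U) Z.1 = 0 := by
  rw [fiberDegree_apply]
  refine finsum_mem_eq_zero_of_forall_eq_zero fun w hw ↦ ?_
  by_cases h : Z.1 w = 0
  · rw [h, zero_mul]
  · exact absurd (show pullback.fst f f w ∈ genericPoints X from
      (show pullback.fst f f w = η from hw.1) ▸ hη) (hZ w h)

variable [IsProper f]

lemma compactSpace_of_isProper {Y : Scheme.{u}} (g : Y ⟶ Spec (.of k)) [IsProper g] :
    CompactSpace Y :=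
  (quasiCompact_iff_compactSpace g).mp inferInstance

/-- The diagonal is a section of both projections: its only point over `η` has second projection `η`
and residue degree one. -/
theorem fiberDegree_diagonalCycle [CompactSpace ↥(pullback f f)] {η : X}
    (hη : η ∈ genericPoints X) (hn : Order.height η = n) (U : Set X) [Decidable (η ∈ U)] :
    fiberDegree (pullback.fst f f) (pullback.fst f f ⁻¹' {η} ∩ pullback.snd f f ⁻¹' U)
      (diagonalCycle f n).1 =
    if η ∈ U then ((Module.length (X.presheaf.stalk η) (X.presheaf.stalk η)).toNat : ℤ) else 0 := by
  have : IsLocallyNoetherian X := LocallyOfFiniteType.isLocallyNoetherian f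
  have := compactSpace_of_isProper f
  change fiberDegree _ _ (AlgebraicCycle.map (pullback.diagonal f) Order.height Order.height
    (fundamentalCycle X n).1) = _
  have hpre : pullback.diagonal f ⁻¹' (pullback.fst f f ⁻¹' {η} ∩ pullback.snd f f ⁻¹' U) =
      {η} ∩ U := by
    change (pullback.diagonal f ≫ pullback.fst f f) ⁻¹' {η} ∩
      (pullback.diagonal f ≫ pullback.snd f f) ⁻¹' U = _
    rw [pullback.diagonal_fst, pullback.diagonal_snd]
    rfl
  rw [fiberDegree_map, hpre, fiberDegree_congr (pullback.diagonal_fst f), fiberDegree_apply]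
  split_ifs with h
  · rw [Set.inter_eq_left.mpr (Set.singleton_subset_iff.mpr h), finsum_mem_singleton,
      residueDegree_eq_one, Nat.cast_one, mul_one]
    exact if_pos ⟨hη, hn⟩
  · rw [Set.singleton_inter_eq_empty.mpr h, finsum_mem_empty]

/-- All of `X × {x}` projects to `x`, so `U` keeps everything or nothing. As a scheme over the first
factor it is the base change of `X` along `κ(x) / k`. -/
theorem fiberDegree_prodPointCycle [CompactSpace ↥(pullback f f)] {η : X}
    (hη : η ∈ genericPoints X) (hn : Order.height η = n) (U : Set X) {x : X} [Decidable (x ∈ U)]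
    (hx : IsClosed {x}) :
    fiberDegree (pullback.fst f f) (pullback.fst f f ⁻¹' {η} ∩ pullback.snd f f ⁻¹' U)
      (prodPointCycle f n x).1 =
    if x ∈ U then (f.residueDegree x *
      (Module.length (X.presheaf.stalk η) (X.presheaf.stalk η)).toNat : ℤ) else 0 := by
  have : IsLocallyNoetherian X := LocallyOfFiniteType.isLocallyNoetherian f
  let Y := (pullback.snd f f).fiber x
  let i : Y ⟶ pullback f f := (pullback.snd f f).fiberι x
  let s : Y ⟶ Spec (X.residueField x) := (pullback.snd f f).fiberToSpecResidueField x
  have : LocallyOfFiniteType s := inferInstanceAs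
    (LocallyOfFiniteType (pullback.snd (pullback.snd f f) (X.fromSpecResidueField x)))
  have : IsLocallyNoetherian Y := LocallyOfFiniteType.isLocallyNoetherian s
  have := isClosed_singleton_iff_isClosedImmersion.mp hx
  have : IsClosedImmersion i := inferInstanceAs
    (IsClosedImmersion (pullback.fst (pullback.snd f f) (X.fromSpecResidueField x)))
  have : CompactSpace Y := i.isClosedEmbedding.compactSpace
  change fiberDegree _ _ (AlgebraicCycle.map i Order.height Order.height
    (fundamentalCycle Y n).1) = _
  rw [fiberDegree_map, Set.preimage_inter]
  change fiberDegree _ ((i ≫ pullback.fst f f) ⁻¹' {η} ∩ _) _ = _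
  have hsnd (y : Y) : pullback.snd f f (i y) = x := by
    have h : i y ∈ Set.range i := ⟨y, rfl⟩
    rwa [(pullback.snd f f).range_fiberι] at h
  split_ifs with h
  · have hU : i ⁻¹' (pullback.snd f f ⁻¹' U) = Set.univ :=
      Set.eq_univ_of_forall fun y ↦ by
        change pullback.snd f f (i y) ∈ U
        rwa [hsnd]
    rw [hU, Set.inter_univ]
    let _ := (residueFieldHom f x).hom.toAlgebra
    have : Module.Finite k (X.residueField x) := finite_residueFieldHom f hx
    have hsq : IsPullback (i ≫ pullback.fst f f) s f (X.fromSpecResidueField x ≫ f) :=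
      (IsPullback.of_hasPullback (pullback.snd f f) (X.fromSpecResidueField x)).paste_horiz
        (IsPullback.of_hasPullback f f)
    rw [← SpecMap_residueFieldHom] at hsq
    rw [← finrank_residueFieldHom f x]
    exact fiberDegree_fundamentalCycle_of_isPullback (κ := X.residueField x) hsq hη hn
  · have hU : i ⁻¹' (pullback.snd f f ⁻¹' U) = ∅ :=
      Set.eq_empty_of_forall_notMem fun y hy ↦ h (by
        rw [← hsnd y]
        exact hy)
    rw [hU, Set.inter_empty, fiberDegree_apply, finsum_mem_empty]

/-- The degree of the part of the `0`-cycle on a clopen subset. -/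
theorem fiberDegree_of_isDecompositionOfDiagonal [CompactSpace X] (hX : IsPureDimensional X n)
    {z : cycleGroup X 0} {Z : cycleGroup (pullback f f) n}
    (hz : IsDecompositionOfDiagonal f n z Z) {η : X} (hη : η ∈ genericPoints X) {U : Set X}
    (hU : IsClopen U) [Decidable (η ∈ U)] : fiberDegree f U z.1 = if η ∈ U then 1 else 0 := by
  classical
  have : IsLocallyNoetherian X := LocallyOfFiniteType.isLocallyNoetherian f
  have : CompactSpace ↥(pullback f f) := compactSpace_of_isProper (pullback.fst f f ≫ f)
  have hn := height_eq_of_isPureDimensional hX hη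
  let S := pullback.fst f f ⁻¹' {η} ∩ pullback.snd f f ⁻¹' U
  let ψ : cycleGroup (pullback f f) n →+ ℤ :=
    (fiberDegree (pullback.fst f f) S).comp (cycleGroup (pullback f f) n).subtype
  set ℓ : ℤ := ((Module.length (X.presheaf.stalk η) (X.presheaf.stalk η)).toNat : ℤ) with hℓ
  -- The stalk at a generic point is Artinian and nonzero, so `toNat` loses nothing and `ℓ` can be
  -- cancelled.
  have hℓ0 : ℓ ≠ 0 := by
    have := isArtinianRing_stalk hη
    rw [hℓ, Nat.cast_ne_zero, ne_eq, ENat.toNat_eq_zero, not_or]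
    exact ⟨Module.length_pos.ne', Module.length_ne_top⟩
  obtain ⟨hZ, hcl⟩ := hz
  -- Equality of classes in the quotient group is membership of this difference in the subgroup, and
  -- `ψ` vanishes there.
  have h0 : ψ (-diagonalCycle f n + (prodCycle f n z + Z)) = 0 :=
    fiberDegree_eq_zero_of_mem_rationalEquivalence (pullback.fst f f) hη hn.ge
      (hU.preimage (pullback.snd f f).continuous) (QuotientAddGroup.eq.mp hcl)
  have hΔ : ψ (diagonalCycle f n) = if η ∈ U then ℓ else 0 := fiberDegree_diagonalCycle f hη hn U
  have hψZ : ψ Z = 0 := fiberDegree_eq_zero_of_notDominatesFirstFactor f hη _ hZ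
  have hprod : ψ (prodCycle f n z) = fiberDegree f U z.1 * ℓ := by
    have hfin := finite_support_cycle z.1
    rw [prodCycle, AddMonoidHom.map_finsum _ (hfin.subset fun x hx h ↦ hx (by
      change z.1 x • _ = _
      rw [h, zero_smul])), fiberDegree_apply, finsum_mem_def,
      finsum_mul]
    refine finsum_congr fun x ↦ ?_
    rw [map_zsmul]
    by_cases hx : z.1 x = 0
    · simp [hx]
    · have h := fiberDegree_prodPointCycle f hη hn U
        (isClosed_singleton_of_height_eq_zero ((z.2 x hx).trans Nat.cast_zero))
      refine (congr_arg (z.1 x • ·) h).trans ?_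
      by_cases hxU : x ∈ U
      · simp [hxU, ℓ, mul_assoc]
      · simp [hxU]
  rw [map_add, map_add, map_neg, hΔ, hψZ, hprod, add_zero] at h0
  have h1 : fiberDegree f U z.1 * ℓ = (if η ∈ U then 1 else 0) * ℓ := by
    rw [ite_mul, one_mul, zero_mul]
    linarith
  exact mul_right_cancel₀ hℓ0 h1

end Diagonal

/-! ### Rings with only trivial idempotents -/

section Idempotents

/-- An integral algebra over a field with only trivial idempotents consists of nilpotent and
invertible elements. -/
lemma isNilpotent_or_isUnit_of_isIntegral {k A : Type*} [Field k] [CommRing A] [Algebra k A]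
    [Algebra.IsIntegral k A] (hA : ∀ e : A, IsIdempotentElem e → e = 0 ∨ e = 1) (a : A) :
    IsNilpotent a ∨ IsUnit a := by
  obtain ⟨p, hp, hpa⟩ := (Algebra.IsIntegral.isIntegral (R := k) a)
  -- Write `p = X ^ m * q` with `X ∤ q` and `u X ^ (m + 1) + v q = 1`. Since `a ^ m q(a) = 0`, the
  -- element `u(a) a ^ (m + 1)` is idempotent. If it is `0` then `a ^ m = 0`; if it is `1` then `a`
  -- is a unit. The exponent `m + 1` keeps a factor `a` even for `m = 0`.
  obtain ⟨q, hq, hXq⟩ := Polynomial.exists_eq_pow_rootMultiplicity_mul_and_not_dvd p hp.ne_zero 0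
  set m := p.rootMultiplicity 0
  rw [map_zero, sub_zero] at hq hXq
  obtain ⟨u, v, huv⟩ : IsCoprime (Polynomial.X ^ (m + 1)) q :=
    ((Polynomial.irreducible_X.coprime_iff_not_dvd).mpr hXq).pow_left
  have h0 : a ^ m * Polynomial.aeval a q = 0 := by
    have h : Polynomial.aeval a p = 0 := hpa
    rwa [hq, map_mul, map_pow, Polynomial.aeval_X] at h
  have h1 := congr_arg (Polynomial.aeval a) huv
  simp only [map_add, map_mul, map_pow, Polynomial.aeval_X, map_one] at h1
  set b := Polynomial.aeval a q
  set u' := Polynomial.aeval a u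
  set v' := Polynomial.aeval a v
  have he : IsIdempotentElem (u' * a ^ (m + 1)) := by
    change u' * a ^ (m + 1) * (u' * a ^ (m + 1)) = u' * a ^ (m + 1)
    linear_combination (u' * a ^ (m + 1)) * h1 - u' * v' * a * h0
  rcases hA _ he with h | h
  · refine .inl ⟨m, ?_⟩
    linear_combination a ^ m * h + v' * h0 - a ^ m * h1
  · refine .inr (.of_mul_eq_one (u' * a ^ m) ?_)
    linear_combination h

/-- A ring generated by a field and by elements which are congruent to scalars modulo nilpotents
has only trivial idempotents. -/
lemma eq_zero_or_eq_one_of_isIdempotentElem {K B : Type*} [Field K] [CommRing B] [Algebra K B]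
    [Nontrivial B] (hB : ∀ b : B, ∃ c : K, IsNilpotent (b - algebraMap K B c)) {e : B}
    (he : IsIdempotentElem e) : e = 0 ∨ e = 1 := by
  obtain ⟨c, hc⟩ := hB e
  have key {e' : B} (he' : IsIdempotentElem e') (h : IsNilpotent e') : e' = 0 := by
    obtain ⟨n, hn⟩ := h
    rw [← he'.pow_succ_eq n, pow_succ, hn, zero_mul]
  -- Modulo nilpotents `c (1 - c)` equals `e (1 - e) = 0`, and a nilpotent scalar is zero. So `e` or
  -- `1 - e` is a nilpotent idempotent.
  have h : c * (1 - c) = 0 := by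
    by_contra h
    have h1 : IsNilpotent (algebraMap K B (c * (1 - c))) := by
      have : algebraMap K B (c * (1 - c)) =
          (e - algebraMap K B c) * (algebraMap K B c + e - 1) := by
        rw [map_mul, map_sub, map_one]
        linear_combination - he.eq
      rw [this]
      exact (Commute.all _ _).isNilpotent_mul_right hc
    exact h1.not_isUnit ((Ne.isUnit h).map _)
  rcases mul_eq_zero.mp h with rfl | h
  · rw [map_zero, sub_zero] at hc
    exact .inl (key he hc)
  · rw [← sub_eq_zero.mp h, map_one] at hc
    have := key he.one_sub (by rwa [← isNilpotent_neg_iff, neg_sub])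
    exact .inr (sub_eq_zero.mp this).symm

end Idempotents

/-! ### Clopen subsets and idempotent global functions -/

section Clopen

variable {X : Scheme.{u}}

lemma isUnit_germ_or_of_isIdempotentElem {e : Γ(X, ⊤)} (x : X) :
    IsUnit (X.presheaf.germ ⊤ x trivial e) ∨ IsUnit (X.presheaf.germ ⊤ x trivial (1 - e)) := by
  rw [map_sub, map_one]
  exact IsLocalRing.isUnit_or_isUnit_one_sub_self _

/-- At each point exactly one of `e` and `1 - e` is a unit, so the locus where `e` is invertible is
clopen. -/
lemma eq_zero_or_eq_one_of_preconnectedSpace [PreconnectedSpace X] {e : Γ(X, ⊤)}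
    (he : IsIdempotentElem e) : e = 0 ∨ e = 1 := by
  have hcompl : (X.basicOpen e : Set X)ᶜ = X.basicOpen (1 - e) := by
    ext x
    rw [Set.mem_compl_iff, SetLike.mem_coe, SetLike.mem_coe, X.mem_basicOpen_top,
      X.mem_basicOpen_top]
    refine ⟨fun h ↦ (isUnit_germ_or_of_isIdempotentElem x).resolve_left h, fun h h' ↦ ?_⟩
    have h0 := congr_arg (X.presheaf.germ ⊤ x trivial) he.mul_one_sub_self
    rw [map_mul, map_zero] at h0
    exact not_isUnit_zero (h0 ▸ h'.mul h)
  have hclopen : IsClopen (X.basicOpen e : Set X) :=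
    ⟨isOpen_compl_iff.mp (hcompl ▸ (X.basicOpen _).isOpen), (X.basicOpen e).isOpen⟩
  have key {e' : Γ(X, ⊤)} (he' : IsIdempotentElem e') (h : (X.basicOpen e' : Set X) = Set.univ) :
      e' = 1 := by
    have : IsUnit e' := by
      refine X.toRingedSpace.isUnit_of_isUnit_germ ⊤ e' fun x _ ↦ ?_
      have : x ∈ (X.basicOpen e' : Set X) := h ▸ Set.mem_univ x
      exact (X.mem_basicOpen_top e' x).mp this
    exact (IsIdempotentElem.iff_eq_one_of_isUnit this).mp he'
  rcases isClopen_iff.mp hclopen with h | h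
  · left
    have := key he.one_sub (by rw [← hcompl, h, Set.compl_empty])
    exact sub_eq_self.mp this
  · exact .inr (key he h)

lemma preconnectedSpace_of_isIdempotentElem
    (hX : ∀ e : Γ(X, ⊤), IsIdempotentElem e → e = 0 ∨ e = 1) : PreconnectedSpace X := by
  rw [preconnectedSpace_iff_clopen]
  intro s hs
  let U : Bool → X.Opens := fun b ↦ if b then ⟨s, hs.2⟩ else ⟨sᶜ, hs.1.isOpen_compl⟩
  -- Gluing `1` on `s` and `0` on its complement gives an idempotent, whose triviality forces `s` to
  -- be empty or everything.
  let σ : ∀ b, Γ(X, U b) := fun b ↦ if b then 1 else 0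
  have hdisj {b c : Bool} (hbc : b ≠ c) : U b ⊓ U c = ⊥ := by
    cases b <;> cases c <;> first | exact absurd rfl hbc | skip
    · exact Opens.ext (Set.compl_inter_self s)
    · exact Opens.ext (Set.inter_compl_self s)
  have hcov : (⊤ : X.Opens) ≤ iSup U := fun x _ ↦ by
    rw [Opens.mem_iSup]
    by_cases h : x ∈ s
    · exact ⟨true, h⟩
    · exact ⟨false, h⟩
  have hcompat : TopCat.Presheaf.IsCompatible X.presheaf U σ := by
    intro b c
    by_cases hbc : b = c
    · subst hbc
      rfl
    · have : Subsingleton Γ(X, U b ⊓ U c) := by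
        rw [hdisj hbc]
        infer_instance
      exact Subsingleton.elim _ _
  obtain ⟨e, he, -⟩ := TopCat.Sheaf.existsUnique_gluing' X.sheaf U ⊤ (fun b ↦ homOfLE le_top)
    hcov σ hcompat
  have hσ (b : Bool) : σ b * σ b = σ b := by
    cases b
    · exact mul_zero _
    · exact mul_one _
  have hidem : IsIdempotentElem (M := Γ(X, ⊤)) e := by
    refine TopCat.Sheaf.eq_of_locally_eq' X.sheaf U ⊤ (fun b ↦ homOfLE le_top) hcov _ _ fun b ↦ ?_
    refine (map_mul _ _ _).trans ?_
    rw [he b]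
    exact hσ b
  have hne (b : Bool) {x : X} (hx : x ∈ U b) : (0 : Γ(X, U b)) ≠ 1 := fun h ↦ by
    have h' := congr_arg (X.presheaf.germ (U b) x hx) h
    rw [map_zero, map_one] at h'
    exact zero_ne_one h'
  rcases hX e hidem with rfl | rfl
  · refine .inl (Set.eq_empty_of_forall_notMem fun x hx ↦ hne true hx ?_)
    exact (map_zero _).symm.trans (he true)
  · refine .inr (Set.eq_univ_of_forall fun x ↦ ?_)
    by_contra hx
    exact hne false hx ((he false).symm.trans (map_one _))

end Clopen

/-! ### The degree of the `0`-cycle and connectedness -/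

section Connected

variable {k : Type u} [Field k] {X : Scheme.{u}} (f : X ⟶ Spec (.of k)) {n : ℕ}

lemma degree_eq_fiberDegree [CompactSpace X] (z : cycleGroup X 0) :
    degree f z = fiberDegree f Set.univ z.1 :=
  (finsum_mem_univ _).symm

variable [IsProper f]

theorem degree_of_isDecompositionOfDiagonal [Nonempty X] (hX : IsPureDimensional X n)
    {z : cycleGroup X 0} {Z : cycleGroup (pullback f f) n}
    (hz : IsDecompositionOfDiagonal f n z Z) : degree f z = 1 := by
  classical
  have := compactSpace_of_isProper f
  obtain ⟨η, hη, -⟩ := exists_mem_genericPoints_specializes (Classical.arbitrary X)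
  rw [degree_eq_fiberDegree, fiberDegree_of_isDecompositionOfDiagonal f hX hz hη isClopen_univ,
    if_pos (Set.mem_univ η)]

/-- The degree of `z` on `U` does not involve `η`. Generic points `η ∈ U` and `ξ ∉ U` would make it
both `1` and `0`. -/
theorem preconnectedSpace_of_isDecompositionOfDiagonal (hX : IsPureDimensional X n)
    {z : cycleGroup X 0} {Z : cycleGroup (pullback f f) n}
    (hz : IsDecompositionOfDiagonal f n z Z) : PreconnectedSpace X := by
  classical
  have := compactSpace_of_isProper f
  rw [preconnectedSpace_iff_clopen]
  intro U hU
  by_contra! h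
  obtain ⟨⟨x, hx⟩, hne⟩ := h
  obtain ⟨y, hy⟩ := (Set.ne_univ_iff_exists_notMem U).mp hne
  obtain ⟨η, hη, hηx⟩ := exists_mem_genericPoints_specializes x
  obtain ⟨ξ, hξ, hξy⟩ := exists_mem_genericPoints_specializes y
  have h1 := fiberDegree_of_isDecompositionOfDiagonal f hX hz hη hU
  rw [fiberDegree_of_isDecompositionOfDiagonal f hX hz hξ hU,
    if_pos (hηx.mem_open hU.isOpen hx),
    if_neg fun h ↦ hy (hξy.mem_closed hU.isClosed h)] at h1
  exact zero_ne_one h1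

end Connected

/-! ### Global functions in the presence of a `0`-cycle of degree one -/

section GlobalSections

lemma nontrivial_globalSections (X : Scheme.{u}) [h : Nonempty X] : Nontrivial Γ(X, ⊤) :=
  (X.presheaf.germ ⊤ h.some trivial).hom.domain_nontrivial

variable {k : Type u} [Field k] {X : Scheme.{u}} (f : X ⟶ Spec (.of k))

/-- The field `A / nilradical A` sits between `k` and `κ(x)`, so the tower law applies. It remains
valid with the convention that infinite degrees are `0`. -/
lemma finrank_quotient_nilradical_dvd_residueDegree {A : Type u} [CommRing A] [Algebra k A]
    [(nilradical A).IsMaximal] (χ : A →+* Γ(X, ⊤))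
    (hχ : χ.comp (algebraMap k A) = ((Scheme.ΓSpecIso (.of k)).inv ≫ f.appTop).hom) (x : X) :
    Module.finrank k (A ⧸ nilradical A) ∣ f.residueDegree x := by
  let _ : Field (A ⧸ nilradical A) := Ideal.Quotient.field _
  let φ : A →+* X.residueField x :=
    ((X.presheaf.germ ⊤ x trivial) ≫ X.residue x).hom.comp χ
  let φ' : A ⧸ nilradical A →+* X.residueField x :=
    Ideal.Quotient.lift _ φ fun a ha ↦ ((mem_nilradical.mp ha).map φ).eq_zero
  let _ := φ'.toAlgebra
  let _ := (residueFieldHom f x).hom.toAlgebra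
  have : IsScalarTower k (A ⧸ nilradical A) (X.residueField x) :=
    .of_algebraMap_eq' (by
      change _ = φ.comp (algebraMap k A)
      change (residueFieldHom f x).hom = ((X.presheaf.germ ⊤ x trivial) ≫ X.residue x).hom.comp
        (χ.comp (algebraMap k A))
      rw [hχ]
      rfl)
  rw [← finrank_residueFieldHom]
  exact Dvd.intro _ (Module.finrank_mul_finrank k (A ⧸ nilradical A) (X.residueField x))

variable [IsProper f]

/-- On a connected proper scheme with a `0`-cycle of degree one, the global functions are constant
up to nilpotents. -/
theorem exists_isNilpotent_sub_of_degree_eq_one [ConnectedSpace X] {z : cycleGroup X 0}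
    (hz : degree f z = 1) (a : Γ(X, ⊤)) :
    ∃ c : k, IsNilpotent (a - ((Scheme.ΓSpecIso (.of k)).inv ≫ f.appTop).hom c) := by
  let F := (Scheme.ΓSpecIso (.of k)).inv ≫ f.appTop
  have hF : F.hom.IsIntegral := by
    apply RingHom.isIntegral_respectsIso.2 (e := (Scheme.ΓSpecIso _).symm.commRingCatIsoToRingEquiv)
    exact isIntegral_appTop_of_universallyClosed f
  algebraize [F.hom]
  have := nontrivial_globalSections X
  have hmax : (nilradical Γ(X, ⊤)).IsMaximal := by
    refine Ideal.isMaximal_iff.mpr ⟨?_, fun J b hJ hb hbJ ↦ ?_⟩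
    · rw [mem_nilradical]
      exact fun ⟨n, hn⟩ ↦ one_ne_zero ((one_pow n).symm.trans hn)
    · rcases isNilpotent_or_isUnit_of_isIntegral (k := k)
        (fun e he ↦ eq_zero_or_eq_one_of_preconnectedSpace he) b with h | h
      · exact absurd (mem_nilradical.mpr h) hb
      · exact (Ideal.eq_top_of_isUnit_mem _ hbJ h) ▸ Submodule.mem_top
  let _ : Field (Γ(X, ⊤) ⧸ nilradical Γ(X, ⊤)) := Ideal.Quotient.field _
  -- Every term of `deg z` is a multiple of the degree of this field over `k`. As the sum is `1`,
  -- the field is `k`.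
  have hdvd : (Module.finrank k (Γ(X, ⊤) ⧸ nilradical Γ(X, ⊤)) : ℤ) ∣ degree f z :=
    finsum_induction (fun m : ℤ ↦ (Module.finrank k (Γ(X, ⊤) ⧸ nilradical Γ(X, ⊤)) : ℤ) ∣ m)
      (dvd_zero _) (fun _ _ ↦ dvd_add) fun x ↦ Dvd.dvd.mul_left (Int.natCast_dvd_natCast.mpr
        (finrank_quotient_nilradical_dvd_residueDegree f (RingHom.id _) rfl x)) _
  rw [hz] at hdvd
  have h1 : Module.finrank k (Γ(X, ⊤) ⧸ nilradical Γ(X, ⊤)) = 1 :=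
    Nat.dvd_one.mp (by exact_mod_cast hdvd)
  obtain ⟨c, hc⟩ := (Algebra.finrank_eq_one_iff_bijective_algebraMap.mp h1).2
    (Ideal.Quotient.mk _ a)
  exact ⟨c, mem_nilradical.mp (Ideal.Quotient.eq.mp hc.symm)⟩

end GlobalSections

/-! ### Base change to arbitrary field extensions -/

section Geometrically

lemma mem_of_isPushout {R A B C : CommRingCat.{u}} {f : R ⟶ A} {g : R ⟶ B} {i : A ⟶ C} {j : B ⟶ C}
    (h : IsPushout f g i j) {P : Subring C} (hi : ∀ a, i.hom a ∈ P) (hj : ∀ b, j.hom b ∈ P)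
    (c : C) :
    c ∈ P := by
  let ι : CommRingCat.of P ⟶ C := CommRingCat.ofHom P.subtype
  let i' : A ⟶ .of P := CommRingCat.ofHom (i.hom.codRestrict P hi)
  let j' : B ⟶ .of P := CommRingCat.ofHom (j.hom.codRestrict P hj)
  have hw : f ≫ i' = g ≫ j' := by
    ext r
    exact congr($(h.w) r)
  have hid : h.desc i' j' hw ≫ ι = 𝟙 C := by
    refine h.hom_ext ?_ ?_
    · rw [h.inl_desc_assoc, Category.comp_id]
      rfl
    · rw [h.inr_desc_assoc, Category.comp_id]
      rfl
  have hc : ι (h.desc i' j' hw c) = c := congr($hid c)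
  rw [← hc]
  exact (h.desc i' j' hw c).2

variable {k : Type u} [Field k] {X : Scheme.{u}} (f : X ⟶ Spec (.of k)) [IsProper f]

lemma appLE_top {X Y : Scheme.{u}} (f : X ⟶ Y) : f.appLE ⊤ ⊤ le_top = f.appTop :=
  f.appLE_eq_app

/-- By flat base change `Γ(Y, ⊤)` is the pushout of `Γ(X, ⊤)` and `K` over `k`. Elements of either
factor are scalars up to nilpotents, hence so is everything, and only trivial idempotents remain. -/
theorem geometricallyConnected_of_degree_eq_one [ConnectedSpace X] {z : cycleGroup X 0}
    (hz : degree f z = 1) : GeometricallyConnected f := by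
  refine ⟨fun K _ y Y r s h ↦ ?_⟩
  have := compactSpace_of_isProper f
  have hr : Function.Surjective r := by
    rw [← Set.range_eq_univ, range_of_isPullback h]
    refine Set.eq_univ_of_forall fun x ↦ ?_
    exact ⟨Classical.arbitrary (PrimeSpectrum K), Subsingleton.elim (α := PrimeSpectrum k) _ _⟩
  have : Nonempty Y := ⟨(hr (Classical.arbitrary X)).choose⟩
  have : Flat y := by
    obtain ⟨φ, rfl⟩ := Spec.map_surjective y
    rw [Flat.SpecMap_iff]
    let _ := φ.hom.toAlgebra
    exact (inferInstance : Module.Flat k K)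
  have : QuasiSeparatedSpace X := (quasiSeparated_iff_quasiSeparatedSpace f).mp inferInstance
  have := isIso_pushoutSection_of_isQuasiSeparated_of_flat_right h (US := ⊤) (UT := ⊤) (UX := ⊤)
    (UY := ⊤) le_top le_top (by simp) (isAffineOpen_top _) (isAffineOpen_top _) isCompact_univ
    (isQuasiSeparated_univ)
  have hpush : IsPushout f.appTop y.appTop r.appTop s.appTop := by
    rw [← appLE_top, ← appLE_top, ← appLE_top, ← appLE_top]
    exact (isIso_pushoutSection_iff h _ _ _).mp this
  have := nontrivial_globalSections Y
  let _ : Algebra K Γ(Y, ⊤) := ((Scheme.ΓSpecIso (.of K)).inv ≫ s.appTop).hom.toAlgebra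
  let N := nilradical Γ(Y, ⊤)
  -- `P` consists of the functions that are scalars from `K` modulo nilpotents. Being a subring, it
  -- is everything once it contains both factors of the pushout.
  let P : Subring Γ(Y, ⊤) :=
    ((Ideal.Quotient.mk N).comp (algebraMap K Γ(Y, ⊤))).range.comap (Ideal.Quotient.mk N)
  have hs (t : Γ(Spec (.of K), ⊤)) : s.appTop t ∈ P := by
    refine ⟨(Scheme.ΓSpecIso (.of K)).hom t,
      congr_arg (fun t ↦ Ideal.Quotient.mk N (s.appTop t)) ?_⟩
    exact congr($((Scheme.ΓSpecIso (.of K)).hom_inv_id) t)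
  have hP := mem_of_isPushout hpush (P := P) (fun a ↦ ?_) hs
  · have : PreconnectedSpace Y := preconnectedSpace_of_isIdempotentElem fun e ↦
      eq_zero_or_eq_one_of_isIdempotentElem (K := K) fun b ↦ by
        obtain ⟨c, hc⟩ : b ∈ P := hP b
        exact ⟨c, mem_nilradical.mp (Ideal.Quotient.eq.mp hc.symm)⟩
    exact { toPreconnectedSpace := this, toNonempty := ‹Nonempty Y› }
  · obtain ⟨c, hc⟩ := exists_isNilpotent_sub_of_degree_eq_one f hz a
    let F := (Scheme.ΓSpecIso (.of k)).inv ≫ f.appTop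
    have h1 : r.appTop (a - F c) ∈ P := by
      refine ⟨0, ?_⟩
      rw [map_zero]
      exact (Ideal.Quotient.eq_zero_iff_mem.mpr (mem_nilradical.mpr (hc.map r.appTop.hom))).symm
    have h2 : r.appTop (F c) ∈ P := by
      have hw : r.appTop (F c) = s.appTop (y.appTop ((Scheme.ΓSpecIso (.of k)).inv c)) :=
        congr($(hpush.w) _)
      rw [hw]
      exact hs _
    have h3 := add_mem h1 h2
    rwa [← map_add, sub_add_cancel] at h3

end Geometrically

end ChowTheory

theorem mainTheorem10 {k : Type u} [Field k] {X : AlgebraicGeometry.Scheme.{u}} [Nonempty X]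
    (f : X ⟶ AlgebraicGeometry.Spec (.of k)) [IsProper f]
    (n : ℕ) (hX : ChowTheory.IsPureDimensional X n)
    (z : ChowTheory.cycleGroup X 0)
    (Z : ChowTheory.cycleGroup (pullback f f) n)
    (hz : ChowTheory.IsDecompositionOfDiagonal f n z Z) :
    ChowTheory.degree f z = 1 ∧ GeometricallyConnected f := by
  have hdeg := ChowTheory.degree_of_isDecompositionOfDiagonal f hX hz
  have := ChowTheory.preconnectedSpace_of_isDecompositionOfDiagonal f hX hz
  have : ConnectedSpace X := { toPreconnectedSpace := this, toNonempty := ‹Nonempty X› }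
  exact ⟨hdeg, ChowTheory.geometricallyConnected_of_degree_eq_one f hdeg⟩
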